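/- Let $n\ge 1$, $\lambda>0$, $\mu\in\mathbb R\setminus\{0\}$, and write $x=(x_0,\vec x)\in\mathbb R\times\mathbb R^{n-1}=\mathbb R^n$. Put $(\mathcal Ff)(p)=\int e^{-ip\cdot x}f(x)\,d^nx$, let $\mathcal S_c$ be the space of Schwartz functions on $\mathbb R^n$ supported in some $K\times\mathbb R^{n-1}$ with $K\subset\mathbb R$ compact, and let $\mathcal A=\mathcal F(\mathcal S_c)$ with product $f\star g=\mathcal F^{-1}(\mathcal Ff\,\hat\star\,\mathcal Fg)$ and involution $f^*=\mathcal F^{-1}((\mathcal Ff)^{\hat *})$, where $$(k\hat\star l)(a)=\int k\big(a_0-b_0,\ \vec a-e^{-\lambda(a_0-b_0)}\vec b\big)\,l(b)\,\frac{d^nb}{(2\pi)^n},\qquad k^{\hat *}(a)=e^{\lambda(n-1)a_0}\,\overline{k(-a_0,-e^{\lambda a_0}\vec a)} .$$ Let $\mathcal H_r$ be the GNS Hilbert space of the weight $\omega(f)=\int f(x)\,d^nx$ on $\mathcal A$, i.e. the completion of $\mathcal A$ for $\langle f,g\rangle=\omega(f^*\star g)$ (through $f\mapsto\mathcal Ff$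 it is $L^2(\mathbb R^n,(2\pi)^{-n}e^{-\lambda(n-1)p_0}d^np)$), on which $\mathcal A$ acts by $\pi(f)\psi=f\star\psi$ and functions of $P_\nu=-i\partial_\nu$ act as Fourier multipliers. On $\mathcal H=\mathcal H_r\otimes\mathbb C^{2^{[n/2]}}$ let $D=\sum_{\nu=0}^{n-1}\Gamma^\nu D_\nu$, with $D_0=\lambda^{-1}(1-e^{-\lambda P_0})$, $D_j=P_j$ for $1\le j\le n-1$, and Hermitian matrices $\Gamma^\nu$ such that $\Gamma^\nu\Gamma^\rho+\Gamma^\rho\Gamma^\nu=2\delta^{\nu\rho}$. Let $\Delta_\Phi=e^{-\lambda P_0}$ and $\Phi(\cdot)=\mathrm{Tr}(\Delta_\Phi\,\cdot\,)$. Let $\mathrm{Re}(z)>n$. Then for every $f\in\mathcal A$ the operator $\Delta_\Phi\,\pi(f)(D^2+\mu^2)^{-z/2}$ is everywhere defined, bounded and of trace class on $\mathcal H$, and $$\zeta_f(z):=\Phi\big(f(D^2+\mu^2)^{-z/2}\big)=\frac{2^{[n/2]}}{(2\pi)^n}\,I(z)\int f(x)\,d^nx,\qquad I(z)=\tfrac12\big(I_c(z)+I_\lambda(z)\big),$$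 where $$I_c(z)=\int_{\mathbb R^n}(\xi^2+\mu^2)^{-z/2}\,d^n\xi=\pi^{n/2}|\mu|^{n-z}\,\frac{\Gamma\left(\frac{z-n}{2}\right)}{\Gamma\left(\frac z2\right)},$$ $$I_\lambda(z)=2\,\pi^{(n-1)/2}|\mu|^{(n-1)-z}\,\frac{\Gamma\left(\frac{z-(n-1)}{2}\right)}{\Gamma\left(\frac z2\right)}\,\lambda^{-1}\,{}_2F_1\!\left(\tfrac12,\tfrac{z-(n-1)}2;\tfrac32;-\tfrac1{(\lambda\mu)^2}\right),$$ and ${}_2F_1$ denotes the hypergeometric function continued analytically to $\mathbb C\setminus[1,\infty)$. Moreover $I(z)\to I_c(z)$ as $\lambda\to0^+$. -/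

import Mathlib

open MeasureTheory Filter Topology
open scoped SchwartzMap ComplexConjugate ENNReal InnerProductSpace

noncomputable section

namespace KMinkowski

/-! ### The algebra

The dimension is `n = d + 1`; points (positions or momenta) are written `x = (x₀, x⃗)`. -/

/-- `ℝⁿ = ℝ × ℝᵈ`, with `n = d + 1`; both factors carry Lebesgue measure. -/
abbrev Pt (d : ℕ) : Type := ℝ × EuclideanSpace ℝ (Fin d)

/-- The Euclidean pairing `p · x = p₀ x₀ + p⃗ · x⃗`. -/
def dot {d : ℕ} (p x : Pt d) : ℝ := p.1 * x.1 + inner ℝ p.2 x.2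

/-- `(2π)⁻ⁿ`. -/
def twoPiInv (d : ℕ) : ℝ := ((2 * Real.pi) ^ (d + 1))⁻¹

/-- The Fourier transform `(𝓕 f)(p) = ∫ e^{-i p·x} f(x) dⁿx`. -/
def fourier {d : ℕ} (f : Pt d → ℂ) (p : Pt d) : ℂ :=
  ∫ x, Complex.exp (-(Complex.I * (dot p x : ℝ))) * f x

/-- The inverse transform `(𝓕⁻¹ k)(x) = ∫ e^{i p·x} k(p) dⁿp / (2π)ⁿ`. -/
def fourierInv {d : ℕ} (k : Pt d → ℂ) (x : Pt d) : ℂ :=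
  (twoPiInv d : ℂ) * ∫ p, Complex.exp (Complex.I * (dot p x : ℝ)) * k p

/-- Convolution on the group with law
`(a₀, a⃗) (b₀, b⃗) = (a₀ + b₀, a⃗ + e^{-λ a₀} b⃗)`, for the right Haar measure `dⁿa / (2π)ⁿ`. -/
def conv {d : ℕ} (lam : ℝ) (k l : Pt d → ℂ) (a : Pt d) : ℂ :=
  (twoPiInv d : ℂ) *
    ∫ b : Pt d, k (a.1 - b.1, a.2 - Real.exp (-(lam * (a.1 - b.1))) • b.2) * l b

/-- The involution `k^*(a) = e^{λ(n-1)a₀} conj k(a⁻¹)` of the convolution algebra. -/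
def convInvol {d : ℕ} (lam : ℝ) (k : Pt d → ℂ) (a : Pt d) : ℂ :=
  (Real.exp (lam * d * a.1) : ℂ) * conj (k (-a.1, -(Real.exp (lam * a.1) • a.2)))

/-- The star product `f ⋆ g = 𝓕⁻¹(𝓕 f ⋆̂ 𝓕 g)`. -/
def starMul {d : ℕ} (lam : ℝ) (f g : Pt d → ℂ) : Pt d → ℂ :=
  fourierInv (conv lam (fourier f) (fourier g))

/-- The involution `f^* = 𝓕⁻¹((𝓕 f)^*̂)`. -/
def starInvol {d : ℕ} (lam : ℝ) (f : Pt d → ℂ) : Pt d → ℂ :=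
  fourierInv (convInvol lam (fourier f))

/-- The weight `ω(f) = ∫ f(x) dⁿx`. -/
def omega {d : ℕ} (f : Pt d → ℂ) : ℂ := ∫ x, f x

/-- Schwartz functions with compact support in the first variable. -/
def IsSc {d : ℕ} (φ : 𝓢(Pt d, ℂ)) : Prop :=
  ∃ K : Set ℝ, IsCompact K ∧ Function.support φ ⊆ K ×ˢ Set.univ

instance instIsAddHaarMeasure (d : ℕ) : (volume : Measure (Pt d)).IsAddHaarMeasure :=
  inferInstanceAs ((volume : Measure ℝ).prod
    (volume : Measure (EuclideanSpace ℝ (Fin d)))).IsAddHaarMeasure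

theorem integrable_kernel {d : ℕ} {f : Pt d → ℂ} (hf : Integrable f) (p : Pt d) :
    Integrable fun x => Complex.exp (-(Complex.I * (dot p x : ℝ))) * f x := by
  refine hf.bdd_mul (c := 1) ?_ (.of_forall fun x => ?_)
  · apply Continuous.aestronglyMeasurable
    unfold dot
    fun_prop
  · rw [← mul_neg, mul_comm, ← Complex.ofReal_neg, Complex.norm_exp_ofReal_mul_I]

/-- The algebra `𝒜 = 𝓕(𝒮_c)`, as a space of (automatically Schwartz) functions on `ℝⁿ`. -/
def algA (d : ℕ) : Submodule ℂ 𝓢(Pt d, ℂ) where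
  carrier := {f | ∃ φ : 𝓢(Pt d, ℂ), IsSc φ ∧ ⇑f = fourier φ}
  zero_mem' := ⟨0, ⟨∅, isCompact_empty, by simp⟩, by ext p; simp [fourier]⟩
  add_mem' := by
    rintro f g ⟨φ, ⟨K, hK, hφ⟩, hf⟩ ⟨χ, ⟨L, hL, hχ⟩, hg⟩
    refine ⟨φ + χ, ⟨K ∪ L, hK.union hL, ?_⟩, ?_⟩
    · intro x hx
      have : x ∈ Function.support φ ∪ Function.support χ :=
        Function.support_add (f := ⇑φ) (g := ⇑χ) hx
      rcases this with h | h
      · exact ⟨Or.inl (hφ h).1, trivial⟩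
      · exact ⟨Or.inr (hχ h).1, trivial⟩
    · ext p
      simp only [add_apply, hf, hg, fourier, mul_add]
      rw [integral_add (integrable_kernel φ.integrable p) (integrable_kernel χ.integrable p)]
  smul_mem' := by
    rintro c f ⟨φ, ⟨K, hK, hφ⟩, hf⟩
    refine ⟨c • φ, ⟨K, hK, ?_⟩, ?_⟩
    · intro x hx
      exact hφ (Function.support_const_smul_subset c (⇑φ) hx)
    · ext p
      simp only [smul_apply, hf, fourier, smul_eq_mul, mul_left_comm _ c]
      rw [integral_const_mul]

/-! ### The Hilbert space

In the momentum representation `f ↦ 𝓕 f`, the scalar product `ω(f^* ⋆ g)` is the scalar product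
of `L²(ℝⁿ, (2π)⁻ⁿ e^{-λ(n-1)p₀} dⁿp)`. -/

/-- The measure `(2π)⁻ⁿ e^{-λ(n-1)p₀} dⁿp`. -/
def momMeasure (d : ℕ) (lam : ℝ) : Measure (Pt d) :=
  volume.withDensity fun p => ENNReal.ofReal (twoPiInv d * Real.exp (-(lam * d * p.1)))

/-- The GNS Hilbert space of `ω`, in the momentum representation: see `gnsMap`,
`denseRange_gnsMap` and `inner_gnsMap` below. -/
abbrev Hr (d : ℕ) (lam : ℝ) : Type := Lp ℂ 2 (momMeasure d lam)

/-- The rank `2^{[n/2]}` of the spinor bundle. -/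
abbrev spinDim (d : ℕ) : ℕ := 2 ^ ((d + 1) / 2)

/-- The Hilbert space `H_r ⊗ ℂ^{2^{[n/2]}}` of spinors. -/
abbrev HSpin (d : ℕ) (lam : ℝ) : Type := PiLp 2 fun _ : Fin (spinDim d) => Hr d lam

/-! #### Fourier inversion -/

/-- The identification of `Pt d` with a Euclidean space. -/
def ptEquiv (d : ℕ) : WithLp 2 (Pt d) ≃L[ℝ] Pt d :=
  WithLp.prodContinuousLinearEquiv 2 ℝ ℝ (EuclideanSpace ℝ (Fin d))

theorem integral_ptEquiv {d : ℕ} (f : Pt d → ℂ) :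
    ∫ v : WithLp 2 (Pt d), f (ptEquiv d v) = ∫ x, f x :=
  (WithLp.volume_preserving_ofLp ℝ (EuclideanSpace ℝ (Fin d))).integral_comp
    (MeasurableEquiv.toLp 2 (Pt d)).symm.measurableEmbedding f

theorem dot_ptEquiv {d : ℕ} (v w : WithLp 2 (Pt d)) :
    dot (ptEquiv d v) (ptEquiv d w) = inner ℝ v w := by
  simp only [dot, WithLp.prod_inner_apply]
  congr 1
  simp [ptEquiv, mul_comm]

/-- Multiplication by `2π`. -/
def twoPiEquiv (d : ℕ) : Pt d ≃L[ℝ] Pt d :=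
  ContinuousLinearEquiv.smulLeft (Units.mk0 (2 * Real.pi) Real.two_pi_pos.ne')

theorem twoPiEquiv_apply {d : ℕ} (p : Pt d) : twoPiEquiv d p = (2 * Real.pi) • p := rfl

theorem dot_smul {d : ℕ} (r : ℝ) (p x : Pt d) : dot (r • p) x = r * dot p x := by
  simp only [dot, Prod.smul_fst, Prod.smul_snd, inner_smul_left, smul_eq_mul]
  simp
  ring

theorem dot_comm {d : ℕ} (p x : Pt d) : dot p x = dot x p := by
  simp only [dot, real_inner_comm, mul_comm]

theorem fourier_eq {d : ℕ} (f : Pt d → ℂ) (v : WithLp 2 (Pt d)) :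
    fourier f (twoPiEquiv d (ptEquiv d v)) =
      FourierTransform.fourier (fun w => f (ptEquiv d w)) v := by
  rw [Real.fourier_eq', fourier, ← integral_ptEquiv]
  refine integral_congr_ae (.of_forall fun w => ?_)
  simp only [smul_eq_mul, twoPiEquiv_apply, dot_smul, dot_ptEquiv]
  congr 2
  rw [real_inner_comm]
  push_cast
  ring

theorem finrank_pt (d : ℕ) : Module.finrank ℝ (Pt d) = d + 1 := by
  simp [Module.finrank_prod, add_comm]

theorem fourierInv_eq {d : ℕ} (k : Pt d → ℂ) (v : WithLp 2 (Pt d)) :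
    fourierInv k (ptEquiv d v) =
      FourierTransformInv.fourierInv (fun w => k (twoPiEquiv d (ptEquiv d w))) v := by
  rw [Real.fourierInv_eq', fourierInv]
  have h := integral_ptEquiv (d := d) fun p =>
    Complex.exp (Complex.I * (dot (twoPiEquiv d p) (ptEquiv d v) : ℝ)) * k (twoPiEquiv d p)
  have h2 := Measure.integral_comp_smul (volume : Measure (Pt d))
    (fun p => Complex.exp (Complex.I * (dot p (ptEquiv d v) : ℝ)) * k p) (2 * Real.pi)
  simp only [← twoPiEquiv_apply] at h2
  rw [h2, finrank_pt, abs_of_pos (inv_pos.2 (pow_pos Real.two_pi_pos _)),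
    Complex.real_smul] at h
  rw [twoPiInv, ← h]
  refine integral_congr_ae (.of_forall fun w => ?_)
  simp only [smul_eq_mul, twoPiEquiv_apply, dot_smul, dot_ptEquiv]
  congr 2
  push_cast
  ring

/-- The Fourier transform of a Schwartz function, as a Schwartz function. -/
def fourierS {d : ℕ} (φ : 𝓢(Pt d, ℂ)) : 𝓢(Pt d, ℂ) :=
  SchwartzMap.compCLMOfContinuousLinearEquiv ℂ ((ptEquiv d).trans (twoPiEquiv d)).symm
    (FourierTransform.fourier (SchwartzMap.compCLMOfContinuousLinearEquiv ℂ (ptEquiv d) φ))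

/-- The inverse Fourier transform of a Schwartz function, as a Schwartz function. -/
def fourierInvS {d : ℕ} (φ : 𝓢(Pt d, ℂ)) : 𝓢(Pt d, ℂ) :=
  SchwartzMap.compCLMOfContinuousLinearEquiv ℂ (ptEquiv d).symm
    (FourierTransformInv.fourierInv (SchwartzMap.compCLMOfContinuousLinearEquiv ℂ
      ((ptEquiv d).trans (twoPiEquiv d)) φ))

theorem coe_fourierS {d : ℕ} (φ : 𝓢(Pt d, ℂ)) : ⇑(fourierS φ) = fourier φ := by
  ext p
  obtain ⟨v, rfl⟩ := ((ptEquiv d).trans (twoPiEquiv d)).surjective p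
  simp only [fourierS, SchwartzMap.compCLMOfContinuousLinearEquiv_apply, Function.comp_apply]
  rw [ContinuousLinearEquiv.symm_apply_apply, ContinuousLinearEquiv.trans_apply, fourier_eq,
    SchwartzMap.fourier_coe]
  rfl

theorem coe_fourierInvS {d : ℕ} (φ : 𝓢(Pt d, ℂ)) : ⇑(fourierInvS φ) = fourierInv φ := by
  ext p
  obtain ⟨v, rfl⟩ := (ptEquiv d).surjective p
  rw [fourierInv_eq]
  simp only [fourierInvS, SchwartzMap.compCLMOfContinuousLinearEquiv_apply, Function.comp_apply]
  rw [ContinuousLinearEquiv.symm_apply_apply, SchwartzMap.fourierInv_coe]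
  rfl

theorem fourierS_fourierInvS {d : ℕ} (φ : 𝓢(Pt d, ℂ)) : fourierS (fourierInvS φ) = φ := by
  have h : SchwartzMap.compCLMOfContinuousLinearEquiv ℂ (ptEquiv d) (fourierInvS φ) =
      FourierTransformInv.fourierInv (SchwartzMap.compCLMOfContinuousLinearEquiv ℂ
        ((ptEquiv d).trans (twoPiEquiv d)) φ) := by
    ext v; simp [fourierInvS]
  rw [fourierS, h, FourierTransform.fourier_fourierInv_eq]
  ext v
  simp only [SchwartzMap.compCLMOfContinuousLinearEquiv_apply, Function.comp_apply,
    ContinuousLinearEquiv.apply_symm_apply]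

theorem fourierInvS_fourierS {d : ℕ} (φ : 𝓢(Pt d, ℂ)) : fourierInvS (fourierS φ) = φ := by
  have h : SchwartzMap.compCLMOfContinuousLinearEquiv ℂ ((ptEquiv d).trans (twoPiEquiv d))
      (fourierS φ) =
      FourierTransform.fourier (SchwartzMap.compCLMOfContinuousLinearEquiv ℂ (ptEquiv d) φ) := by
    ext v
    simp only [fourierS, SchwartzMap.compCLMOfContinuousLinearEquiv_apply, Function.comp_apply,
      ContinuousLinearEquiv.symm_apply_apply]
  rw [fourierInvS, h, FourierTransform.fourierInv_fourier_eq]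
  ext v
  simp only [SchwartzMap.compCLMOfContinuousLinearEquiv_apply, Function.comp_apply,
    ContinuousLinearEquiv.apply_symm_apply]

theorem fourierInv_eq_fourier_neg {d : ℕ} (k : Pt d → ℂ) (x : Pt d) :
    fourierInv k x = (twoPiInv d : ℂ) * fourier k (-x) := by
  simp only [fourierInv, fourier]
  congr 2
  ext p
  have : dot (-x) p = -dot p x := by
    rw [← neg_one_smul ℝ x, dot_smul, dot_comm]; ring
  rw [this]
  push_cast
  ring_nf

theorem twoPiInv_pos (d : ℕ) : 0 < twoPiInv d :=
  inv_pos.2 (pow_pos Real.two_pi_pos _)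

/-- The Fourier transform of an element of `𝒜` lies in `𝒮_c`. -/
theorem isSc_fourierS {d : ℕ} {f : 𝓢(Pt d, ℂ)} (hf : f ∈ algA d) : IsSc (fourierS f) := by
  obtain ⟨φ, ⟨K, hK, hφ⟩, hf⟩ := hf
  refine ⟨-K, hK.neg, fun p hp => ⟨?_, trivial⟩⟩
  have h : φ (-p) = (twoPiInv d : ℂ) * fourierS f p := by
    conv_lhs => rw [← fourierInvS_fourierS φ]
    rw [coe_fourierInvS, fourierInv_eq_fourier_neg, neg_neg, coe_fourierS, coe_fourierS, hf]
  have h' : -p ∈ Function.support φ := by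
    rw [Function.mem_support, h]
    exact mul_ne_zero (by exact_mod_cast (twoPiInv_pos d).ne') hp
  exact (hφ h').1

/-- Every element of `𝒮_c` is the Fourier transform of an element of `𝒜`. -/
theorem fourierInvS_mem {d : ℕ} {k : 𝓢(Pt d, ℂ)} (hk : IsSc k) : fourierInvS k ∈ algA d := by
  obtain ⟨K, hK, hk⟩ := hk
  refine ⟨(twoPiInv d : ℂ) •
    SchwartzMap.compCLMOfContinuousLinearEquiv ℂ (ContinuousLinearEquiv.neg ℝ) k,
    ⟨-K, hK.neg, fun p hp => ⟨?_, trivial⟩⟩, ?_⟩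
  · have h' : -p ∈ Function.support k := by
      intro h
      apply hp
      simp [h]
    exact (hk h').1
  · ext x
    rw [coe_fourierInvS, fourierInv_eq_fourier_neg, fourier, fourier, ← integral_const_mul,
      ← integral_neg_eq_self]
    refine integral_congr_ae (.of_forall fun p => ?_)
    have : dot (-x) (-p) = dot x p := by
      rw [← neg_one_smul ℝ x, dot_smul, dot_comm, ← neg_one_smul ℝ p, dot_smul, dot_comm]; ring
    simp only [this, smul_apply, smul_eq_mul,
      SchwartzMap.compCLMOfContinuousLinearEquiv_apply, Function.comp_apply]
    simp
    ring

/-! #### The GNS map -/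

theorem convInvol_schwartz {d : ℕ} (lam : ℝ) {k : 𝓢(Pt d, ℂ)} (hk : IsSc k) :
    ∃ l : 𝓢(Pt d, ℂ), IsSc l ∧ ⇑l = convInvol lam k := by
  obtain ⟨K, hK, hk⟩ := hk
  obtain ⟨R, hR⟩ := hK.isBounded.exists_norm_le
  have hk0 : ∀ a : Pt d, R < |a.1| → k a = 0 := by
    intro a ha
    by_contra h
    exact absurd (hR _ (hk h).1) (not_le.2 ha)
  let χ : ContDiffBump (0 : ℝ) := ⟨|R| + 1, |R| + 2, by positivity, by linarith⟩
  have hχ1 : ∀ t : ℝ, |t| ≤ R → χ t = 1 := fun t ht =>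
    χ.one_of_mem_closedBall (by
      simp only [Metric.mem_closedBall, dist_zero_right, Real.norm_eq_abs]
      change |t| ≤ |R| + 1
      linarith [le_abs_self R])
  have hgr : ∀ c : ℝ, Function.HasTemperateGrowth (fun t : ℝ => Real.exp (c * (χ t * t))) := by
    intro c
    have h1 : Function.HasTemperateGrowth (fun t : ℝ => Real.exp (c * (χ t * t)) - 1) := by
      refine HasCompactSupport.hasTemperateGrowth ?_ ?_
      · refine χ.hasCompactSupport.mono' (fun t ht => subset_tsupport _ ?_)
        intro h
        apply ht
        simp [h]
      · have := χ.contDiff (n := ⊤)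
        fun_prop
    have h2 := h1.add (Function.HasTemperateGrowth.const 1)
    have e : ((fun t : ℝ => Real.exp (c * (χ t * t)) - 1) + fun _ => 1) =
        fun t : ℝ => Real.exp (c * (χ t * t)) := by
      ext t; simp
    rwa [e] at h2
  have hbd : ∃ C : ℝ, ∀ t : ℝ, Real.exp (-(lam * (χ t * t))) ≤ C := by
    refine ⟨Real.exp (|lam| * (|R| + 2)), fun t => Real.exp_le_exp.2 ?_⟩
    have h1 : |χ t * t| ≤ |R| + 2 := by
      by_cases ht : |t| < |R| + 2
      · rw [abs_mul, abs_of_nonneg χ.nonneg]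
        calc χ t * |t| ≤ 1 * |t| := by gcongr; exact χ.le_one
          _ ≤ _ := by linarith
      · rw [χ.zero_of_le_dist (by
          simp only [dist_zero_right, Real.norm_eq_abs]; exact not_lt.1 ht)]
        simp; positivity
    calc -(lam * (χ t * t)) ≤ |lam * (χ t * t)| := neg_le_abs _
      _ = |lam| * |χ t * t| := abs_mul _ _
      _ ≤ _ := by gcongr
  obtain ⟨C, hC⟩ := hbd
  let G : Pt d → Pt d := fun a => (-a.1, -(Real.exp (lam * (χ a.1 * a.1)) • a.2))
  have hfst : Function.HasTemperateGrowth (fun a : Pt d => a.1) :=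
    (ContinuousLinearMap.fst ℝ ℝ (EuclideanSpace ℝ (Fin d))).hasTemperateGrowth
  have hsnd : Function.HasTemperateGrowth (fun a : Pt d => a.2) :=
    (ContinuousLinearMap.snd ℝ ℝ (EuclideanSpace ℝ (Fin d))).hasTemperateGrowth
  have hG : G.HasTemperateGrowth := by
    have h1 := ((hgr lam).comp hfst).smul hsnd
    have e : G = fun a => ContinuousLinearMap.inl ℝ ℝ (EuclideanSpace ℝ (Fin d)) (-a.1) +
        ContinuousLinearMap.inr ℝ ℝ (EuclideanSpace ℝ (Fin d))
          (-(Real.exp (lam * (χ a.1 * a.1)) • a.2)) := by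
      ext a <;> simp [G]
    rw [e]
    exact ((ContinuousLinearMap.inl ℝ ℝ (EuclideanSpace ℝ (Fin d))).hasTemperateGrowth.comp
      hfst.neg).add ((ContinuousLinearMap.inr ℝ ℝ
        (EuclideanSpace ℝ (Fin d))).hasTemperateGrowth.comp h1.neg)
  have hGup : ∃ (k : ℕ) (C : ℝ), ∀ x, ‖x‖ ≤ C * (1 + ‖G x‖) ^ k := by
    refine ⟨1, max 1 C, fun a => ?_⟩
    have h1 : ‖a.1‖ ≤ ‖G a‖ := by
      simp [G]
    have h2 : ‖a.2‖ ≤ C * ‖G a‖ := by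
      have h3 : Real.exp (lam * (χ a.1 * a.1)) * ‖a.2‖ ≤ ‖G a‖ := by
        simp [G, norm_smul]
      calc ‖a.2‖ = Real.exp (-(lam * (χ a.1 * a.1))) *
            (Real.exp (lam * (χ a.1 * a.1)) * ‖a.2‖) := by
            rw [← mul_assoc, ← Real.exp_add]; simp
        _ ≤ C * ‖G a‖ := by
            have hC0 : 0 ≤ C := (Real.exp_pos _).le.trans (hC 0)
            exact mul_le_mul (hC _) h3 (by positivity) hC0
    have h0 := norm_nonneg (G a)
    have hm1 : 1 ≤ max 1 C := le_max_left _ _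
    have hm2 : C ≤ max 1 C := le_max_right _ _
    rw [pow_one, Prod.norm_def]
    refine max_le ?_ ?_ <;> nlinarith
  refine ⟨SchwartzMap.smulLeftCLM ℂ (fun a : Pt d => Real.exp (lam * d * (χ a.1 * a.1)))
    (SchwartzMap.postcompCLM (𝕜 := ℝ) (Complex.conjCLE : ℂ →L[ℝ] ℂ)
      (SchwartzMap.compCLM ℝ hG hGup k)), ?_, ?_⟩
  all_goals
    have hval : ∀ a : Pt d, SchwartzMap.smulLeftCLM ℂ
        (fun a : Pt d => Real.exp (lam * d * (χ a.1 * a.1)))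
        (SchwartzMap.postcompCLM (𝕜 := ℝ) (Complex.conjCLE : ℂ →L[ℝ] ℂ)
        (SchwartzMap.compCLM ℝ hG hGup k)) a =
        (Real.exp (lam * d * (χ a.1 * a.1)) : ℂ) * conj (k (G a)) := by
      intro a
      have hg' : Function.HasTemperateGrowth
          (fun a : Pt d => Real.exp (lam * d * (χ a.1 * a.1))) := (hgr (lam * d)).comp hfst
      rw [SchwartzMap.smulLeftCLM_apply_apply hg']
      simp [Complex.real_smul]
  · refine ⟨-K, hK.neg, fun a ha => ⟨?_, trivial⟩⟩
    rw [Function.mem_support, hval] at ha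
    have : G a ∈ Function.support k := by
      intro h
      apply ha
      simp [h]
    exact (hk this).1
  · ext a
    rw [hval, convInvol]
    by_cases ha : |a.1| ≤ R
    · simp only [G, hχ1 _ ha, one_mul]
    · rw [hk0 (G a) (by simpa [G] using ha), hk0 _ (by simpa using ha)]
      simp

theorem momMeasure_le {d : ℕ} (lam : ℝ) {K : Set ℝ} (hK : IsCompact K) :
    ∃ c : ℝ≥0∞, c ≠ ∞ ∧
      (momMeasure d lam).restrict (K ×ˢ Set.univ) ≤ c • (volume : Measure (Pt d)) := by
  obtain ⟨C, hC⟩ := hK.bddAbove_image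
    (f := fun t : ℝ => twoPiInv d * Real.exp (-(lam * d * t))) (by fun_prop)
  refine ⟨ENNReal.ofReal C, ENNReal.ofReal_ne_top, ?_⟩
  have hm : MeasurableSet (K ×ˢ (Set.univ : Set (EuclideanSpace ℝ (Fin d)))) :=
    hK.measurableSet.prod .univ
  rw [momMeasure, restrict_withDensity hm, ← withDensity_const]
  calc _ ≤ ((volume : Measure (Pt d)).restrict (K ×ˢ Set.univ)).withDensity
        fun _ => ENNReal.ofReal C := by
        refine withDensity_mono ((ae_restrict_iff' hm).2 (.of_forall fun p hp => ?_))
        exact ENNReal.ofReal_le_ofReal (hC (Set.mem_image_of_mem _ hp.1))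
    _ ≤ _ := by
        simp only [withDensity_const]
        refine Measure.le_iff.2 fun A _ => ?_
        simp only [Measure.smul_apply, smul_eq_mul]
        gcongr
        exact Measure.restrict_le_self

theorem memLp_of_isSc {d : ℕ} (lam : ℝ) {k : 𝓢(Pt d, ℂ)} (hk : IsSc k) :
    MemLp k 2 (momMeasure d lam) := by
  obtain ⟨K, hK, hk⟩ := hk
  obtain ⟨c, hc, hle⟩ := momMeasure_le (d := d) lam hK
  have h := (k.memLp 2 (volume : Measure (Pt d))).of_measure_le_smul hc hle
  rw [← memLp_indicator_iff_restrict (hK.measurableSet.prod .univ),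
    Set.indicator_eq_self.2 hk] at h
  exact h

theorem memLp_fourier {d : ℕ} (lam : ℝ) (f : algA d) :
    MemLp (fourier (f : 𝓢(Pt d, ℂ))) 2 (momMeasure d lam) := by
  rw [← coe_fourierS]
  exact memLp_of_isSc lam (isSc_fourierS f.2)

/-- The map `𝒜 → H_r`, `f ↦ 𝓕 f`. -/
def gnsMap {d : ℕ} (lam : ℝ) (f : algA d) : Hr d lam := (memLp_fourier lam f).toLp

instance instIsFiniteMeasureOnCompacts (d : ℕ) (lam : ℝ) :
    IsFiniteMeasureOnCompacts (momMeasure d lam) := by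
  refine ⟨fun L hL => ?_⟩
  obtain ⟨c, hc, hle⟩ := momMeasure_le (d := d) lam (hL.image continuous_fst)
  have hsub : L ⊆ (Prod.fst '' L) ×ˢ Set.univ := fun x hx => ⟨⟨x, hx, rfl⟩, trivial⟩
  calc momMeasure d lam L = (momMeasure d lam).restrict ((Prod.fst '' L) ×ˢ Set.univ) L := by
        rw [Measure.restrict_apply hL.measurableSet, Set.inter_eq_left.2 hsub]
    _ ≤ (c • (volume : Measure (Pt d))) L := hle L
    _ < ∞ := by
        simpa using ENNReal.mul_lt_top hc.lt_top hL.measure_lt_top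

theorem denseRange_gnsMap (d : ℕ) (lam : ℝ) : DenseRange (gnsMap (d := d) lam) := by
  refine (Lp.dense_hasCompactSupport_contDiff (F := ℂ) (μ := momMeasure d lam) (p := 2)
    (by simp)).mono ?_
  rintro ψ ⟨g, hψ, hg, hg'⟩
  have hk : IsSc (hg.toSchwartzMap hg') := by
    refine ⟨Prod.fst '' tsupport g, hg.isCompact.image continuous_fst, fun x hx => ⟨?_, trivial⟩⟩
    exact ⟨x, subset_tsupport _ hx, rfl⟩
  refine ⟨⟨fourierInvS _, fourierInvS_mem hk⟩, ?_⟩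
  ext1
  refine (MemLp.coeFn_toLp _).trans (.trans ?_ hψ.symm)
  rw [← coe_fourierS, fourierS_fourierInvS]
  exact .of_forall fun x => rfl

theorem measurePreserving_translate {d : ℕ} (lam : ℝ) (b : Pt d) :
    MeasurePreserving (fun p : Pt d =>
      ((p.1 - b.1, p.2 - Real.exp (-(lam * (p.1 - b.1))) • b.2) : Pt d)) := by
  refine (measurePreserving_sub_right (volume : Measure ℝ) b.1).skew_product
    (g := fun t y => y - Real.exp (-(lam * (t - b.1))) • b.2) ?_ (.of_forall fun t => ?_)
  · apply Continuous.measurable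
    unfold Function.uncurry
    fun_prop
  · exact (measurePreserving_sub_right volume _).map_eq

theorem measurePreserving_shear {d : ℕ} (lam : ℝ) :
    MeasurePreserving (fun z : Pt d × Pt d =>
      ((z.1, (z.2.1 - z.1.1, z.2.2 - Real.exp (-(lam * (z.2.1 - z.1.1))) • z.1.2)) :
        Pt d × Pt d)) := by
  refine (MeasurePreserving.id (volume : Measure (Pt d))).skew_product
    (g := fun b p : Pt d => (p.1 - b.1, p.2 - Real.exp (-(lam * (p.1 - b.1))) • b.2)) ?_
    (.of_forall fun b => ?_)
  · apply Continuous.measurable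
    unfold Function.uncurry
    fun_prop
  · exact (measurePreserving_translate lam b).map_eq

/-- The homeomorphism `(x₀, x⃗) ↦ (x₀, e^s x⃗)`. -/
def scaleHomeo (d : ℕ) (s : ℝ) : Pt d ≃ₜ Pt d :=
  (Homeomorph.refl ℝ).prodCongr (Homeomorph.smulOfNeZero (Real.exp s) (Real.exp_pos s).ne')

theorem scaleHomeo_apply {d : ℕ} (s : ℝ) (x : Pt d) :
    scaleHomeo d s x = (x.1, Real.exp s • x.2) := rfl

theorem map_scaleHomeo (d : ℕ) (s : ℝ) :
    Measure.map (scaleHomeo d s) volume =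
      ENNReal.ofReal (Real.exp (-(s * d))) • (volume : Measure (Pt d)) := by
  have h := Measure.map_prod_map (volume : Measure ℝ) (volume : Measure (EuclideanSpace ℝ (Fin d)))
    measurable_id (measurable_const_smul (Real.exp s))
  rw [Measure.map_id, Measure.map_addHaar_smul _ (Real.exp_pos s).ne',
    Measure.prod_smul_right] at h
  refine Eq.trans (b := Measure.map (Prod.map id (Real.exp s • ·)) (volume.prod volume)) rfl
    (h.symm.trans ?_)
  rw [finrank_euclideanSpace_fin, abs_of_pos (inv_pos.2 (pow_pos (Real.exp_pos s) _)),
    ← Real.exp_nat_mul, ← Real.exp_neg, mul_comm (d : ℝ)]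
  rfl

theorem integral_scale {d : ℕ} (s : ℝ) {G : Type} [NormedAddCommGroup G] [NormedSpace ℝ G]
    (g : Pt d → G) :
    ∫ x : Pt d, g (x.1, Real.exp s • x.2) = Real.exp (-(s * d)) • ∫ x, g x := by
  have h := (scaleHomeo d s).measurableEmbedding.integral_map (μ := volume) g
  rw [map_scaleHomeo, integral_smul_measure, ENNReal.toReal_ofReal (Real.exp_pos _).le] at h
  exact h.symm

theorem integrable_scale {d : ℕ} (s : ℝ) {g : Pt d → ℂ} (hg : Integrable g) :
    Integrable fun x : Pt d => g (x.1, Real.exp s • x.2) := by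
  have h := MeasurableEmbedding.integrable_map_iff (μ := volume) (g := g)
    (scaleHomeo d s).measurableEmbedding
  rw [map_scaleHomeo] at h
  exact h.1 (hg.smul_measure ENNReal.ofReal_ne_top)

theorem integral_inversion {d : ℕ} (lam : ℝ) {F : Pt d → ℂ} (hF : Integrable F)
    (hF' : Integrable fun q : Pt d =>
      (Real.exp (lam * d * q.1) : ℂ) * F (-q.1, -(Real.exp (lam * q.1) • q.2))) :
    ∫ q : Pt d, (Real.exp (lam * d * q.1) : ℂ) * F (-q.1, -(Real.exp (lam * q.1) • q.2)) =
      ∫ q, F q := by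
  have h1 := integral_prod _ hF'
  have h2 := integral_prod _ hF
  refine h1.trans (Eq.trans ?_ h2.symm)
  rw [← integral_neg_eq_self (fun t : ℝ => ∫ y, F (t, y))]
  congr 1
  ext t
  simp only
  rw [integral_const_mul]
  have h3 := Measure.integral_comp_smul (volume : Measure (EuclideanSpace ℝ (Fin d)))
    (fun y => F (-t, y)) (-Real.exp (lam * t))
  simp only [neg_smul] at h3
  rw [h3, finrank_euclideanSpace_fin, abs_inv, abs_pow, abs_neg, abs_of_pos (Real.exp_pos _),
    ← Real.exp_nat_mul, Complex.real_smul, ← mul_assoc, ← Complex.ofReal_mul,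
    show lam * d * t = d * (lam * t) by ring, mul_inv_cancel₀ (Real.exp_pos _).ne']
  simp

theorem norm_phase (r : ℝ) : ‖Complex.exp (Complex.I * (r : ℂ))‖ = 1 := by
  rw [mul_comm, Complex.norm_exp_ofReal_mul_I]

theorem fourierInv_conv {d : ℕ} (lam : ℝ) (k l : 𝓢(Pt d, ℂ)) (x : Pt d) :
    fourierInv (conv lam k l) x = (twoPiInv d : ℂ) *
      ∫ q : Pt d, k q * (Complex.exp (Complex.I * (dot q x : ℝ)) *
        fourierInv l (x.1, Real.exp (-(lam * q.1)) • x.2)) := by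
  set c : ℂ := (twoPiInv d : ℂ) with hc
  let Ψ : Pt d × Pt d → ℂ := fun z => Complex.exp (Complex.I *
      (dot ((z.2.1 + z.1.1, z.2.2 + Real.exp (-(lam * z.2.1)) • z.1.2) : Pt d) x : ℝ)) *
      (c * (l z.1 * k z.2))
  have hΨ : Integrable Ψ := by
    have h1 : Integrable (fun z : Pt d × Pt d => c * (l z.1 * k z.2)) :=
      (l.integrable.mul_prod k.integrable).const_mul c
    refine h1.bdd_mul (c := 1) ?_ (.of_forall fun z => (norm_phase _).le)
    apply Continuous.aestronglyMeasurable
    unfold dot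
    fun_prop
  have hΨ' : Integrable (fun z : Pt d × Pt d =>
      Ψ (z.1, (z.2.1 - z.1.1, z.2.2 - Real.exp (-(lam * (z.2.1 - z.1.1))) • z.1.2))) :=
    (measurePreserving_shear lam).integrable_comp_of_integrable hΨ
  have e1 : ∀ b p : Pt d,
      Ψ (b, (p.1 - b.1, p.2 - Real.exp (-(lam * (p.1 - b.1))) • b.2)) =
        Complex.exp (Complex.I * (dot p x : ℝ)) *
          (c * (k (p.1 - b.1, p.2 - Real.exp (-(lam * (p.1 - b.1))) • b.2) * l b)) := by
    intro b p
    simp only [Ψ, sub_add_cancel]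
    rw [mul_comm (l b)]
  have e2 : ∀ b q : Pt d, Ψ (b, q) = c * (k q * (Complex.exp (Complex.I * (dot q x : ℝ)) *
      (Complex.exp (Complex.I *
        (dot b (x.1, Real.exp (-(lam * q.1)) • x.2) : ℝ)) * l b))) := by
    intro b q
    have : dot ((q.1 + b.1, q.2 + Real.exp (-(lam * q.1)) • b.2) : Pt d) x =
        dot q x + dot b (x.1, Real.exp (-(lam * q.1)) • x.2) := by
      simp only [dot, inner_add_left, inner_smul_left, inner_smul_right]
      simp
      ring
    simp only [Ψ, this, Complex.ofReal_add, mul_add, Complex.exp_add]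
    ring
  rw [fourierInv, ← hc]
  congr 1
  calc ∫ p, Complex.exp (Complex.I * (dot p x : ℝ)) * conv lam k l p
      = ∫ p : Pt d, ∫ b : Pt d,
          Ψ (b, (p.1 - b.1, p.2 - Real.exp (-(lam * (p.1 - b.1))) • b.2)) := by
        congr 1
        ext p
        simp only [e1, conv, integral_const_mul, ← hc]
    _ = ∫ b : Pt d, ∫ p : Pt d,
          Ψ (b, (p.1 - b.1, p.2 - Real.exp (-(lam * (p.1 - b.1))) • b.2)) :=
        (integral_integral_swap (f := fun b p : Pt d =>
          Ψ (b, (p.1 - b.1, p.2 - Real.exp (-(lam * (p.1 - b.1))) • b.2))) hΨ').symm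
    _ = ∫ b : Pt d, ∫ q : Pt d, Ψ (b, q) := by
        congr 1
        ext b
        have hm := measurePreserving_translate lam b
        have hcont : Continuous fun q => Ψ (b, q) := by
          simp only [Ψ]
          unfold dot
          fun_prop
        have := integral_map (μ := (volume : Measure (Pt d))) hm.measurable.aemeasurable
          (f := fun q => Ψ (b, q)) hcont.aestronglyMeasurable
        rw [hm.map_eq] at this
        exact this.symm
    _ = ∫ q : Pt d, ∫ b : Pt d, Ψ (b, q) :=
        integral_integral_swap (f := fun b q : Pt d => Ψ (b, q)) hΨ
    _ = _ := by
        congr 1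
        ext q
        simp only [e2, integral_const_mul, fourierInv, ← hc]
        ring

theorem integrable_weight {d : ℕ} (c : ℝ) {k : 𝓢(Pt d, ℂ)} (hk : IsSc k) :
    Integrable fun q : Pt d => (Real.exp (c * q.1) : ℂ) * k q := by
  obtain ⟨K, hK, hk⟩ := hk
  obtain ⟨C, hC⟩ := hK.bddAbove_image (f := fun t : ℝ => Real.exp (c * t)) (by fun_prop)
  refine (k.integrable.norm.const_mul C).mono' ?_ (.of_forall fun q => ?_)
  · apply Continuous.aestronglyMeasurable
    fun_prop
  · rw [norm_mul, Complex.norm_real, Real.norm_of_nonneg (Real.exp_pos _).le]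
    by_cases hq : k q = 0
    · simp [hq]
    · gcongr
      exact hC (Set.mem_image_of_mem _ (hk hq).1)

theorem omega_conv {d : ℕ} (lam : ℝ) (k l : 𝓢(Pt d, ℂ)) (hk : IsSc k) :
    omega (fourierInv (conv lam k l)) = (twoPiInv d : ℂ) *
      ∫ q : Pt d, (Real.exp (lam * d * q.1) : ℂ) *
        (k q * l (-q.1, -(Real.exp (lam * q.1) • q.2))) := by
  let g := fourierInvS l
  have hg : ⇑g = fourierInv l := coe_fourierInvS l
  let Ψ : Pt d × Pt d → ℂ := fun z => k z.1 * (Complex.exp (Complex.I * (dot z.1 z.2 : ℝ)) *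
        g (z.2.1, Real.exp (-(lam * z.1.1)) • z.2.2))
  have hcont : Continuous Ψ := by
    simp only [Ψ]
    unfold dot
    fun_prop
  have hkI : Integrable fun q : Pt d => Real.exp (lam * d * q.1) * ‖k q‖ := by
    refine (integrable_weight (lam * d) hk).norm.congr (.of_forall fun q => ?_)
    simp only [norm_mul, Complex.norm_real, Real.norm_of_nonneg (Real.exp_pos _).le]
  have hnorm : ∀ z, ‖Ψ z‖ = ‖k z.1‖ * ‖g (z.2.1, Real.exp (-(lam * z.1.1)) • z.2.2)‖ := by
    intro z
    simp only [Ψ, norm_mul, norm_phase, one_mul]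
  have hΨ : Integrable Ψ := by
    refine (integrable_prod_iff hcont.aestronglyMeasurable).2 ⟨.of_forall fun q => ?_, ?_⟩
    · simp only [Ψ]
      refine Integrable.const_mul ?_ _
      refine (integrable_scale _ g.integrable).bdd_mul (c := 1) ?_
        (.of_forall fun z => (norm_phase _).le)
      apply Continuous.aestronglyMeasurable
      unfold dot
      fun_prop
    · simp only [hnorm, integral_const_mul]
      have : ∀ q : Pt d, ∫ x : Pt d, ‖g (x.1, Real.exp (-(lam * q.1)) • x.2)‖ =
          Real.exp (lam * d * q.1) * ∫ x, ‖g x‖ := by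
        intro q
        rw [integral_scale (-(lam * q.1)) (fun x => ‖g x‖), smul_eq_mul]
        ring_nf
      simp only [this]
      refine (hkI.mul_const (∫ x, ‖g x‖)).congr (.of_forall fun q => ?_)
      simp only
      ring
  have hin : ∀ q : Pt d, ∫ x, Ψ (q, x) = (Real.exp (lam * d * q.1) : ℂ) *
        (k q * l (-q.1, -(Real.exp (lam * q.1) • q.2))) := by
    intro q
    have e : ∀ x : Pt d, Complex.exp (Complex.I * (dot q x : ℝ)) *
        g (x.1, Real.exp (-(lam * q.1)) • x.2) =
        (fun y : Pt d => Complex.exp (-(Complex.I *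
          (dot (-q.1, -(Real.exp (lam * q.1) • q.2)) y : ℝ))) * g y)
          (x.1, Real.exp (-(lam * q.1)) • x.2) := by
      intro x
      have : dot (-q.1, -(Real.exp (lam * q.1) • q.2)) (x.1, Real.exp (-(lam * q.1)) • x.2) =
          -dot q x := by
        simp only [dot, inner_neg_left, inner_smul_left, inner_smul_right, Real.exp_neg]
        have := (Real.exp_pos (lam * q.1)).ne'
        simp
        field_simp
        ring
      simp only [this]
      push_cast
      ring_nf
    simp only [Ψ, integral_const_mul, e]
    rw [integral_scale (-(lam * q.1)) (fun y : Pt d => Complex.exp (-(Complex.I *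
          (dot (-q.1, -(Real.exp (lam * q.1) • q.2)) y : ℝ))) * g y)]
    have hl : fourier g = l := by
      rw [← coe_fourierS, fourierS_fourierInvS]
    rw [← fourier, hl, Complex.real_smul]
    ring_nf
  have hswap := integral_integral_swap (f := fun q x : Pt d => Ψ (q, x)) hΨ
  simp only [hin] at hswap
  rw [hswap, omega, ← integral_const_mul]
  congr 1
  ext x
  rw [fourierInv_conv]
  simp only [Ψ, hg]

/-- `gnsMap` is the GNS map of the weight `ω`: its range is dense, and
`⟨f, g⟩ = ω(f^* ⋆ g)`. -/
theorem inner_gnsMap {d : ℕ} (lam : ℝ) (f g : algA d) :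
    inner ℂ (gnsMap lam f) (gnsMap lam g) =
      omega (starMul lam (starInvol lam (f : 𝓢(Pt d, ℂ))) (g : 𝓢(Pt d, ℂ))) := by
  let k := fourierS (f : 𝓢(Pt d, ℂ))
  let l := fourierS (g : 𝓢(Pt d, ℂ))
  have hk : IsSc k := isSc_fourierS f.2
  have hkf : fourier (f : 𝓢(Pt d, ℂ)) = k := (coe_fourierS _).symm
  have hlg : fourier (g : 𝓢(Pt d, ℂ)) = l := (coe_fourierS _).symm
  obtain ⟨k', hk', hkk⟩ := convInvol_schwartz lam hk
  have hR : omega (starMul lam (starInvol lam (f : 𝓢(Pt d, ℂ))) (g : 𝓢(Pt d, ℂ))) =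
      omega (fourierInv (conv lam k' l)) := by
    rw [starMul, starInvol, hkf, hlg, ← hkk, ← coe_fourierInvS, ← coe_fourierS,
      fourierS_fourierInvS]
  rw [hR, omega_conv lam k' l hk']
  let F : Pt d → ℂ := fun b => (Real.exp (-(lam * d * b.1)) : ℂ) * (conj (k b) * l b)
  have hlb : ∃ C : ℝ, ∀ x, ‖l x‖ ≤ C := ⟨_, fun x => l.norm_le_seminorm ℝ x⟩
  obtain ⟨C, hC⟩ := hlb
  have hF : Integrable F := by
    have h1 := (integrable_weight (-(lam * d)) hk)
    have h2 : Integrable fun b : Pt d => (Real.exp (-(lam * d) * b.1) : ℂ) * conj (k b) := by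
      refine h1.norm.mono' ?_ (.of_forall fun q => by simp)
      apply Continuous.aestronglyMeasurable
      fun_prop
    refine (h2.mul_bdd (c := C) l.continuous.aestronglyMeasurable (.of_forall hC)).congr
      (.of_forall fun q => ?_)
    simp only [F, neg_mul]
    ring
  have e : ∀ q : Pt d, (Real.exp (lam * d * q.1) : ℂ) *
      (k' q * l (-q.1, -(Real.exp (lam * q.1) • q.2))) =
      (Real.exp (lam * d * q.1) : ℂ) * F (-q.1, -(Real.exp (lam * q.1) • q.2)) := by
    intro q
    rw [hkk, convInvol]
    simp only [F, mul_neg, neg_neg]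
    ring
  have hF' : Integrable fun q : Pt d =>
      (Real.exp (lam * d * q.1) : ℂ) * F (-q.1, -(Real.exp (lam * q.1) • q.2)) := by
    have h1 := integrable_weight (lam * d) hk'
    have hc : Continuous fun q : Pt d => l (-q.1, -(Real.exp (lam * q.1) • q.2)) := by fun_prop
    refine (h1.mul_bdd (c := C) hc.aestronglyMeasurable (.of_forall fun q => hC _)).congr
      (.of_forall fun q => ?_)
    simp only
    rw [← e, mul_assoc]
  simp only [e]
  rw [integral_inversion lam hF hF', L2.inner_def]
  have e3 : ∫ p, inner ℂ (gnsMap lam f p) (gnsMap lam g p) ∂(momMeasure d lam) =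
      ∫ p, conj (k p) * l p ∂(momMeasure d lam) := by
    refine integral_congr_ae ?_
    filter_upwards [(memLp_fourier lam f).coeFn_toLp, (memLp_fourier lam g).coeFn_toLp]
      with p h1 h2
    change inner ℂ ((memLp_fourier lam f).toLp _ p) ((memLp_fourier lam g).toLp _ p) = _
    rw [h1, h2, hkf, hlg, RCLike.inner_apply, mul_comm]
  rw [e3, momMeasure, integral_withDensity_eq_integral_toReal_smul (by fun_prop)
    (.of_forall fun _ => ENNReal.ofReal_lt_top), ← integral_const_mul]
  refine integral_congr_ae (.of_forall fun p => ?_)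
  have hpos : 0 ≤ twoPiInv d * Real.exp (-(lam * d * p.1)) :=
    mul_nonneg (twoPiInv_pos d).le (Real.exp_pos _).le
  simp only [F, ENNReal.toReal_ofReal hpos, Complex.real_smul]
  push_cast
  ring

/-! ### Operators -/

/-- `T` is the operator `π(f)` of left multiplication, `π(f) ψ = f ⋆ ψ`. -/
def IsLeftMul {d : ℕ} (lam : ℝ) (f : Pt d → ℂ) (T : Hr d lam →L[ℂ] Hr d lam) : Prop :=
  ∀ ψ : Hr d lam, T ψ =ᵐ[momMeasure d lam] conv lam (fourier f) ψ

open Classical in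
/-- The bounded operator `π(f)` on `H_r` (it exists for `f ∈ 𝒜`). -/
def leftMul {d : ℕ} (lam : ℝ) (f : Pt d → ℂ) : Hr d lam →L[ℂ] Hr d lam :=
  if h : ∃ T, IsLeftMul lam f T then h.choose else 0

/-- The bounded operator `π(f) ⊗ 1` on spinors. -/
def leftMulSpin {d : ℕ} (lam : ℝ) (f : Pt d → ℂ) : HSpin d lam →L[ℂ] HSpin d lam :=
  (PiLp.continuousLinearEquiv 2 ℂ fun _ : Fin (spinDim d) => Hr d lam).symm.toContinuousLinearMap ∘L
    (ContinuousLinearMap.piMap fun _ => leftMul lam f) ∘L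
    (PiLp.continuousLinearEquiv 2 ℂ fun _ : Fin (spinDim d) => Hr d lam).toContinuousLinearMap

/-- The operator `m(P)`, where `P_μ = -i ∂_μ`: multiplication by `m(p)` in the momentum
representation, on its maximal domain. -/
def mulOp {d : ℕ} (lam : ℝ) (m : Pt d → ℂ) : Hr d lam →ₗ.[ℂ] Hr d lam where
  domain :=
    { carrier := {ψ | MemLp (fun p => m p * ψ p) 2 (momMeasure d lam)}
      zero_mem' := by
        refine (memLp_congr_ae ?_).2 (MemLp.zero (ε := ℂ) (p := 2) (μ := momMeasure d lam))
        filter_upwards [Lp.coeFn_zero ℂ 2 (momMeasure d lam)] with p hp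
        rw [hp, Pi.zero_apply, mul_zero]
      add_mem' := by
        intro ψ χ hψ hχ
        refine (memLp_congr_ae ?_).2 (MemLp.add hψ hχ)
        filter_upwards [Lp.coeFn_add ψ χ] with p hp
        exact (congrArg (m p * ·) hp).trans (mul_add _ _ _)
      smul_mem' := by
        intro c ψ hψ
        refine (memLp_congr_ae ?_).2 (MemLp.const_smul hψ c)
        filter_upwards [Lp.coeFn_smul c ψ] with p hp
        exact (congrArg (m p * ·) hp).trans (mul_left_comm _ _ _) }
  toFun :=
    { toFun := fun ψ => MemLp.toLp (fun p => m p * (ψ : Hr d lam) p) ψ.2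
      map_add' := by
        intro ψ χ
        rw [← MemLp.toLp_add]
        refine MemLp.toLp_congr _ _ ?_
        filter_upwards [Lp.coeFn_add (ψ : Hr d lam) (χ : Hr d lam)] with p hp
        exact (congrArg (m p * ·) hp).trans (mul_add _ _ _)
      map_smul' := by
        intro c ψ
        rw [RingHom.id_apply, ← MemLp.toLp_const_smul]
        refine MemLp.toLp_congr _ _ ?_
        filter_upwards [Lp.coeFn_smul c (ψ : Hr d lam)] with p hp
        exact (congrArg (m p * ·) hp).trans (mul_left_comm _ _ _) }

/-- The unbounded operator `∑_μ A_μ ⊗ m_μ(P)` on spinors, for matrices `A_μ`, defined on the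
spinors all of whose components lie in the domain of every `m_μ(P)`. -/
def matOp {d : ℕ} (lam : ℝ) {ι : Type} [Fintype ι]
    (A : ι → Matrix (Fin (spinDim d)) (Fin (spinDim d)) ℂ) (m : ι → Pt d → ℂ) :
    HSpin d lam →ₗ.[ℂ] HSpin d lam where
  domain :=
    { carrier := {ψ | ∀ i j, ψ j ∈ (mulOp lam (m i)).domain}
      zero_mem' := fun i _ => (mulOp lam (m i)).domain.zero_mem
      add_mem' := fun hψ hχ i j => (mulOp lam (m i)).domain.add_mem (hψ i j) (hχ i j)
      smul_mem' := fun c _ hψ i j => (mulOp lam (m i)).domain.smul_mem c (hψ i j) }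
  toFun :=
    { toFun := fun ψ => WithLp.toLp 2 fun a =>
        ∑ i, ∑ j, A i a j • mulOp lam (m i) ⟨(ψ : HSpin d lam) j, ψ.2 i j⟩
      map_add' := by
        intro ψ χ
        ext1 a
        simp only [PiLp.add_apply, ← Finset.sum_add_distrib, ← smul_add, ← LinearPMap.map_add]
        rfl
      map_smul' := by
        intro c ψ
        ext1 a
        simp only [RingHom.id_apply, PiLp.smul_apply, Finset.smul_sum, smul_comm c,
          ← LinearPMap.map_smul]
        rfl }

/-! ### The Dirac operator and the weight `Φ` -/

/-- Hermitian matrices with `{Γ^μ, Γ^ν} = 2 δ^{μν}`. -/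
def IsClifford {d : ℕ} (Γ : Fin (d + 1) → Matrix (Fin (spinDim d)) (Fin (spinDim d)) ℂ) : Prop :=
  (∀ i, (Γ i).IsHermitian) ∧
    ∀ i j, Γ i * Γ j + Γ j * Γ i = if i = j then 2 else 0

/-- `D₀ = λ⁻¹(1 - e^{-λ P₀})` and `D_j = P_j`, as functions of the momentum. -/
def diracSymbol {d : ℕ} (lam : ℝ) : Fin (d + 1) → Pt d → ℂ :=
  Fin.cons (fun p => ((lam⁻¹ * (1 - Real.exp (-(lam * p.1))) : ℝ) : ℂ))
    fun j p => ((p.2 j : ℝ) : ℂ)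

/-- The Dirac operator `D = Γ^μ D_μ`. -/
def dirac {d : ℕ} (lam : ℝ)
    (Γ : Fin (d + 1) → Matrix (Fin (spinDim d)) (Fin (spinDim d)) ℂ) :
    HSpin d lam →ₗ.[ℂ] HSpin d lam :=
  matOp lam Γ (diracSymbol lam)

/-- The modular operator `Δ_Φ = e^{-λ P₀}` (times the identity on spinor indices). -/
def modularOp (d : ℕ) (lam : ℝ) : HSpin d lam →ₗ.[ℂ] HSpin d lam :=
  matOp lam (fun _ : Unit => 1) fun _ p => ((Real.exp (-(lam * p.1)) : ℝ) : ℂ)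

section Operators

variable {E : Type*} [NormedAddCommGroup E] [InnerProductSpace ℂ E]

/-- The bounded operator `R` is the inverse of the unbounded operator `D² + μ²`. -/
def IsSqAddInv (D : E →ₗ.[ℂ] E) (mu : ℝ) (R : E →L[ℂ] E) : Prop :=
  (∀ ψ : E, ∃ (h₁ : R ψ ∈ D.domain) (h₂ : D ⟨R ψ, h₁⟩ ∈ D.domain),
    D ⟨D ⟨R ψ, h₁⟩, h₂⟩ + ((mu ^ 2 : ℝ) : ℂ) • R ψ = ψ) ∧
  ∀ (φ : D.domain) (h : D φ ∈ D.domain), R (D ⟨D φ, h⟩ + ((mu ^ 2 : ℝ) : ℂ) • (φ : E)) = φ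

open Classical in
/-- `(D² + μ²)⁻¹`. -/
def sqAddInv (D : E →ₗ.[ℂ] E) (mu : ℝ) : E →L[ℂ] E :=
  if h : ∃ R, IsSqAddInv D mu R then h.choose else 0

/-- `(D² + μ²)^{-z/2}`, for `Re z > 0`: the function `w ↦ w^{z/2}` (which is continuous on
`[0, ∞)`) of the bounded positive operator `(D² + μ²)⁻¹`. -/
def sqAddPow [CompleteSpace E] (D : E →ₗ.[ℂ] E) (mu : ℝ) (z : ℂ) : E →L[ℂ] E :=
  cfc (fun w : ℂ => w ^ (z / 2)) (sqAddInv D mu)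

/-- Trace class (equivalently, nuclear) operators on a Hilbert space:
`T ψ = ∑ₖ ⟨xₖ, ψ⟩ yₖ` with `∑ₖ ‖xₖ‖ ‖yₖ‖ < ∞`. -/
def IsTraceClass (T : E →L[ℂ] E) : Prop :=
  ∃ x y : ℕ → E, Summable (fun k => ‖x k‖ * ‖y k‖) ∧
    ∀ ψ, HasSum (fun k => inner ℂ (x k) ψ • y k) (T ψ)

/-- `T` is of trace class and `Tr T = t`, i.e. `∑ᵢ ⟨bᵢ, T bᵢ⟩ = t` in every orthonormal basis. -/
def HasTrace {E : Type} [NormedAddCommGroup E] [InnerProductSpace ℂ E]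
    (T : E →L[ℂ] E) (t : ℂ) : Prop :=
  IsTraceClass T ∧
    ∀ (ι : Type) (b : HilbertBasis ι ℂ E), HasSum (fun i => inner ℂ (b i) (T (b i))) t

end Operators

/-- `Φ(A) = Tr(Δ_Φ A) = t`: the operator `Δ_Φ A` is everywhere defined, bounded and of trace
class, and its trace is `t`. -/
def HasPhi {d : ℕ} {lam : ℝ} (A : HSpin d lam →L[ℂ] HSpin d lam) (t : ℂ) : Prop :=
  ∃ T : HSpin d lam →L[ℂ] HSpin d lam,
    (∀ ψ, ∃ h : A ψ ∈ (modularOp d lam).domain, modularOp d lam ⟨A ψ, h⟩ = T ψ) ∧ HasTrace T t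

/-- `ζ_f(z) = Φ(f (D² + μ²)^{-z/2})` is defined and equal to `t`. -/
def HasZeta {d : ℕ} (lam mu : ℝ)
    (Γ : Fin (d + 1) → Matrix (Fin (spinDim d)) (Fin (spinDim d)) ℂ)
    (f : Pt d → ℂ) (z t : ℂ) : Prop :=
  HasPhi (leftMulSpin lam f ∘L sqAddPow (dirac lam Γ) mu z) t

/-! ### The special functions -/

/-- `F` is the analytic continuation of the hypergeometric series `₂F₁(a, b; c; ·)` from the unit
disc to `ℂ ∖ [1, ∞)`. -/
def IsHypCont (a b c : ℂ) (F : ℂ → ℂ) : Prop :=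
  DifferentiableOn ℂ F {w | 1 - w ∈ Complex.slitPlane} ∧
    ∀ w : ℂ, ‖w‖ < 1 → F w = ordinaryHypergeometric a b c w

open Classical in
/-- The hypergeometric function `₂F₁(a, b; c; w)` on `ℂ ∖ [1, ∞)`. -/
def hyp (a b c w : ℂ) : ℂ :=
  if h : ∃ F, IsHypCont a b c F then h.choose w else 0

/-- `I_c(z) = ∫ (ξ² + μ²)^{-z/2} dⁿξ`. -/
def Ic (n : ℕ) (mu : ℝ) (z : ℂ) : ℂ :=
  ∫ ξ : EuclideanSpace ℝ (Fin n), ((‖ξ‖ ^ 2 + mu ^ 2 : ℝ) : ℂ) ^ (-z / 2)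

/-- `I_λ(z) = 2 π^{(n-1)/2} |μ|^{n-1-z} Γ((z-(n-1))/2) / Γ(z/2) λ⁻¹
₂F₁(1/2, (z-(n-1))/2; 3/2; -1/(λμ)²)`. -/
def Ilam (n : ℕ) (lam mu : ℝ) (z : ℂ) : ℂ :=
  2 * (Real.pi : ℂ) ^ (((n : ℂ) - 1) / 2) * ((|mu| : ℝ) : ℂ) ^ ((n : ℂ) - 1 - z) *
    (Complex.Gamma ((z - ((n : ℂ) - 1)) / 2) / Complex.Gamma (z / 2)) * (lam : ℂ)⁻¹ *
    hyp (1 / 2) ((z - ((n : ℂ) - 1)) / 2) (3 / 2) (-1 / ((lam : ℂ) * mu) ^ 2)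

/-- `I(z) = (I_c(z) + I_λ(z)) / 2`. -/
def Itot (n : ℕ) (lam mu : ℝ) (z : ℂ) : ℂ := (Ic n mu z + Ilam n lam mu z) / 2

end KMinkowski

end

noncomputable section

namespace KMinkowski

section RieszIntegral

variable {V : Type*} [NormedAddCommGroup V] [InnerProductSpace ℝ V] [FiniteDimensional ℝ V]
  [MeasurableSpace V] [BorelSpace V]

theorem integrable_sq_norm_add_rpow {A r : ℝ} (hA : 0 < A)
    (hr : (Module.finrank ℝ V : ℝ) / 2 < r) :
    Integrable fun ξ : V => (‖ξ‖ ^ 2 + A) ^ (-r) := by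
  have h0 : (0 : ℝ) ≤ Module.finrank ℝ V := Nat.cast_nonneg _
  have h := (integrable_rpow_neg_one_add_norm_sq (E := V) (μ := volume) (r := 2 * r)
    (by linarith)).const_mul ((min 1 A) ^ (-r))
  refine h.mono' (Measurable.aestronglyMeasurable (by fun_prop)) (.of_forall fun ξ => ?_)
  have hm : 0 < min 1 A := lt_min one_pos hA
  rw [Real.norm_of_nonneg (by positivity), show -(2 * r) / 2 = -r by ring,
    ← Real.mul_rpow hm.le (by positivity)]
  refine Real.rpow_le_rpow_of_nonpos (by positivity) ?_ (by linarith)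
  nlinarith [min_le_left 1 A, min_le_right 1 A, sq_nonneg ‖ξ‖]

theorem norm_ofReal_cpow_neg {x : ℝ} (hx : 0 < x) (s : ℂ) : ‖(x : ℂ) ^ (-s)‖ = x ^ (-s.re) := by
  rw [Complex.norm_cpow_eq_rpow_re_of_pos hx, Complex.neg_re]

theorem integrable_sq_norm_add_cpow {A : ℝ} (hA : 0 < A) {s : ℂ}
    (hs : (Module.finrank ℝ V : ℝ) / 2 < s.re) :
    Integrable fun ξ : V => ((‖ξ‖ ^ 2 + A : ℝ) : ℂ) ^ (-s) := by
  refine (integrable_sq_norm_add_rpow hA hs).mono'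
    (Measurable.aestronglyMeasurable (by fun_prop)) (.of_forall fun ξ => ?_)
  rw [norm_ofReal_cpow_neg (by positivity)]

theorem norm_gamma_integrand {s : ℂ} {r t : ℝ} (ht : 0 < t) :
    ‖(t : ℂ) ^ (s - 1) * Complex.exp (-(r * t))‖ = t ^ (s.re - 1) * Real.exp (-(r * t)) := by
  rw [norm_mul, Complex.norm_cpow_eq_rpow_re_of_pos ht, Complex.norm_exp]
  simp

theorem integrable_gamma_integrand {s : ℂ} (hs : 0 < s.re) {r : ℝ} (hr : 0 < r) :
    IntegrableOn (fun t : ℝ => (t : ℂ) ^ (s - 1) * Complex.exp (-(r * t))) (Set.Ioi 0) := by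
  have h := integrableOn_rpow_mul_exp_neg_mul_rpow (s := s.re - 1) (p := 1) (b := r)
    (by linarith) (by norm_num) hr
  refine Integrable.mono' h (Measurable.aestronglyMeasurable (by fun_prop)) ?_
  refine (ae_restrict_iff' measurableSet_Ioi).2 (.of_forall fun t ht => ?_)
  rw [norm_gamma_integrand ht]
  simp

theorem integral_norm_gamma_integrand {s : ℂ} (hs : 0 < s.re) {r : ℝ} (hr : 0 < r) :
    ∫ t in Set.Ioi (0 : ℝ), ‖(t : ℂ) ^ (s - 1) * Complex.exp (-(r * t))‖ =
      Real.Gamma s.re * r ^ (-s.re) := by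
  rw [setIntegral_congr_fun measurableSet_Ioi fun t ht => norm_gamma_integrand ht,
    Real.integral_rpow_mul_exp_neg_mul_Ioi hs hr, one_div, Real.inv_rpow hr.le,
    Real.rpow_neg hr.le, mul_comm]

/-- The integral `∫ (‖ξ‖² + A)^{-s} dξ` over a Euclidean space. -/
theorem integral_sq_norm_add_cpow {A : ℝ} (hA : 0 < A) {s : ℂ}
    (hs : (Module.finrank ℝ V : ℝ) / 2 < s.re) :
    ∫ ξ : V, ((‖ξ‖ ^ 2 + A : ℝ) : ℂ) ^ (-s) =
      (Real.pi : ℂ) ^ ((Module.finrank ℝ V : ℂ) / 2) * (A : ℂ) ^ ((Module.finrank ℝ V : ℂ) / 2 - s) *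
        (Complex.Gamma (s - (Module.finrank ℝ V : ℂ) / 2) / Complex.Gamma s) := by
  set n := Module.finrank ℝ V with hn
  have hn0 : (0 : ℝ) ≤ n := Nat.cast_nonneg _
  have hs0 : 0 < s.re := by linarith
  have hΓ : Complex.Gamma s ≠ 0 := Complex.Gamma_ne_zero_of_re_pos hs0
  let Ψ : V × ℝ → ℂ := fun x =>
    (x.2 : ℂ) ^ (s - 1) * Complex.exp (-(((‖x.1‖ ^ 2 + A : ℝ) : ℂ) * x.2))
  have hpos : ∀ ξ : V, 0 < ‖ξ‖ ^ 2 + A := fun ξ => by positivity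
  have hΨ : Integrable Ψ ((volume : Measure V).prod (volume.restrict (Set.Ioi 0))) := by
    have hm : Measurable Ψ := by fun_prop
    refine (integrable_prod_iff hm.aestronglyMeasurable).2 ⟨.of_forall fun ξ => ?_, ?_⟩
    · have h := integrable_gamma_integrand hs0 (hpos ξ)
      exact h
    · simp only [Ψ, integral_norm_gamma_integrand hs0 (hpos _)]
      exact (integrable_sq_norm_add_rpow hA hs).const_mul _
  have hswap := integral_integral_swap (f := fun ξ t => Ψ (ξ, t)) hΨ
  have h1 : ∀ ξ : V, ∫ t in Set.Ioi (0 : ℝ), Ψ (ξ, t) =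
      Complex.Gamma s * ((‖ξ‖ ^ 2 + A : ℝ) : ℂ) ^ (-s) := by
    intro ξ
    simp only [Ψ]
    rw [Complex.integral_cpow_mul_exp_neg_mul_Ioi hs0 (hpos ξ), mul_comm, one_div,
      Complex.inv_cpow _ _ (by rw [Complex.arg_ofReal_of_nonneg (hpos ξ).le]; exact Real.pi_pos.ne),
      Complex.cpow_neg]
  have h2 : ∀ t ∈ Set.Ioi (0 : ℝ), ∫ ξ : V, Ψ (ξ, t) = (Real.pi : ℂ) ^ ((n : ℂ) / 2) *
      ((t : ℂ) ^ (s - (n : ℂ) / 2 - 1) * Complex.exp (-(A * t))) := by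
    intro t ht
    have ht' : (t : ℂ) ≠ 0 := by exact_mod_cast ht.ne'
    have hg := GaussianFourier.integral_cexp_neg_mul_sq_norm (V := V) (b := t) (by simpa using ht)
    have e : ∀ ξ : V, Ψ (ξ, t) = (t : ℂ) ^ (s - 1) * Complex.exp (-(A * t)) *
        Complex.exp (-(t : ℂ) * (‖ξ‖ : ℂ) ^ 2) := by
      intro ξ
      simp only [Ψ]
      rw [mul_assoc, ← Complex.exp_add]
      push_cast
      ring_nf
    simp only [e]
    rw [integral_const_mul, hg, ← hn, div_eq_mul_inv (Real.pi : ℂ), ← Complex.ofReal_inv,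
      Complex.mul_cpow_ofReal_nonneg Real.pi_pos.le (inv_nonneg.2 (le_of_lt ht)),
      Complex.ofReal_inv, Complex.inv_cpow _ _ (by
        rw [Complex.arg_ofReal_of_nonneg (le_of_lt ht)]; exact Real.pi_pos.ne),
      ← Complex.cpow_neg, show s - (n : ℂ) / 2 - 1 = s - 1 + -((n : ℂ) / 2) by ring,
      Complex.cpow_add _ _ ht']
    ring
  simp only [h1] at hswap
  rw [setIntegral_congr_fun measurableSet_Ioi h2, integral_const_mul, integral_const_mul,
    Complex.integral_cpow_mul_exp_neg_mul_Ioi (by simpa using hs) hA, one_div,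
    Complex.inv_cpow _ _ (by rw [Complex.arg_ofReal_of_nonneg hA.le]; exact Real.pi_pos.ne),
    ← Complex.cpow_neg, neg_sub] at hswap
  rw [mul_div_assoc', eq_div_iff hΓ, mul_comm, hswap]
  ring

end RieszIntegral

section Hypergeometric

theorem ascPochhammer_half_mul (k : ℕ) :
    (ascPochhammer ℂ k).eval (1 / 2) * (2 * k + 1) = (ascPochhammer ℂ k).eval (3 / 2) := by
  induction k with
  | zero => simp
  | succ k ih =>
    rw [ascPochhammer_succ_eval, ascPochhammer_succ_eval, ← ih]
    push_cast
    ring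

theorem ascPochhammer_half_div (k : ℕ) :
    (ascPochhammer ℂ k).eval (1 / 2) * ((ascPochhammer ℂ k).eval (3 / 2))⁻¹ =
      ((2 * k + 1 : ℕ) : ℂ)⁻¹ := by
  have h0 : (ascPochhammer ℂ k).eval (1 / 2) ≠ 0 := by
    intro h
    rw [ascPochhammer_eval_eq_zero_iff] at h
    obtain ⟨j, -, hj⟩ := h
    have := congrArg Complex.re hj
    norm_num at this
    have h1 : (0 : ℝ) ≤ j := Nat.cast_nonneg j
    linarith
  rw [← ascPochhammer_half_mul]
  push_cast
  have h1 : (2 * (k : ℂ) + 1) ≠ 0 := by exact_mod_cast Nat.succ_ne_zero (2 * k)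
  field_simp

/-- The domain `ℂ ∖ [1, ∞)`. -/
def hypDomain : Set ℂ := {w | 1 - w ∈ Complex.slitPlane}

theorem isOpen_hypDomain : IsOpen hypDomain :=
  Complex.isOpen_slitPlane.preimage (by fun_prop)

theorem one_sub_mul_mem_slitPlane {w : ℂ} (hw : w ∈ hypDomain) {t : ℝ} (h0 : 0 ≤ t)
    (h1 : t ≤ 1) : 1 - w * t ∈ Complex.slitPlane := by
  have h := Complex.starConvex_one_slitPlane hw (sub_nonneg.2 h1) h0 (by ring)
  convert h using 1
  simp only [Complex.real_smul]
  push_cast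
  ring

theorem isPreconnected_hypDomain : IsPreconnected hypDomain := by
  have h : StarConvex ℝ 0 hypDomain := by
    rw [starConvex_zero_iff]
    intro w hw t h0 h1
    have := one_sub_mul_mem_slitPlane hw h0 h1
    rwa [mul_comm] at this
  exact (h.isPathConnected (by simp [hypDomain])).isConnected.isPreconnected

theorem IsHypCont.eqOn {a b c : ℂ} {F G : ℂ → ℂ} (hF : IsHypCont a b c F)
    (hG : IsHypCont a b c G) : Set.EqOn F G hypDomain := by
  refine AnalyticOnNhd.eqOn_of_preconnected_of_eventuallyEq
    (hF.1.analyticOnNhd isOpen_hypDomain) (hG.1.analyticOnNhd isOpen_hypDomain)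
    isPreconnected_hypDomain (z₀ := 0) (by simp [hypDomain]) ?_
  filter_upwards [Metric.ball_mem_nhds (0 : ℂ) one_pos] with w hw
  rw [Metric.mem_ball, dist_zero_right] at hw
  rw [hF.2 w hw, hG.2 w hw]

/-- The integral `∫₀¹ (1 - w t²)^{-b} dt`. -/
def eulerInt (b w : ℂ) : ℂ := ∫ t in (0 : ℝ)..1, (1 - w * (t ^ 2 : ℝ)) ^ (-b)

theorem continuousOn_eulerInt_integrand (b : ℂ) :
    ContinuousOn (fun x : ℂ × ℝ => (1 - x.1 * (x.2 ^ 2 : ℝ)) ^ b)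
      (hypDomain ×ˢ Set.Icc 0 1) := by
  refine ContinuousOn.cpow_const (by fun_prop) ?_
  rintro ⟨w, t⟩ ⟨hw, ht⟩
  exact one_sub_mul_mem_slitPlane hw (by positivity) (pow_le_one₀ ht.1 ht.2)

theorem continuousOn_eulerInt_section (b : ℂ) {w : ℂ} (hw : w ∈ hypDomain) :
    ContinuousOn (fun t : ℝ => (1 - w * (t ^ 2 : ℝ)) ^ b) (Set.Icc 0 1) :=
  (continuousOn_eulerInt_integrand b).comp (f := fun t : ℝ => (w, t)) (by fun_prop)
    fun _ ht => ⟨hw, ht⟩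

theorem differentiableOn_eulerInt (b : ℂ) : DifferentiableOn ℂ (eulerInt b) hypDomain := by
  intro w₀ hw₀
  obtain ⟨ε, hε, hball⟩ := Metric.nhds_basis_closedBall.mem_iff.1 (isOpen_hypDomain.mem_nhds hw₀)
  obtain ⟨C, hC⟩ := ((isCompact_closedBall w₀ ε).prod isCompact_Icc).exists_bound_of_continuousOn
    ((continuousOn_eulerInt_integrand (-b - 1)).mono (Set.prod_mono hball subset_rfl))
  have hsec : ∀ (c : ℂ) (w : ℂ), w ∈ hypDomain → AEStronglyMeasurable
      (fun t : ℝ => (1 - w * (t ^ 2 : ℝ)) ^ c) (volume.restrict (Set.uIoc 0 1)) := by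
    intro c w hw
    rw [Set.uIoc_of_le zero_le_one]
    exact ((continuousOn_eulerInt_section c hw).mono Set.Ioc_subset_Icc_self).aestronglyMeasurable
      measurableSet_Ioc
  have h := intervalIntegral.hasDerivAt_integral_of_dominated_loc_of_deriv_le
    (μ := volume) (a := (0 : ℝ)) (b := 1) (𝕜 := ℂ)
    (F := fun w (t : ℝ) => (1 - w * (t ^ 2 : ℝ)) ^ (-b))
    (F' := fun w (t : ℝ) => -b * (1 - w * (t ^ 2 : ℝ)) ^ (-b - 1) * -(t ^ 2 : ℝ))
    (bound := fun _ => ‖b‖ * C) (Metric.closedBall_mem_nhds w₀ hε) ?_ ?_ ?_ ?_ ?_ ?_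
  · exact h.2.differentiableAt.differentiableWithinAt
  · filter_upwards [isOpen_hypDomain.mem_nhds hw₀] with w hw using hsec _ w hw
  · exact ContinuousOn.intervalIntegrable_of_Icc zero_le_one (continuousOn_eulerInt_section _ hw₀)
  · exact ((hsec _ _ hw₀).const_mul _).mul (by fun_prop)
  · refine .of_forall fun t ht w hw => ?_
    rw [Set.uIoc_of_le zero_le_one] at ht
    have h1 := hC (w, t) ⟨hw, Set.Ioc_subset_Icc_self ht⟩
    have h2 : ‖-((t ^ 2 : ℝ) : ℂ)‖ ≤ 1 := by
      rw [norm_neg, Complex.norm_real, Real.norm_of_nonneg (by positivity)]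
      exact pow_le_one₀ ht.1.le ht.2
    rw [norm_mul, norm_mul, norm_neg]
    have h3 : 0 ≤ C := (norm_nonneg _).trans h1
    calc _ ≤ ‖b‖ * C * 1 := by gcongr
      _ = _ := mul_one _
  · exact intervalIntegrable_const
  · refine .of_forall fun t ht w hw => ?_
    rw [Set.uIoc_of_le zero_le_one] at ht
    have hd : HasDerivAt (fun w : ℂ => 1 - w * (t ^ 2 : ℝ)) (-((t ^ 2 : ℝ) : ℂ)) w := by
      simpa only [one_mul] using! ((hasDerivAt_id w).mul_const ((t ^ 2 : ℝ) : ℂ)).const_sub 1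
    exact hd.cpow_const (one_sub_mul_mem_slitPlane (hball hw) (by positivity)
      (pow_le_one₀ ht.1.le ht.2))

theorem hasSum_one_sub_cpow_neg (b : ℂ) {x : ℂ} (hx : ‖x‖ < 1) :
    HasSum (fun k : ℕ => ((k.factorial : ℂ)⁻¹ * (ascPochhammer ℂ k).eval b) * x ^ k)
      ((1 - x) ^ (-b)) := by
  have h := (Complex.one_add_cpow_hasFPowerSeriesOnBall_zero (a := -b)).hasSum (y := -x)
    (by simpa [Metric.mem_eball, edist_zero_right, ← enorm_eq_nnnorm] using
      (by rw [← ofReal_norm, ENNReal.ofReal_lt_one]; exact hx))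
  rw [zero_add, ← sub_eq_add_neg] at h
  have e : ∀ k : ℕ, (binomialSeries ℂ (-b) k fun _ => -x) =
      ((k.factorial : ℂ)⁻¹ * (ascPochhammer ℂ k).eval b) * x ^ k := by
    intro k
    have h1 : (ascPochhammer ℂ k).eval (1 : ℂ) ≠ 0 := by
      rw [ascPochhammer_eval_one]
      exact_mod_cast k.factorial_ne_zero
    rw [binomialSeries_eq_ordinaryHypergeometricSeries (b := (1 : ℂ)) (fun j hj => by
      have := congrArg Complex.re hj
      norm_num at this
      linarith [(Nat.cast_nonneg j : (0 : ℝ) ≤ j)]),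
      FormalMultilinearSeries.compContinuousLinearMap_apply]
    have e2 : (⇑(-ContinuousLinearMap.id ℂ ℂ) ∘ fun _ : Fin k => -x) = fun _ => x := by
      ext; simp
    rw [e2, ordinaryHypergeometricSeries_apply_eq, neg_neg, mul_inv_cancel_right₀ h1, smul_eq_mul]
  simpa only [e] using h

theorem isHypCont_eulerInt (b : ℂ) : IsHypCont (1 / 2) b (3 / 2) (eulerInt b) := by
  refine ⟨differentiableOn_eulerInt b, fun w hw => ?_⟩
  have hs := intervalIntegral.hasSum_integral_of_dominated_convergence
    (μ := volume) (a := (0 : ℝ)) (b := 1)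
    (F := fun (k : ℕ) (t : ℝ) => ((k.factorial : ℂ)⁻¹ * (ascPochhammer ℂ k).eval b) *
      (w * (t ^ 2 : ℝ)) ^ k) (f := fun t : ℝ => (1 - w * (t ^ 2 : ℝ)) ^ (-b))
    (fun k _ => ‖((k.factorial : ℂ)⁻¹ * (ascPochhammer ℂ k).eval b) * w ^ k‖)
    ?_ ?_ ?_ ?_ ?_
  · rw [eulerInt, ← hs.tsum_eq, ordinaryHypergeometric_eq_tsum]
    refine tsum_congr fun k => ?_
    have e : ∀ t : ℝ, ((k.factorial : ℂ)⁻¹ * (ascPochhammer ℂ k).eval b) *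
        (w * (t ^ 2 : ℝ)) ^ k = ((k.factorial : ℂ)⁻¹ * (ascPochhammer ℂ k).eval b) * w ^ k *
        ((t ^ (2 * k) : ℝ) : ℂ) := by
      intro t
      push_cast
      rw [mul_pow, ← pow_mul]
      ring
    simp only [e]
    rw [intervalIntegral.integral_const_mul, intervalIntegral.integral_ofReal, integral_pow,
      smul_eq_mul]
    have := ascPochhammer_half_div k
    push_cast at this ⊢
    rw [show ∀ p q r s t : ℂ, p * q * r * s * t = p * r * (q * s) * t by intros; ring, this]
    simp
    ring
  · exact fun k => Continuous.aestronglyMeasurable (by fun_prop)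
  · refine fun k => .of_forall fun t ht => ?_
    rw [Set.uIoc_of_le zero_le_one] at ht
    rw [norm_mul, norm_mul _ (w ^ k), mul_pow, norm_mul (w ^ k)]
    have : ‖((t ^ 2 : ℝ) : ℂ) ^ k‖ ≤ 1 := by
      rw [norm_pow, Complex.norm_real, Real.norm_of_nonneg (by positivity)]
      exact pow_le_one₀ (by positivity) (pow_le_one₀ ht.1.le ht.2)
    calc _ ≤ ‖(k.factorial : ℂ)⁻¹ * (ascPochhammer ℂ k).eval b‖ * (‖w ^ k‖ * 1) := by gcongr
      _ = _ := by rw [mul_one]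
  · exact .of_forall fun t _ => (hasSum_one_sub_cpow_neg b hw).summable.norm
  · exact intervalIntegrable_const
  · refine .of_forall fun t ht => ?_
    rw [Set.uIoc_of_le zero_le_one] at ht
    refine hasSum_one_sub_cpow_neg b (lt_of_le_of_lt ?_ hw)
    rw [norm_mul, Complex.norm_real, Real.norm_of_nonneg (by positivity)]
    exact mul_le_of_le_one_right (norm_nonneg _) (pow_le_one₀ ht.1.le ht.2)

theorem hyp_half_eq (b : ℂ) {w : ℂ} (hw : w ∈ hypDomain) :
    hyp (1 / 2) b (3 / 2) w = eulerInt b w := by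
  have h : ∃ F, IsHypCont (1 / 2) b (3 / 2) F := ⟨_, isHypCont_eulerInt b⟩
  rw [hyp, dif_pos h]
  exact h.choose_spec.eqOn (isHypCont_eulerInt b) hw

end Hypergeometric

section ZetaIntegral

theorem sq_cpow_eq {mu : ℝ} (hmu : mu ≠ 0) (w : ℂ) :
    ((mu ^ 2 : ℝ) : ℂ) ^ w = ((|mu| : ℝ) : ℂ) ^ (2 * w) := by
  have h : 0 < |mu| := abs_pos.2 hmu
  rw [← sq_abs, Complex.cpow_def_of_ne_zero (by exact_mod_cast (pow_pos h 2).ne'),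
    Complex.cpow_def_of_ne_zero (by exact_mod_cast h.ne'), ← Complex.ofReal_log (by positivity),
    ← Complex.ofReal_log h.le, Real.log_pow]
  push_cast
  ring_nf

theorem Ic_eq (n : ℕ) {mu : ℝ} (hmu : mu ≠ 0) {z : ℂ} (hz : (n : ℝ) < z.re) :
    Ic n mu z = (Real.pi : ℂ) ^ ((n : ℂ) / 2) * ((|mu| : ℝ) : ℂ) ^ ((n : ℂ) - z) *
      (Complex.Gamma ((z - (n : ℂ)) / 2) / Complex.Gamma (z / 2)) := by
  have hA : 0 < mu ^ 2 := by positivity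
  have hre : (z / 2).re = z.re / 2 := by simp
  have h := integral_sq_norm_add_cpow (V := EuclideanSpace ℝ (Fin n)) hA (s := z / 2)
    (by rw [finrank_euclideanSpace_fin, hre]; linarith)
  rw [finrank_euclideanSpace_fin] at h
  rw [Ic]
  simp only [neg_div]
  rw [h, sq_cpow_eq hmu, show 2 * ((n : ℂ) / 2 - z / 2) = n - z by ring,
    show z / 2 - (n : ℂ) / 2 = (z - n) / 2 by ring]

/-- The constant relating `∫ (ξ² + μ²)^{-z/2}` over `ℝ^{d+1}` to an integral over `ℝ`. -/
def sliceConst (d : ℕ) (z : ℂ) : ℂ :=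
  (Real.pi : ℂ) ^ ((d : ℂ) / 2) * (Complex.Gamma ((z - d) / 2) / Complex.Gamma (z / 2))

/-- The function `t ↦ (t² + μ²)^{-(z-d)/2}` obtained by integrating `(ξ² + μ²)^{-z/2}` over the
last `d` variables. -/
def slice (d : ℕ) (mu : ℝ) (z : ℂ) (t : ℝ) : ℂ := ((t ^ 2 + mu ^ 2 : ℝ) : ℂ) ^ (-((z - d) / 2))

variable {d : ℕ} {mu : ℝ} {z : ℂ}

theorem integrable_slice (hmu : mu ≠ 0) (hz : ((d + 1 : ℕ) : ℝ) < z.re) :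
    Integrable (slice d mu z) := by
  have h := integrable_sq_norm_add_cpow (V := ℝ) (A := mu ^ 2) (by positivity)
    (s := (z - d) / 2) (by
      simp only [Module.finrank_self]
      push_cast at hz
      simp
      linarith)
  simpa only [slice, Real.norm_eq_abs, sq_abs] using! h

theorem Ic_eq_integral_slice (hmu : mu ≠ 0) (hz : ((d + 1 : ℕ) : ℝ) < z.re) :
    Ic (d + 1) mu z = sliceConst d z * ∫ t, slice d mu z t := by
  have hd : (0 : ℝ) ≤ d := Nat.cast_nonneg d
  have h := integral_sq_norm_add_cpow (V := ℝ) (A := mu ^ 2) (by positivity)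
    (s := (z - d) / 2) (by
      simp only [Module.finrank_self]
      push_cast at hz
      simp
      linarith)
  simp only [Real.norm_eq_abs, sq_abs, Module.finrank_self] at h
  have hG : Complex.Gamma ((z - d) / 2) ≠ 0 := Complex.Gamma_ne_zero_of_re_pos (by
    push_cast at hz
    simp
    linarith)
  have hpi : (Real.pi : ℂ) ≠ 0 := by exact_mod_cast Real.pi_pos.ne'
  rw [Ic_eq _ hmu hz]
  simp only [slice]
  rw [h, sliceConst, sq_cpow_eq hmu]
  push_cast
  rw [show 2 * ((1 : ℂ) / 2 - (z - d) / 2) = d + 1 - z by ring,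
    show (z - (d : ℂ)) / 2 - 1 / 2 = (z - (d + 1)) / 2 by ring,
    show ((d : ℂ) + 1) / 2 = d / 2 + 1 / 2 by ring, Complex.cpow_add _ _ hpi]
  field_simp

theorem Ilam_eq_integral_slice (hmu : mu ≠ 0) {lam : ℝ} (hlam : 0 < lam) :
    Ilam (d + 1) lam mu z = 2 * (sliceConst d z * ∫ t in (0 : ℝ)..1 / lam, slice d mu z t) := by
  have hw : -1 / ((lam : ℂ) * mu) ^ 2 ∈ hypDomain := by
    have : 1 - -1 / ((lam : ℂ) * mu) ^ 2 = ((1 + 1 / (lam * mu) ^ 2 : ℝ) : ℂ) := by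
      push_cast
      ring
    rw [hypDomain, Set.mem_ofPred_eq, this, Complex.ofReal_mem_slitPlane]
    positivity
  have hsub := intervalIntegral.integral_comp_div (a := 0) (b := 1) (slice d mu z) hlam.ne'
  rw [zero_div, Complex.real_smul] at hsub
  have e : ∀ t : ℝ, slice d mu z (t / lam) = ((|mu| : ℝ) : ℂ) ^ ((d : ℂ) - z) *
      (1 - -1 / ((lam : ℂ) * mu) ^ 2 * (t ^ 2 : ℝ)) ^ (-((z - d) / 2)) := by
    intro t
    have h1 : (t / lam) ^ 2 + mu ^ 2 = mu ^ 2 * (1 + t ^ 2 / (lam * mu) ^ 2) := by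
      field_simp
      ring
    have h2 : 1 - -1 / ((lam : ℂ) * mu) ^ 2 * (t ^ 2 : ℝ) =
        ((1 + t ^ 2 / (lam * mu) ^ 2 : ℝ) : ℂ) := by
      push_cast
      ring
    rw [slice, h1, Complex.ofReal_mul, Complex.mul_cpow_ofReal_nonneg (by positivity)
      (by positivity), sq_cpow_eq hmu, h2]
    congr 2
    ring
  simp only [e, intervalIntegral.integral_const_mul] at hsub
  rw [Ilam, show (z - (((d + 1 : ℕ) : ℂ) - 1)) / 2 = (z - d) / 2 by push_cast; ring,
    show ((d + 1 : ℕ) : ℂ) - 1 = d by push_cast; ring, hyp_half_eq _ hw, eulerInt, sliceConst]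
  have hl : (lam : ℂ) ≠ 0 := by exact_mod_cast hlam.ne'
  rw [eq_comm, ← eq_inv_mul_iff_mul_eq₀ hl] at hsub
  rw [hsub]
  ring

theorem Itot_eq_integral_slice (hmu : mu ≠ 0) (hz : ((d + 1 : ℕ) : ℝ) < z.re) {lam : ℝ}
    (hlam : 0 < lam) :
    Itot (d + 1) lam mu z = sliceConst d z * ∫ t in Set.Iic (1 / lam), slice d mu z t := by
  have hi := integrable_slice hmu hz
  have heven : ∀ t, slice d mu z (-t) = slice d mu z t := fun t => by simp [slice]
  have h1 : ∫ t in Set.Iic (0 : ℝ), slice d mu z t = ∫ t in Set.Ioi (0 : ℝ), slice d mu z t := by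
    have := integral_comp_neg_Iic (0 : ℝ) (slice d mu z)
    simpa only [heven, neg_zero] using this
  have h2 := intervalIntegral.integral_Iic_add_Ioi (b := (0 : ℝ)) hi.integrableOn hi.integrableOn
  have h3 := intervalIntegral.integral_Iic_sub_Iic (a := (0 : ℝ)) (b := 1 / lam)
    (μ := volume) (f := slice d mu z) hi.integrableOn hi.integrableOn
  rw [Itot, Ic_eq_integral_slice hmu hz, Ilam_eq_integral_slice hmu hlam, ← h2, ← h3, h1]
  ring

theorem tendsto_Itot (hmu : mu ≠ 0) (hz : ((d + 1 : ℕ) : ℝ) < z.re) :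
    Tendsto (fun lam : ℝ => Itot (d + 1) lam mu z) (𝓝[>] 0) (𝓝 (Ic (d + 1) mu z)) := by
  have hi := integrable_slice hmu hz
  rw [Ic_eq_integral_slice hmu hz]
  have h := (aecover_Iic (μ := volume) (b := fun lam : ℝ => 1 / lam) (l := 𝓝[>] 0)
    (by simpa only [one_div] using tendsto_inv_nhdsGT_zero)).integral_tendsto_of_countably_generated hi
  refine (h.const_mul (sliceConst d z)).congr' ?_
  filter_upwards [self_mem_nhdsWithin] with lam hlam
  exact (Itot_eq_integral_slice hmu hz hlam).symm

/-- The symbol of `D₀`. -/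
def dZero (lam t : ℝ) : ℝ := lam⁻¹ * (1 - Real.exp (-(lam * t)))

theorem hasDerivAt_dZero {lam : ℝ} (hlam : lam ≠ 0) (t : ℝ) :
    HasDerivAt (dZero lam) (Real.exp (-(lam * t))) t := by
  have h := ((((hasDerivAt_id t).const_mul lam).neg.exp).const_sub 1).const_mul lam⁻¹
  convert! h using 1
  simp
  field_simp

theorem injective_dZero {lam : ℝ} (hlam : lam ≠ 0) : Function.Injective (dZero lam) := by
  intro s t h
  simp only [dZero] at h
  have h1 := mul_left_cancel₀ (inv_ne_zero hlam) h
  have h2 := Real.exp_injective (sub_right_injective h1)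
  exact mul_left_cancel₀ hlam (neg_injective h2)

theorem range_dZero {lam : ℝ} (hlam : 0 < lam) : Set.range (dZero lam) = Set.Iio (1 / lam) := by
  ext y
  constructor
  · rintro ⟨t, rfl⟩
    rw [Set.mem_Iio, dZero, one_div]
    exact mul_lt_of_lt_one_right (inv_pos.2 hlam) (by linarith [Real.exp_pos (-(lam * t))])
  · intro hy
    have h : 0 < 1 - lam * y := by
      rw [Set.mem_Iio, lt_div_iff₀ hlam] at hy
      linarith
    refine ⟨-Real.log (1 - lam * y) / lam, ?_⟩
    rw [dZero, mul_div_cancel₀ _ hlam.ne', neg_neg, Real.exp_log h]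
    field_simp
    ring

theorem integrable_exp_mul_comp_dZero {lam : ℝ} (hlam : 0 < lam) {g : ℝ → ℂ}
    (hg : Integrable g) :
    Integrable fun t => (Real.exp (-(lam * t)) : ℂ) * g (dZero lam t) := by
  have h := integrableOn_image_iff_integrableOn_abs_deriv_smul MeasurableSet.univ
    (fun t _ => (hasDerivAt_dZero hlam.ne' t).hasDerivWithinAt)
    (injective_dZero hlam.ne').injOn g
  rw [integrableOn_univ] at h
  refine (h.1 hg.integrableOn).congr (.of_forall fun t => ?_)
  simp only
  rw [abs_of_pos (Real.exp_pos _), Complex.real_smul]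

theorem integral_exp_mul_comp_dZero {lam : ℝ} (hlam : 0 < lam) (g : ℝ → ℂ) :
    ∫ t, (Real.exp (-(lam * t)) : ℂ) * g (dZero lam t) = ∫ t in Set.Iic (1 / lam), g t := by
  have h := integral_image_eq_integral_abs_deriv_smul MeasurableSet.univ
    (fun t _ => (hasDerivAt_dZero hlam.ne' t).hasDerivWithinAt)
    (injective_dZero hlam.ne').injOn g
  rw [Set.image_univ, range_dZero hlam, setIntegral_univ] at h
  rw [integral_Iic_eq_integral_Iio, h]
  congr 1
  ext t
  rw [abs_of_pos (Real.exp_pos _), Complex.real_smul]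

/-- The symbol of `D² + μ²`. -/
def symb (lam mu : ℝ) (p : Pt d) : ℝ := dZero lam p.1 ^ 2 + ‖p.2‖ ^ 2 + mu ^ 2

theorem sq_le_symb (lam mu : ℝ) (p : Pt d) : mu ^ 2 ≤ symb lam mu p := by
  unfold symb
  nlinarith [sq_nonneg (dZero lam p.1), sq_nonneg ‖p.2‖]

theorem symb_pos (lam : ℝ) (hmu : mu ≠ 0) (p : Pt d) : 0 < symb lam mu p :=
  lt_of_lt_of_le (by positivity) (sq_le_symb lam mu p)

theorem continuous_dZero (lam : ℝ) : Continuous (dZero lam) := by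
  unfold dZero
  fun_prop

theorem continuous_symb (lam mu : ℝ) : Continuous (symb (d := d) lam mu) := by
  have := continuous_dZero lam
  unfold symb
  fun_prop

theorem continuous_symb_cpow (lam : ℝ) (hmu : mu ≠ 0) (w : ℂ) :
    Continuous fun p : Pt d => ((symb lam mu p : ℝ) : ℂ) ^ w := by
  have := continuous_symb (d := d) lam mu
  refine Continuous.cpow (by fun_prop) continuous_const fun p => ?_
  rw [Complex.ofReal_mem_slitPlane]
  exact symb_pos lam hmu p

theorem integral_symb_slice (lam : ℝ) (hmu : mu ≠ 0) (hz : (d : ℝ) < z.re) (t : ℝ) :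
    Integrable (fun y : EuclideanSpace ℝ (Fin d) => ((symb lam mu (t, y) : ℝ) : ℂ) ^ (-(z / 2))) ∧
    ∫ y : EuclideanSpace ℝ (Fin d), ((symb lam mu (t, y) : ℝ) : ℂ) ^ (-(z / 2)) =
      sliceConst d z * slice d mu z (dZero lam t) := by
  have hA : 0 < dZero lam t ^ 2 + mu ^ 2 := by positivity
  have hre : (Module.finrank ℝ (EuclideanSpace ℝ (Fin d)) : ℝ) / 2 < (z / 2).re := by
    rw [finrank_euclideanSpace_fin]
    simp
    linarith
  have e : ∀ y : EuclideanSpace ℝ (Fin d), symb lam mu (t, y) =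
      ‖y‖ ^ 2 + (dZero lam t ^ 2 + mu ^ 2) := fun y => by simp only [symb]; ring
  simp only [e]
  refine ⟨integrable_sq_norm_add_cpow hA hre, ?_⟩
  rw [integral_sq_norm_add_cpow hA hre, finrank_euclideanSpace_fin, sliceConst, slice,
    show (d : ℂ) / 2 - z / 2 = -((z - d) / 2) by ring,
    show z / 2 - (d : ℂ) / 2 = (z - d) / 2 by ring]
  ring

/-- The function `e^{-λ p₀} (D² + μ²)^{-z/2}` of the momentum is integrable. -/
theorem integrable_exp_mul_symb_cpow {lam : ℝ} (hlam : 0 < lam) (hmu : mu ≠ 0)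
    (hz : ((d + 1 : ℕ) : ℝ) < z.re) :
    Integrable fun p : Pt d =>
      (Real.exp (-(lam * p.1)) : ℂ) * ((symb lam mu p : ℝ) : ℂ) ^ (-(z / 2)) := by
  have hz' : (d : ℝ) < z.re := by push_cast at hz; linarith
  have hc : Continuous fun p : Pt d =>
      (Real.exp (-(lam * p.1)) : ℂ) * ((symb lam mu p : ℝ) : ℂ) ^ (-(z / 2)) := by
    have := continuous_symb_cpow (d := d) lam hmu (-(z / 2))
    fun_prop
  refine (integrable_prod_iff hc.aestronglyMeasurable).2 ⟨.of_forall fun t => ?_, ?_⟩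
  · exact (integral_symb_slice lam hmu hz' t).1.const_mul (Real.exp (-(lam * t)) : ℂ)
  · have hz0 : ((d + 1 : ℕ) : ℝ) < ((z.re : ℂ)).re := by simpa using hz
    have hz0' : (d : ℝ) < ((z.re : ℂ)).re := by simpa using hz'
    have h := ((integrable_exp_mul_comp_dZero hlam (integrable_slice hmu hz0)).const_mul
      (sliceConst d (z.re : ℂ))).norm
    refine h.congr (.of_forall fun t => ?_)
    have e : ∀ y : EuclideanSpace ℝ (Fin d), ‖(Real.exp (-(lam * t)) : ℂ) *
        ((symb lam mu (t, y) : ℝ) : ℂ) ^ (-(z / 2))‖ =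
        Real.exp (-(lam * t)) * (symb lam mu (t, y)) ^ (-(z.re / 2)) := by
      intro y
      rw [norm_mul, norm_ofReal_cpow_neg (symb_pos lam hmu _), Complex.norm_real,
        Real.norm_of_nonneg (Real.exp_pos _).le]
      simp
    have e2 : ∀ y : EuclideanSpace ℝ (Fin d),
        ((symb lam mu (t, y) : ℝ) : ℂ) ^ (-((z.re : ℂ) / 2)) =
          (((symb lam mu (t, y)) ^ (-(z.re / 2)) : ℝ) : ℂ) := by
      intro y
      rw [Complex.ofReal_cpow (symb_pos lam hmu _).le]
      push_cast
      rfl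
    have h3 := (integral_symb_slice lam hmu hz0' t).2
    simp only [e2] at h3
    rw [integral_complex_ofReal] at h3
    simp only [e, integral_const_mul]
    rw [mul_left_comm, ← h3, ← Complex.ofReal_mul, Complex.norm_real, Real.norm_of_nonneg]
    exact mul_nonneg (Real.exp_pos _).le (integral_nonneg fun y =>
      Real.rpow_nonneg (symb_pos lam hmu _).le _)

theorem integral_exp_mul_symb_cpow {lam : ℝ} (hlam : 0 < lam) (hmu : mu ≠ 0)
    (hz : ((d + 1 : ℕ) : ℝ) < z.re) :
    ∫ p : Pt d, (Real.exp (-(lam * p.1)) : ℂ) * ((symb lam mu p : ℝ) : ℂ) ^ (-(z / 2)) =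
      Itot (d + 1) lam mu z := by
  have hz' : (d : ℝ) < z.re := by push_cast at hz; linarith
  refine (integral_prod _ (integrable_exp_mul_symb_cpow hlam hmu hz)).trans ?_
  simp only [integral_const_mul, (integral_symb_slice lam hmu hz' _).2]
  simp only [mul_left_comm _ (sliceConst d z)]
  rw [integral_const_mul, integral_exp_mul_comp_dZero hlam, Itot_eq_integral_slice hmu hz hlam]

end ZetaIntegral

section Nuclear

variable {E : Type*} [NormedAddCommGroup E] [InnerProductSpace ℂ E]

/-- `T = ∑ᵢ ⟨xᵢ, ·⟩ yᵢ` with `∑ᵢ ‖xᵢ‖ ‖yᵢ‖ < ∞`. -/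
def IsNuclearSum {ι : Type*} (T : E →L[ℂ] E) (x y : ι → E) : Prop :=
  Summable (fun k => ‖x k‖ * ‖y k‖) ∧ ∀ ψ, HasSum (fun k => inner ℂ (x k) ψ • y k) (T ψ)

theorem IsNuclearSum.isTraceClass {ι : Type*} [Countable ι] {T : E →L[ℂ] E} {x y : ι → E}
    (h : IsNuclearSum T x y) : IsTraceClass T := by
  obtain ⟨e, he⟩ := Countable.exists_injective_nat ι
  refine ⟨Function.extend e x 0, Function.extend e y 0, ?_, fun ψ => ?_⟩
  · rw [← he.summable_iff]
    · simpa only [Function.comp_def, he.extend_apply] using h.1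
    · intro k hk
      rw [Function.extend_apply' _ _ _ (by simpa using hk)]
      simp
  · rw [← he.hasSum_iff]
    · simpa only [Function.comp_def, he.extend_apply] using h.2 ψ
    · intro k hk
      rw [Function.extend_apply' _ _ _ (by simpa using hk)]
      simp

theorem _root_.HilbertBasis.hasSum_sq_norm_inner {ι : Type*} (b : HilbertBasis ι ℂ E) (x : E) :
    HasSum (fun i => ‖inner ℂ x (b i)‖ ^ 2) (‖x‖ ^ 2) := by
  have h := b.hasSum_inner_mul_inner x x
  have e : ∀ i, inner ℂ x (b i) * inner ℂ (b i) x = ((‖inner ℂ x (b i)‖ ^ 2 : ℝ) : ℂ) := by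
    intro i
    rw [← inner_conj_symm (b i) x, Complex.mul_conj, Complex.normSq_eq_norm_sq]
  simp only [e] at h
  rw [inner_self_eq_norm_sq_to_K] at h
  have h2 := Complex.hasSum_re h
  simp only [Complex.ofReal_re] at h2
  convert! h2 using 1
  norm_cast

theorem _root_.HilbertBasis.sum_norm_inner_mul_le {ι : Type*} (b : HilbertBasis ι ℂ E) (x y : E)
    (s : Finset ι) :
    ∑ i ∈ s, ‖inner ℂ x (b i) * inner ℂ (b i) y‖ ≤ ‖x‖ * ‖y‖ := by
  have hle : ∀ v : E, √(∑ i ∈ s, ‖inner ℂ v (b i)‖ ^ 2) ≤ ‖v‖ := by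
    intro v
    rw [Real.sqrt_le_left (norm_nonneg _)]
    exact sum_le_hasSum s (fun i _ => by positivity) (b.hasSum_sq_norm_inner v)
  calc ∑ i ∈ s, ‖inner ℂ x (b i) * inner ℂ (b i) y‖
      = ∑ i ∈ s, ‖inner ℂ x (b i)‖ * ‖inner ℂ y (b i)‖ := by
        refine Finset.sum_congr rfl fun i _ => ?_
        rw [norm_mul, norm_inner_symm (b i)]
    _ ≤ √(∑ i ∈ s, ‖inner ℂ x (b i)‖ ^ 2) * √(∑ i ∈ s, ‖inner ℂ y (b i)‖ ^ 2) :=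
        Real.sum_mul_le_sqrt_mul_sqrt _ _ _
    _ ≤ ‖x‖ * ‖y‖ := mul_le_mul (hle x) (hle y) (Real.sqrt_nonneg _) (norm_nonneg _)

/-- The trace of a nuclear operator, in an arbitrary orthonormal basis. -/
theorem IsNuclearSum.hasSum_inner {ι κ : Type*} {T : E →L[ℂ] E} {x y : κ → E}
    (h : IsNuclearSum T x y) {t : ℂ} (ht : HasSum (fun k => inner ℂ (x k) (y k)) t)
    (b : HilbertBasis ι ℂ E) : HasSum (fun i => inner ℂ (b i) (T (b i))) t := by
  let f : κ × ι → ℂ := fun p => inner ℂ (x p.1) (b p.2) * inner ℂ (b p.2) (y p.1)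
  have hk : ∀ k, Summable fun i => ‖f (k, i)‖ := fun k =>
    summable_of_sum_le (c := ‖x k‖ * ‖y k‖) (fun i => norm_nonneg _)
      fun s => b.sum_norm_inner_mul_le (x k) (y k) s
  have hf : Summable f := by
    refine Summable.of_norm ((summable_prod_of_nonneg fun _ => norm_nonneg _).2 ⟨hk, ?_⟩)
    exact Summable.of_nonneg_of_le (fun k => tsum_nonneg fun i => norm_nonneg _)
      (fun k => (hk k).tsum_le_of_sum_le fun s => b.sum_norm_inner_mul_le (x k) (y k) s) h.1
  have h1 : HasSum f t := by
    have h2 := hf.hasSum.prod_fiberwise fun k => b.hasSum_inner_mul_inner (x k) (y k)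
    rw [ht.unique h2]
    exact hf.hasSum
  have h2 : HasSum (f ∘ Prod.swap) t := (Equiv.prodComm ι κ).hasSum_iff.2 h1
  refine h2.prod_fiberwise fun i => ?_
  have h3 := (h.2 (b i)).mapL (innerSL ℂ (b i))
  simpa only [innerSL_apply_apply, inner_smul_right] using! h3

theorem IsNuclearSum.hasTrace {E : Type} [NormedAddCommGroup E] [InnerProductSpace ℂ E]
    {κ : Type*} [Countable κ] {T : E →L[ℂ] E} {x y : κ → E} (h : IsNuclearSum T x y) {t : ℂ}
    (ht : HasSum (fun k => inner ℂ (x k) (y k)) t) : HasTrace T t :=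
  ⟨h.isTraceClass, fun _ b => h.hasSum_inner ht b⟩

/-- The amplification `T ⊗ 1` of a nuclear operator is nuclear. -/
theorem IsNuclearSum.amplify [CompleteSpace E] {κ ι : Type*} [Fintype ι] [DecidableEq ι] {T : E →L[ℂ] E}
    {x y : κ → E} (h : IsNuclearSum T x y)
    {S : PiLp 2 (fun _ : ι => E) →L[ℂ] PiLp 2 (fun _ : ι => E)}
    (hS : ∀ ψ i, S ψ i = T (ψ i)) :
    IsNuclearSum S (fun p : ι × κ => PiLp.single 2 p.1 (x p.2))
      (fun p : ι × κ => PiLp.single 2 p.1 (y p.2)) := by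
  have hin : ∀ (i : ι) (v : E) (ψ : PiLp 2 (fun _ : ι => E)),
      inner ℂ (PiLp.single 2 i v : PiLp 2 (fun _ : ι => E)) ψ = inner ℂ v (ψ i) := by
    intro i v ψ
    rw [PiLp.inner_apply, Finset.sum_eq_single i]
    · simp
    · intro j _ hj
      simp [hj]
    · simp
  have hs : Summable fun p : ι × κ => ‖(PiLp.single 2 p.1 (x p.2) : PiLp 2 (fun _ : ι => E))‖ *
      ‖(PiLp.single 2 p.1 (y p.2) : PiLp 2 (fun _ : ι => E))‖ := by
    simp only [PiLp.norm_single]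
    refine (summable_prod_of_nonneg fun _ => by positivity).2 ⟨fun _ => h.1, ?_⟩
    exact (hasSum_fintype _).summable
  refine ⟨hs, fun ψ => ?_⟩
  have hsum : Summable fun p : ι × κ =>
      inner ℂ (PiLp.single 2 p.1 (x p.2) : PiLp 2 (fun _ : ι => E)) ψ •
        (PiLp.single 2 p.1 (y p.2) : PiLp 2 (fun _ : ι => E)) := by
    refine Summable.of_norm_bounded (hs.mul_right ‖ψ‖) fun p => ?_
    rw [norm_smul, mul_right_comm]
    gcongr
    exact norm_inner_le_norm _ _
  have hfib : ∀ i : ι, HasSum (fun k : κ =>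
      inner ℂ (PiLp.single 2 i (x k) : PiLp 2 (fun _ : ι => E)) ψ •
        (PiLp.single 2 i (y k) : PiLp 2 (fun _ : ι => E))) (PiLp.single 2 i (T (ψ i))) := by
    intro i
    have h1 := h.2 (ψ i)
    let L : E →L[ℂ] PiLp 2 (fun _ : ι => E) :=
      (PiLp.continuousLinearEquiv 2 ℂ fun _ : ι => E).symm.toContinuousLinearMap ∘L
        ContinuousLinearMap.single ℂ (fun _ : ι => E) i
    have hL : ∀ v, L v = PiLp.single 2 i v := fun v => rfl
    have h2 := h1.mapL L
    simp only [hin]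
    refine h2.congr_fun fun k => ?_
    rw [map_smul, hL]
  have h1 := hsum.hasSum.prod_fiberwise hfib
  have h2 : S ψ = ∑ i, PiLp.single 2 i (T (ψ i)) := by
    ext j
    rw [hS, WithLp.ofLp_sum, Finset.sum_apply, Finset.sum_eq_single j]
    · simp
    · intro i _ hi
      simp [hi.symm]
    · simp
  rw [h2, (hasSum_fintype _).unique h1]
  exact hsum.hasSum

theorem hasSum_inner_amplify {κ ι : Type*} [Fintype ι] [DecidableEq ι] {x y : κ → E}
    (h : Summable fun k => ‖x k‖ * ‖y k‖) {t : ℂ}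
    (ht : HasSum (fun k => inner ℂ (x k) (y k)) t) :
    HasSum (fun p : ι × κ => inner ℂ (PiLp.single 2 p.1 (x p.2) : PiLp 2 (fun _ : ι => E))
      (PiLp.single 2 p.1 (y p.2))) (Fintype.card ι * t) := by
  have e : ∀ p : ι × κ, inner ℂ (PiLp.single 2 p.1 (x p.2) : PiLp 2 (fun _ : ι => E))
      (PiLp.single 2 p.1 (y p.2)) = inner ℂ (x p.2) (y p.2) := by
    intro p
    rw [PiLp.inner_apply, Finset.sum_eq_single p.1]
    · simp
    · intro j _ hj
      simp [hj]
    · simp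
  simp only [e]
  have hs : Summable fun p : ι × κ => inner ℂ (x p.2) (y p.2) := by
    refine Summable.of_norm_bounded (g := fun p : ι × κ => ‖x p.2‖ * ‖y p.2‖) ?_
      fun p => norm_inner_le_norm _ _
    exact (summable_prod_of_nonneg fun _ => by positivity).2
      ⟨fun _ => h, (hasSum_fintype _).summable⟩
  have h1 := hs.hasSum.prod_fiberwise fun _ => ht
  have h2 : (Fintype.card ι : ℂ) * t = ∑ _i : ι, t := by simp
  rw [h2, (hasSum_fintype _).unique h1]
  exact hs.hasSum

end Nuclear

section KernelOperators

theorem eLpNorm_two_sq {α F : Type*} [MeasurableSpace α] {μ : Measure α} [NormedAddCommGroup F]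
    (f : α → F) : eLpNorm f 2 μ ^ 2 = ∫⁻ a, ‖f a‖ₑ ^ 2 ∂μ := by
  have h := eLpNorm_nnreal_pow_eq_lintegral (μ := μ) (f := f) (p := 2) two_ne_zero
  simpa using h

theorem sq_lintegral_mul_le {α : Type*} [MeasurableSpace α] {μ : Measure α} {f g : α → ℝ≥0∞}
    (hf : AEMeasurable f μ) (hg : AEMeasurable g μ) :
    (∫⁻ a, f a * g a ∂μ) ^ 2 ≤ (∫⁻ a, f a ^ 2 ∂μ) * ∫⁻ a, g a ^ 2 ∂μ := by
  have h := ENNReal.lintegral_mul_le_Lp_mul_Lq μ Real.HolderConjugate.two_two hf hg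
  have e : ∀ x : ℝ≥0∞, (x ^ (1 / 2 : ℝ)) ^ 2 = x := by
    intro x
    rw [← ENNReal.rpow_natCast, ← ENNReal.rpow_mul]
    norm_num
  calc _ ≤ ((∫⁻ a, f a ^ (2 : ℝ) ∂μ) ^ (1 / 2 : ℝ) * (∫⁻ a, g a ^ (2 : ℝ) ∂μ) ^ (1 / 2 : ℝ)) ^ 2 :=
        pow_le_pow_left₀ zero_le h 2
    _ = _ := by
        rw [mul_pow, e, e]
        norm_cast

variable {α β : Type*} [MeasurableSpace α] [MeasurableSpace β] {μ : Measure α} {ν : Measure β}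

theorem lintegral_sq_lt_top {K : α × β → ℂ} (hK : MemLp K 2 (μ.prod ν)) :
    ∫⁻ p, ‖K p‖ₑ ^ 2 ∂(μ.prod ν) < ∞ := by
  rw [← eLpNorm_two_sq]
  exact ENNReal.pow_lt_top hK.2

theorem inner_toLp_conj {K : β → ℂ} (hK : MemLp K 2 ν) (ψ : Lp ℂ 2 ν) :
    inner ℂ (hK.star.toLp (star K)) ψ = ∫ b, K b * ψ b ∂ν := by
  rw [L2.inner_def]
  refine integral_congr_ae ?_
  filter_upwards [hK.star.coeFn_toLp] with b hb
  rw [hb, RCLike.inner_apply]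
  simp [mul_comm]

/-- The adjoint kernel. -/
def adjKernel (K : α × β → ℂ) : β × α → ℂ := fun p => conj (K (p.2, p.1))

theorem measurable_adjKernel {K : α × β → ℂ} (hK : Measurable K) : Measurable (adjKernel K) := by
  unfold adjKernel
  exact Complex.continuous_conj.measurable.comp (hK.comp measurable_swap)

variable [SFinite ν]

theorem measurable_lintegral_kernel {K : α × β → ℂ} (hK : Measurable K) (ψ : Lp ℂ 2 ν) :
    Measurable fun a => ∫⁻ b, ‖K (a, b)‖ₑ * ‖ψ b‖ₑ ∂ν := by
  have hψ : Measurable ψ := (Lp.stronglyMeasurable ψ).measurable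
  exact Measurable.lintegral_prod_right' (f := fun p : α × β => ‖K p‖ₑ * ‖ψ p.2‖ₑ) (by fun_prop)

theorem ae_integrable_kernel {K : α × β → ℂ} (hK : Measurable K) {ψ : Lp ℂ 2 ν}
    (h : ∫⁻ a, (∫⁻ b, ‖K (a, b)‖ₑ * ‖ψ b‖ₑ ∂ν) ^ 2 ∂μ < ∞) :
    ∀ᵐ a ∂μ, Integrable (fun b => K (a, b) * ψ b) ν := by
  have hψ : Measurable ψ := (Lp.stronglyMeasurable ψ).measurable
  filter_upwards [ae_lt_top ((measurable_lintegral_kernel hK ψ).pow_const 2) h.ne] with a ha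
  refine ⟨Measurable.aestronglyMeasurable (by fun_prop), ?_⟩
  rw [hasFiniteIntegral_iff_enorm]
  simp only [enorm_mul]
  by_contra h'
  rw [not_lt, top_le_iff] at h'
  simp [h'] at ha

/-- An integral operator whose absolute value is bounded on `L²` is bounded on `L²`. -/
theorem exists_kernelOp {K : α × β → ℂ} (hK : Measurable K) {C : ℝ≥0∞} (hC : C ≠ ∞)
    (hbd : ∀ ψ : Lp ℂ 2 ν, ∫⁻ a, (∫⁻ b, ‖K (a, b)‖ₑ * ‖ψ b‖ₑ ∂ν) ^ 2 ∂μ ≤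
      C * ∫⁻ b, ‖ψ b‖ₑ ^ 2 ∂ν) :
    ∃ T : Lp ℂ 2 ν →L[ℂ] Lp ℂ 2 μ, ∀ ψ, T ψ =ᵐ[μ] fun a => ∫ b, K (a, b) * ψ b ∂ν := by
  have hfin : ∀ ψ : Lp ℂ 2 ν, ∫⁻ a, (∫⁻ b, ‖K (a, b)‖ₑ * ‖ψ b‖ₑ ∂ν) ^ 2 ∂μ < ∞ := by
    intro ψ
    refine (hbd ψ).trans_lt (ENNReal.mul_lt_top hC.lt_top ?_)
    rw [← eLpNorm_two_sq]
    exact ENNReal.pow_lt_top (Lp.eLpNorm_lt_top ψ)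
  have hle : ∀ ψ : Lp ℂ 2 ν, eLpNorm (fun a => ∫ b, K (a, b) * ψ b ∂ν) 2 μ ^ 2 ≤
      C * eLpNorm ψ 2 ν ^ 2 := by
    intro ψ
    rw [eLpNorm_two_sq, eLpNorm_two_sq]
    refine (lintegral_mono fun a => ?_).trans (hbd ψ)
    gcongr
    refine (enorm_integral_le_lintegral_enorm _).trans ?_
    simp only [enorm_mul, le_refl]
  have hmem : ∀ ψ : Lp ℂ 2 ν, MemLp (fun a => ∫ b, K (a, b) * ψ b ∂ν) 2 μ := by
    intro ψ
    have hψ : Measurable ψ := (Lp.stronglyMeasurable ψ).measurable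
    refine ⟨?_, ?_⟩
    · refine (StronglyMeasurable.integral_prod_right'
        (f := fun p : α × β => K p * ψ p.2) ?_).aestronglyMeasurable
      exact Measurable.stronglyMeasurable (by fun_prop)
    · by_contra h'
      rw [not_lt, top_le_iff] at h'
      have := hle ψ
      rw [h', ENNReal.top_pow two_ne_zero, top_le_iff] at this
      exact ENNReal.mul_ne_top hC (ENNReal.pow_ne_top (Lp.eLpNorm_ne_top ψ)) this
  let L : Lp ℂ 2 ν →ₗ[ℂ] Lp ℂ 2 μ :=
    { toFun := fun ψ => (hmem ψ).toLp
      map_add' := by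
        intro ψ χ
        rw [← MemLp.toLp_add]
        refine MemLp.toLp_congr _ _ ?_
        filter_upwards [ae_integrable_kernel hK (hfin ψ), ae_integrable_kernel hK (hfin χ)]
          with a h1 h2
        rw [Pi.add_apply, ← integral_add h1 h2]
        refine integral_congr_ae ?_
        filter_upwards [Lp.coeFn_add ψ χ] with b hb
        rw [hb, Pi.add_apply, mul_add]
      map_smul' := by
        intro c ψ
        rw [RingHom.id_apply, ← MemLp.toLp_const_smul]
        refine MemLp.toLp_congr _ _ (.of_forall fun a => ?_)
        simp only [Pi.smul_apply, smul_eq_mul]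
        rw [← integral_const_mul]
        refine integral_congr_ae ?_
        filter_upwards [Lp.coeFn_smul c ψ] with b hb
        rw [hb, Pi.smul_apply, smul_eq_mul, mul_left_comm] }
  refine ⟨L.mkContinuous √C.toReal fun ψ => ?_, fun ψ => (hmem ψ).coeFn_toLp⟩
  change ‖(hmem ψ).toLp‖ ≤ _
  rw [Lp.norm_toLp, Lp.norm_def, ← Real.sqrt_sq ENNReal.toReal_nonneg,
    ← Real.sqrt_sq (ENNReal.toReal_nonneg (a := eLpNorm ψ 2 ν)),
    ← Real.sqrt_mul ENNReal.toReal_nonneg]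
  refine Real.sqrt_le_sqrt ?_
  rw [← ENNReal.toReal_pow, ← ENNReal.toReal_pow, ← ENNReal.toReal_mul]
  exact ENNReal.toReal_mono
    (ENNReal.mul_ne_top hC (ENNReal.pow_ne_top (Lp.eLpNorm_ne_top ψ))) (hle ψ)

/-- **Schur test.** -/
theorem schur_bound [SFinite μ] {K : α × β → ℂ} (hK : Measurable K) {C₁ C₂ : ℝ≥0∞}
    (h₁ : ∀ a, ∫⁻ b, ‖K (a, b)‖ₑ ∂ν ≤ C₁) (h₂ : ∀ b, ∫⁻ a, ‖K (a, b)‖ₑ ∂μ ≤ C₂)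
    (ψ : Lp ℂ 2 ν) :
    ∫⁻ a, (∫⁻ b, ‖K (a, b)‖ₑ * ‖ψ b‖ₑ ∂ν) ^ 2 ∂μ ≤ C₁ * C₂ * ∫⁻ b, ‖ψ b‖ₑ ^ 2 ∂ν := by
  have hψ : Measurable ψ := (Lp.stronglyMeasurable ψ).measurable
  have e : ∀ x : ℝ≥0∞, x = x ^ (1 / 2 : ℝ) * x ^ (1 / 2 : ℝ) := by
    intro x
    rw [← ENNReal.rpow_add_of_nonneg _ _ (by norm_num) (by norm_num)]
    norm_num
  have hpt : ∀ a, (∫⁻ b, ‖K (a, b)‖ₑ * ‖ψ b‖ₑ ∂ν) ^ 2 ≤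
      C₁ * ∫⁻ b, ‖K (a, b)‖ₑ * ‖ψ b‖ₑ ^ 2 ∂ν := by
    intro a
    calc (∫⁻ b, ‖K (a, b)‖ₑ * ‖ψ b‖ₑ ∂ν) ^ 2
        = (∫⁻ b, ‖K (a, b)‖ₑ ^ (1 / 2 : ℝ) * (‖K (a, b)‖ₑ ^ (1 / 2 : ℝ) * ‖ψ b‖ₑ) ∂ν) ^ 2 := by
          congr 2
          ext b
          rw [← mul_assoc, ← e]
      _ ≤ (∫⁻ b, (‖K (a, b)‖ₑ ^ (1 / 2 : ℝ)) ^ 2 ∂ν) *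
          ∫⁻ b, (‖K (a, b)‖ₑ ^ (1 / 2 : ℝ) * ‖ψ b‖ₑ) ^ 2 ∂ν :=
          sq_lintegral_mul_le (by fun_prop) (by fun_prop)
      _ = (∫⁻ b, ‖K (a, b)‖ₑ ∂ν) * ∫⁻ b, ‖K (a, b)‖ₑ * ‖ψ b‖ₑ ^ 2 ∂ν := by
          simp only [mul_pow, sq (_ ^ (1 / 2 : ℝ)), ← e]
      _ ≤ _ := by
          gcongr
          exact h₁ a
  calc _ ≤ ∫⁻ a, C₁ * ∫⁻ b, ‖K (a, b)‖ₑ * ‖ψ b‖ₑ ^ 2 ∂ν ∂μ := lintegral_mono hpt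
    _ = C₁ * ∫⁻ a, ∫⁻ b, ‖K (a, b)‖ₑ * ‖ψ b‖ₑ ^ 2 ∂ν ∂μ := by
        refine lintegral_const_mul _ ?_
        exact Measurable.lintegral_prod_right' (f := fun p : α × β => ‖K p‖ₑ * ‖ψ p.2‖ₑ ^ 2)
          (by fun_prop)
    _ = C₁ * ∫⁻ b, ∫⁻ a, ‖K (a, b)‖ₑ * ‖ψ b‖ₑ ^ 2 ∂μ ∂ν := by
        congr 1
        refine lintegral_lintegral_swap (f := fun a b => ‖K (a, b)‖ₑ * ‖ψ b‖ₑ ^ 2) ?_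
        unfold Function.uncurry
        exact Measurable.aemeasurable (by fun_prop)
    _ ≤ C₁ * ∫⁻ b, C₂ * ‖ψ b‖ₑ ^ 2 ∂ν := by
        gcongr with b
        rw [lintegral_mul_const _ (by fun_prop)]
        gcongr
        exact h₂ b
    _ = _ := by rw [lintegral_const_mul _ (by fun_prop), mul_assoc]

/-- The Hilbert–Schmidt bound. -/
theorem hilbertSchmidt_bound {K : α × β → ℂ} (hK : Measurable K) (ψ : Lp ℂ 2 ν) :
    ∫⁻ a, (∫⁻ b, ‖K (a, b)‖ₑ * ‖ψ b‖ₑ ∂ν) ^ 2 ∂μ ≤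
      (∫⁻ p, ‖K p‖ₑ ^ 2 ∂(μ.prod ν)) * ∫⁻ b, ‖ψ b‖ₑ ^ 2 ∂ν := by
  have hψ : Measurable ψ := (Lp.stronglyMeasurable ψ).measurable
  rw [lintegral_prod _ (by fun_prop), ← lintegral_mul_const _ (by
    exact Measurable.lintegral_prod_right' (f := fun p : α × β => ‖K p‖ₑ ^ 2) (by fun_prop))]
  exact lintegral_mono fun a => sq_lintegral_mul_le (by fun_prop) (by fun_prop)

open Classical in
/-- The Hilbert–Schmidt operator with kernel `K`. -/
def hsOp (K : α × β → ℂ) (μ : Measure α) (ν : Measure β) : Lp ℂ 2 ν →L[ℂ] Lp ℂ 2 μ :=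
  if h : ∃ T : Lp ℂ 2 ν →L[ℂ] Lp ℂ 2 μ, ∀ ψ, T ψ =ᵐ[μ] fun a => ∫ b, K (a, b) * ψ b ∂ν then
    h.choose else 0

theorem hsOp_ae_eq {K : α × β → ℂ} (hK : Measurable K) (hK2 : MemLp K 2 (μ.prod ν))
    (ψ : Lp ℂ 2 ν) : hsOp K μ ν ψ =ᵐ[μ] fun a => ∫ b, K (a, b) * ψ b ∂ν := by
  have h := exists_kernelOp hK (lintegral_sq_lt_top hK2).ne (hilbertSchmidt_bound hK)
  rw [hsOp, dif_pos h]
  exact h.choose_spec ψ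

theorem ae_memLp_section [SFinite μ] {K : α × β → ℂ} (hK : Measurable K) (hK2 : MemLp K 2 (μ.prod ν)) :
    ∀ᵐ a ∂μ, MemLp (fun b => K (a, b)) 2 ν := by
  have h := (memLp_two_iff_integrable_sq_norm hK2.1).1 hK2
  filter_upwards [h.prod_right_ae] with a ha
  exact (memLp_two_iff_integrable_sq_norm (Measurable.aestronglyMeasurable (by fun_prop))).2 ha

/-- Hilbert–Schmidt operators: `∑ᵢ ⟨A eᵢ, B eᵢ⟩` is the scalar product of the kernels. -/
theorem hasSum_inner_hsOp [SFinite μ] {ι : Type*} [Countable ι] (b : HilbertBasis ι ℂ (Lp ℂ 2 ν))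
    {K L : α × β → ℂ} (hK : Measurable K) (hK2 : MemLp K 2 (μ.prod ν)) (hL : Measurable L)
    (hL2 : MemLp L 2 (μ.prod ν)) :
    HasSum (fun i => inner ℂ (hsOp K μ ν (b i)) (hsOp L μ ν (b i)))
      (∫ a, ∫ x, conj (K (a, x)) * L (a, x) ∂ν ∂μ) := by
  simp only [L2.inner_def]
  have hsq : ∀ {M : α × β → ℂ} (hM : Measurable M) (hM2 : MemLp M 2 (μ.prod ν)),
      ∀ᵐ a ∂μ, HasSum (fun i => ‖hsOp M μ ν (b i) a‖ ^ 2) (∫ x, ‖M (a, x)‖ ^ 2 ∂ν) := by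
    intro M hM hM2
    have h1 : ∀ᵐ a ∂μ, ∀ i, hsOp M μ ν (b i) a = ∫ x, M (a, x) * b i x ∂ν :=
      ae_all_iff.2 fun i => hsOp_ae_eq hM hM2 (b i)
    filter_upwards [h1, ae_memLp_section hM hM2] with a h1 h2
    simp only [h1, ← inner_toLp_conj h2]
    convert! b.hasSum_sq_norm_inner (h2.star.toLp _) using 1
    rw [← Complex.ofReal_inj, Complex.ofReal_pow]
    refine Eq.trans ?_ (inner_self_eq_norm_sq_to_K (𝕜 := ℂ) (h2.star.toLp _))
    rw [inner_toLp_conj h2, ← integral_complex_ofReal]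
    refine integral_congr_ae ?_
    filter_upwards [h2.star.coeFn_toLp] with x hx
    rw [hx, Pi.star_apply, RCLike.star_def, Complex.mul_conj, Complex.normSq_eq_norm_sq]
  refine hasSum_integral_of_dominated_convergence
    (fun i a => ‖hsOp K μ ν (b i) a‖ ^ 2 + ‖hsOp L μ ν (b i) a‖ ^ 2) ?_ ?_ ?_ ?_ ?_
  · exact fun i => (Lp.aestronglyMeasurable _).inner (Lp.aestronglyMeasurable _)
  · refine fun i => .of_forall fun a => (norm_inner_le_norm _ _).trans ?_
    nlinarith [sq_nonneg (‖hsOp K μ ν (b i) a‖ - ‖hsOp L μ ν (b i) a‖),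
      sq_nonneg ‖hsOp K μ ν (b i) a‖, sq_nonneg ‖hsOp L μ ν (b i) a‖]
  · filter_upwards [hsq hK hK2, hsq hL hL2] with a h1 h2
    exact (h1.add h2).summable
  · have h1 := ((memLp_two_iff_integrable_sq_norm hK2.1).1 hK2).integral_prod_left
    have h2 := ((memLp_two_iff_integrable_sq_norm hL2.1).1 hL2).integral_prod_left
    refine (h1.add h2).congr ?_
    filter_upwards [hsq hK hK2, hsq hL hL2] with a h1 h2
    exact (h1.add h2).tsum_eq.symm
  · have h1 : ∀ᵐ a ∂μ, ∀ i, hsOp K μ ν (b i) a = ∫ x, K (a, x) * b i x ∂ν :=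
      ae_all_iff.2 fun i => hsOp_ae_eq hK hK2 (b i)
    have h2 : ∀ᵐ a ∂μ, ∀ i, hsOp L μ ν (b i) a = ∫ x, L (a, x) * b i x ∂ν :=
      ae_all_iff.2 fun i => hsOp_ae_eq hL hL2 (b i)
    filter_upwards [h1, h2, ae_memLp_section hK hK2, ae_memLp_section hL hL2] with a h1 h2 h3 h4
    simp only [h1, h2, ← inner_toLp_conj h3, ← inner_toLp_conj h4]
    have h := b.hasSum_inner_mul_inner (h4.star.toLp _) (h3.star.toLp _)
    rw [inner_toLp_conj h4] at h
    convert! h using 1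
    · ext i
      rw [RCLike.inner_apply, inner_conj_symm]
    · refine integral_congr_ae ?_
      filter_upwards [h3.star.coeFn_toLp] with x hx
      rw [hx, Pi.star_apply, RCLike.star_def, mul_comm]

theorem memLp_adjKernel [SFinite μ] {K : α × β → ℂ} (hK2 : MemLp K 2 (μ.prod ν)) :
    MemLp (adjKernel K) 2 (ν.prod μ) := by
  have h := (hK2.comp_measurePreserving (Measure.measurePreserving_swap (μ := ν) (ν := μ))).star
  exact h

theorem integrable_bilinear_kernel [SFinite μ] {K : α × β → ℂ} (hK : Measurable K)
    (hK2 : MemLp K 2 (μ.prod ν)) (φ : Lp ℂ 2 μ) (ψ : Lp ℂ 2 ν) :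
    Integrable (fun p : α × β => conj (φ p.1) * (K p * ψ p.2)) (μ.prod ν) := by
  have hψ : Measurable ψ := (Lp.stronglyMeasurable ψ).measurable
  have hφ : Measurable φ := (Lp.stronglyMeasurable φ).measurable
  have hφ' : Measurable fun a => conj (φ a) := Complex.continuous_conj.measurable.comp hφ
  have hm : Measurable fun p : α × β => conj (φ p.1) * (K p * ψ p.2) :=
    (hφ'.comp measurable_fst).mul (hK.mul (hψ.comp measurable_snd))
  refine ⟨hm.aestronglyMeasurable, ?_⟩
  rw [hasFiniteIntegral_iff_enorm, lintegral_prod _ hm.enorm.aemeasurable]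
  have e : ∀ a b, ‖conj (φ a) * (K (a, b) * ψ b)‖ₑ = ‖φ a‖ₑ * (‖K (a, b)‖ₑ * ‖ψ b‖ₑ) := by
    intro a b
    rw [enorm_mul, enorm_mul, RCLike.enorm_conj]
  simp only [e]
  have e2 : ∀ a, ∫⁻ b, ‖φ a‖ₑ * (‖K (a, b)‖ₑ * ‖ψ b‖ₑ) ∂ν =
      ‖φ a‖ₑ * ∫⁻ b, ‖K (a, b)‖ₑ * ‖ψ b‖ₑ ∂ν := fun a =>
    lintegral_const_mul _ (by fun_prop)
  simp only [e2]
  have h := sq_lintegral_mul_le (μ := μ) (f := fun a => ‖φ a‖ₑ)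
    (g := fun a => ∫⁻ b, ‖K (a, b)‖ₑ * ‖ψ b‖ₑ ∂ν) (by fun_prop)
    (measurable_lintegral_kernel hK ψ).aemeasurable
  have h2 : (∫⁻ a, ‖φ a‖ₑ * ∫⁻ b, ‖K (a, b)‖ₑ * ‖ψ b‖ₑ ∂ν ∂μ) ^ 2 < ∞ := by
    refine h.trans_lt (ENNReal.mul_lt_top ?_ ((hilbertSchmidt_bound hK ψ).trans_lt
      (ENNReal.mul_lt_top (lintegral_sq_lt_top hK2) ?_)))
    · rw [← eLpNorm_two_sq]
      exact ENNReal.pow_lt_top (Lp.eLpNorm_lt_top φ)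
    · rw [← eLpNorm_two_sq]
      exact ENNReal.pow_lt_top (Lp.eLpNorm_lt_top ψ)
  by_contra h'
  rw [not_lt, top_le_iff] at h'
  simp [h'] at h2

theorem adjoint_hsOp [SFinite μ] {K : α × β → ℂ} (hK : Measurable K)
    (hK2 : MemLp K 2 (μ.prod ν)) :
    ContinuousLinearMap.adjoint (hsOp K μ ν) = hsOp (adjKernel K) ν μ := by
  symm
  rw [ContinuousLinearMap.eq_adjoint_iff]
  intro φ ψ
  rw [L2.inner_def, L2.inner_def]
  have hint := integrable_bilinear_kernel hK hK2 φ ψ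
  calc ∫ b, inner ℂ (hsOp (adjKernel K) ν μ φ b) (ψ b) ∂ν
      = ∫ b, ∫ a, conj (φ a) * (K (a, b) * ψ b) ∂μ ∂ν := by
        refine integral_congr_ae ?_
        filter_upwards [hsOp_ae_eq (measurable_adjKernel hK) (memLp_adjKernel hK2) φ] with b hb
        rw [hb, RCLike.inner_apply, ← integral_conj, ← integral_const_mul]
        refine integral_congr_ae (.of_forall fun a => ?_)
        simp [adjKernel]
        ring
    _ = ∫ a, ∫ b, conj (φ a) * (K (a, b) * ψ b) ∂ν ∂μ :=
        (integral_integral_swap (f := fun a b => conj (φ a) * (K (a, b) * ψ b)) hint).symm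
    _ = _ := by
        refine integral_congr_ae ?_
        filter_upwards [hsOp_ae_eq hK hK2 ψ] with a ha
        rw [ha, RCLike.inner_apply, integral_const_mul, mul_comm]

end KernelOperators

section Factorization

theorem _root_.HilbertBasis.countable {E ι : Type*} [NormedAddCommGroup E] [InnerProductSpace ℂ E]
    [SecondCountableTopology E] (b : HilbertBasis ι ℂ E) : Countable ι := by
  have hd : ∀ i j, i ≠ j → 1 ≤ dist (b i) (b j) := by
    intro i j hij
    have h := norm_sub_sq (𝕜 := ℂ) (b i) (b j)
    rw [b.orthonormal.2 hij, b.orthonormal.1 i, b.orthonormal.1 j] at h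
    rw [dist_eq_norm]
    norm_num at h
    nlinarith [norm_nonneg (b i - b j)]
  refine Set.countable_univ_iff.1 (Set.PairwiseDisjoint.countable_of_isOpen
    (s := fun i => Metric.ball (b i) (1 / 2)) ?_ (fun i _ => Metric.isOpen_ball)
    fun i _ => ⟨b i, Metric.mem_ball_self (by norm_num)⟩)
  intro i _ j _ hij
  exact Metric.ball_disjoint_ball (by linarith [hd i j hij])

variable {α X : Type*} [MeasurableSpace α] [MeasurableSpace X] {μ : Measure α} {ξ : Measure X}
  [SFinite μ] [SFinite ξ]

/-- The composition of two Hilbert–Schmidt operators is nuclear. -/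
theorem isNuclearSum_hsOp {ι : Type*} [Countable ι] (h : HilbertBasis ι ℂ (Lp ℂ 2 ξ))
    {U V : α × X → ℂ} (hU : Measurable U) (hU2 : MemLp U 2 (μ.prod ξ)) (hV : Measurable V)
    (hV2 : MemLp V 2 (μ.prod ξ)) :
    IsNuclearSum (hsOp U μ ξ ∘L ContinuousLinearMap.adjoint (hsOp V μ ξ))
      (fun i => hsOp V μ ξ (h i)) (fun i => hsOp U μ ξ (h i)) := by
  have hsq : ∀ {M : α × X → ℂ} (hM : Measurable M) (hM2 : MemLp M 2 (μ.prod ξ)),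
      Summable fun i => ‖hsOp M μ ξ (h i)‖ ^ 2 := by
    intro M hM hM2
    have := (hasSum_inner_hsOp h hM hM2 hM hM2).summable
    simp only [inner_self_eq_norm_sq_to_K] at this
    exact_mod_cast this
  refine ⟨?_, fun ψ => ?_⟩
  · refine Summable.of_nonneg_of_le (fun i => by positivity) (fun i => ?_)
      ((hsq hV hV2).add (hsq hU hU2))
    nlinarith [sq_nonneg (‖hsOp V μ ξ (h i)‖ - ‖hsOp U μ ξ (h i)‖),
      sq_nonneg ‖hsOp V μ ξ (h i)‖, sq_nonneg ‖hsOp U μ ξ (h i)‖]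
  · have h1 := (h.hasSum_repr (ContinuousLinearMap.adjoint (hsOp V μ ξ) ψ)).mapL (hsOp U μ ξ)
    simpa only [map_smul, h.repr_apply_apply, ContinuousLinearMap.adjoint_inner_right] using! h1

theorem hsOp_comp_adjoint_ae_eq {U V : α × X → ℂ} (hU : Measurable U)
    (hU2 : MemLp U 2 (μ.prod ξ)) (hV : Measurable V) (hV2 : MemLp V 2 (μ.prod ξ))
    (ψ : Lp ℂ 2 μ) :
    (hsOp U μ ξ ∘L ContinuousLinearMap.adjoint (hsOp V μ ξ)) ψ =ᵐ[μ]
      fun a => ∫ b, (∫ x, U (a, x) * conj (V (b, x)) ∂ξ) * ψ b ∂μ := by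
  rw [adjoint_hsOp hV hV2, ContinuousLinearMap.comp_apply]
  have hV' := measurable_adjKernel hV
  have hV2' := memLp_adjKernel hV2
  filter_upwards [hsOp_ae_eq hU hU2 (hsOp (adjKernel V) ξ μ ψ), ae_memLp_section hU hU2]
    with a ha hUa
  rw [ha]
  have hint := integrable_bilinear_kernel hV' hV2' (hUa.star.toLp _) ψ
  calc ∫ x, U (a, x) * hsOp (adjKernel V) ξ μ ψ x ∂ξ
      = ∫ x, ∫ b, conj (hUa.star.toLp _ x) * (adjKernel V (x, b) * ψ b) ∂μ ∂ξ := by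
        refine integral_congr_ae ?_
        filter_upwards [hsOp_ae_eq hV' hV2' ψ, hUa.star.coeFn_toLp] with x hx hx2
        rw [hx, hx2, integral_const_mul]
        simp
    _ = ∫ b, ∫ x, conj (hUa.star.toLp _ x) * (adjKernel V (x, b) * ψ b) ∂ξ ∂μ :=
        integral_integral_swap (f := fun x b =>
          conj (hUa.star.toLp _ x) * (adjKernel V (x, b) * ψ b)) hint
    _ = _ := by
        refine integral_congr_ae (.of_forall fun b => ?_)
        simp only
        rw [← integral_mul_const]
        refine integral_congr_ae ?_
        filter_upwards [hUa.star.coeFn_toLp] with x hx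
        rw [hx]
        simp [adjKernel]
        ring

/-- An integral operator whose kernel is `∫ U(a, x) conj V(b, x) dx`, with `U` and `V` square
integrable, is nuclear, and its trace is the integral of its kernel over the diagonal. -/
theorem exists_nuclear_of_factorization [SecondCountableTopology (Lp ℂ 2 ξ)] {U V : α × X → ℂ}
    (hU : Measurable U) (hU2 : MemLp U 2 (μ.prod ξ)) (hV : Measurable V)
    (hV2 : MemLp V 2 (μ.prod ξ)) :
    ∃ (T : Lp ℂ 2 μ →L[ℂ] Lp ℂ 2 μ) (ι : Set (Lp ℂ 2 ξ)) (x y : ι → Lp ℂ 2 μ),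
      (∀ ψ, T ψ =ᵐ[μ] fun a => ∫ b, (∫ x, U (a, x) * conj (V (b, x)) ∂ξ) * ψ b ∂μ) ∧
      Countable ι ∧ IsNuclearSum T x y ∧
      HasSum (fun i => inner ℂ (x i) (y i)) (∫ a, ∫ x, U (a, x) * conj (V (a, x)) ∂ξ ∂μ) := by
  obtain ⟨w, h, -⟩ := exists_hilbertBasis ℂ (Lp ℂ 2 ξ)
  have hw : Countable w := h.countable
  refine ⟨_, w, _, _, hsOp_comp_adjoint_ae_eq hU hU2 hV hV2, hw,
    isNuclearSum_hsOp h hU hU2 hV hV2, ?_⟩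
  simpa only [mul_comm] using hasSum_inner_hsOp h hV hV2 hU hU2

end Factorization

section Multiplication

open scoped BoundedContinuousFunction

variable {α : Type*} [TopologicalSpace α] [MeasurableSpace α] [BorelSpace α] {μ : Measure α}

theorem memLp_bdd_mul {α : Type*} [MeasurableSpace α] {μ : Measure α} {g : α → ℂ}
    (hg : Measurable g) {C : ℝ} (hC : ∀ x, ‖g x‖ ≤ C) {ψ : α → ℂ} (hψ : MemLp ψ 2 μ) :
    MemLp (fun x => g x * ψ x) 2 μ :=
  hψ.of_le_mul (c := C) (hg.aestronglyMeasurable.mul hψ.1) (.of_forall fun x => by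
    rw [norm_mul]
    gcongr
    exact hC x)

/-- Multiplication by a bounded continuous function on `L²`. -/
def mulLp (μ : Measure α) (g : α →ᵇ ℂ) : Lp ℂ 2 μ →L[ℂ] Lp ℂ 2 μ :=
  LinearMap.mkContinuous
    { toFun := fun ψ => (memLp_bdd_mul g.continuous.measurable g.norm_coe_le_norm
        (Lp.memLp ψ)).toLp
      map_add' := by
        intro ψ χ
        rw [← MemLp.toLp_add]
        refine MemLp.toLp_congr _ _ ?_
        filter_upwards [Lp.coeFn_add ψ χ] with p hp
        rw [hp, Pi.add_apply, Pi.add_apply, mul_add]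
      map_smul' := by
        intro c ψ
        rw [RingHom.id_apply, ← MemLp.toLp_const_smul]
        refine MemLp.toLp_congr _ _ ?_
        filter_upwards [Lp.coeFn_smul c ψ] with p hp
        rw [hp, Pi.smul_apply, Pi.smul_apply, smul_eq_mul, smul_eq_mul, mul_left_comm] }
    ‖g‖ fun ψ => by
      refine Lp.norm_le_mul_norm_of_ae_le_mul ?_
      filter_upwards [(memLp_bdd_mul g.continuous.measurable g.norm_coe_le_norm
        (Lp.memLp ψ)).coeFn_toLp] with p hp
      change ‖(memLp_bdd_mul g.continuous.measurable g.norm_coe_le_norm (Lp.memLp ψ)).toLp _ p‖ ≤ _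
      rw [hp, norm_mul]
      gcongr
      exact g.norm_coe_le_norm p

theorem mulLp_ae_eq (g : α →ᵇ ℂ) (ψ : Lp ℂ 2 μ) : mulLp μ g ψ =ᵐ[μ] fun p => g p * ψ p :=
  (memLp_bdd_mul g.continuous.measurable g.norm_coe_le_norm (Lp.memLp ψ)).coeFn_toLp

/-- The representation of bounded continuous functions by multiplication operators. -/
def mulRep (μ : Measure α) : (α →ᵇ ℂ) →⋆ₐ[ℂ] (Lp ℂ 2 μ →L[ℂ] Lp ℂ 2 μ) where
  toFun := mulLp μ
  map_one' := by
    ext1 ψ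
    ext1
    filter_upwards [mulLp_ae_eq 1 ψ] with p hp
    rw [hp]
    simp
  map_mul' g h := by
    ext1 ψ
    ext1
    filter_upwards [mulLp_ae_eq (g * h) ψ, mulLp_ae_eq g (mulLp μ h ψ), mulLp_ae_eq h ψ]
      with p h1 h2 h3
    refine h1.trans (Eq.trans ?_ h2.symm)
    rw [h3]
    simp [mul_assoc]
  map_zero' := by
    ext1 ψ
    ext1
    filter_upwards [mulLp_ae_eq 0 ψ, Lp.coeFn_zero ℂ 2 μ] with p h1 h2
    refine h1.trans (Eq.trans ?_ h2.symm)
    simp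
  map_add' g h := by
    ext1 ψ
    ext1
    filter_upwards [mulLp_ae_eq (g + h) ψ, mulLp_ae_eq g ψ, mulLp_ae_eq h ψ,
      Lp.coeFn_add (mulLp μ g ψ) (mulLp μ h ψ)] with p h1 h2 h3 h4
    refine h1.trans (Eq.trans ?_ h4.symm)
    rw [Pi.add_apply, h2, h3]
    simp [add_mul]
  commutes' c := by
    ext1 ψ
    ext1
    filter_upwards [mulLp_ae_eq (algebraMap ℂ (α →ᵇ ℂ) c) ψ, Lp.coeFn_smul c ψ] with p h1 h2
    refine h1.trans (Eq.trans ?_ h2.symm)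
    simp [Algebra.algebraMap_eq_smul_one]
  map_star' g := by
    rw [ContinuousLinearMap.star_eq_adjoint, ContinuousLinearMap.eq_adjoint_iff]
    intro φ ψ
    rw [L2.inner_def, L2.inner_def]
    refine integral_congr_ae ?_
    filter_upwards [mulLp_ae_eq (star g) φ, mulLp_ae_eq g ψ] with p h1 h2
    rw [h1, h2]
    simp
    ring

/-- The amplification `T ⊗ 1`. -/
def amplify {E : Type*} [NormedAddCommGroup E] [InnerProductSpace ℂ E] (ι : Type*) [Fintype ι]
    (T : E →L[ℂ] E) : PiLp 2 (fun _ : ι => E) →L[ℂ] PiLp 2 (fun _ : ι => E) :=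
  (PiLp.continuousLinearEquiv 2 ℂ fun _ : ι => E).symm.toContinuousLinearMap ∘L
    (ContinuousLinearMap.piMap fun _ => T) ∘L
    (PiLp.continuousLinearEquiv 2 ℂ fun _ : ι => E).toContinuousLinearMap

theorem amplify_apply {E : Type*} [NormedAddCommGroup E] [InnerProductSpace ℂ E] {ι : Type*}
    [Fintype ι] (T : E →L[ℂ] E) (ψ : PiLp 2 (fun _ : ι => E)) (i : ι) :
    amplify ι T ψ i = T (ψ i) := rfl

/-- The amplification `T ↦ T ⊗ 1`, as a homomorphism. -/
def amplifyHom (E : Type*) [NormedAddCommGroup E] [InnerProductSpace ℂ E] [CompleteSpace E]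
    (ι : Type*) [Fintype ι] :
    (E →L[ℂ] E) →⋆ₐ[ℂ] (PiLp 2 (fun _ : ι => E) →L[ℂ] PiLp 2 (fun _ : ι => E)) where
  toFun := amplify ι
  map_one' := by ext1 ψ; ext i; simp [amplify_apply]
  map_mul' S T := by ext1 ψ; ext i; simp [amplify_apply]
  map_zero' := by ext1 ψ; ext i; simp [amplify_apply]
  map_add' S T := by ext1 ψ; ext i; simp [amplify_apply]
  commutes' c := by ext1 ψ; ext i; simp [amplify_apply, Algebra.algebraMap_eq_smul_one]
  map_star' T := by
    rw [ContinuousLinearMap.star_eq_adjoint (amplify ι T), ContinuousLinearMap.eq_adjoint_iff]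
    intro φ ψ
    simp only [PiLp.inner_apply, amplify_apply, ContinuousLinearMap.star_eq_adjoint,
      ContinuousLinearMap.adjoint_inner_left]

instance instCStarAlgebraBCF {α : Type*} [TopologicalSpace α] : CStarAlgebra (α →ᵇ ℂ) where

theorem cfc_bcf_apply {α : Type*} [TopologicalSpace α] (f : ℂ → ℂ) (g : α →ᵇ ℂ) (hf : ContinuousOn f (spectrum ℂ g)) (x : α) :
    cfc f g x = f (g x) := by
  let ev : (α →ᵇ ℂ) →⋆ₐ[ℂ] ℂ :=
    { toFun := fun h => h x
      map_one' := rfl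
      map_mul' := fun _ _ => rfl
      map_zero' := rfl
      map_add' := fun _ _ => rfl
      commutes' := fun _ => rfl
      map_star' := fun _ => rfl }
  have hev : Continuous ev := continuous_eval_const x
  have h := StarAlgHom.map_cfc ev f g hf hev (by cfc_tac) (by cfc_tac)
  change ev (cfc f g) = _
  rw [h]
  exact cfc_algebraMap (A := ℂ) (g x) f

end Multiplication

section Dirac

open scoped BoundedContinuousFunction

variable {d : ℕ} {lam mu : ℝ}

theorem mulOp_ae_eq {m : Pt d → ℂ} (ψ : (mulOp lam m).domain) :
    mulOp lam m ψ =ᵐ[momMeasure d lam] fun p => m p * (ψ : Hr d lam) p :=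
  MemLp.coeFn_toLp ψ.2

theorem coeFn_finset_sum {ι : Type*} (s : Finset ι) (f : ι → Hr d lam) :
    ((∑ i ∈ s, f i : Hr d lam) : Pt d → ℂ) =ᵐ[momMeasure d lam] fun p => ∑ i ∈ s, f i p := by
  classical
  induction s using Finset.induction_on with
  | empty =>
    filter_upwards [Lp.coeFn_zero ℂ 2 (momMeasure d lam)] with p hp
    simpa using hp
  | insert i s hi ih =>
    rw [Finset.sum_insert hi]
    filter_upwards [Lp.coeFn_add (f i) (∑ i ∈ s, f i), ih] with p h1 h2
    rw [h1, Pi.add_apply, h2, Finset.sum_insert hi]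

theorem matOp_ae_eq {ι : Type} [Fintype ι]
    {A : ι → Matrix (Fin (spinDim d)) (Fin (spinDim d)) ℂ} {m : ι → Pt d → ℂ}
    (ψ : (matOp lam A m).domain) (a : Fin (spinDim d)) :
    (matOp lam A m ψ) a =ᵐ[momMeasure d lam]
      fun p => ∑ i, ∑ j, A i a j * (m i p * (ψ : HSpin d lam) j p) := by
  have h1 : ∀ i j, (A i a j • mulOp lam (m i) ⟨(ψ : HSpin d lam) j, ψ.2 i j⟩ : Hr d lam)
      =ᵐ[momMeasure d lam] fun p => A i a j * (m i p * (ψ : HSpin d lam) j p) := by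
    intro i j
    filter_upwards [Lp.coeFn_smul (A i a j) (mulOp lam (m i) ⟨(ψ : HSpin d lam) j, ψ.2 i j⟩),
      mulOp_ae_eq (lam := lam) (m := m i) ⟨(ψ : HSpin d lam) j, ψ.2 i j⟩] with p h1 h2
    rw [h1, Pi.smul_apply, h2, smul_eq_mul]
  have h2 : ∀ᵐ p ∂(momMeasure d lam), ∀ i j,
      (A i a j • mulOp lam (m i) ⟨(ψ : HSpin d lam) j, ψ.2 i j⟩ : Hr d lam) p =
        A i a j * (m i p * (ψ : HSpin d lam) j p) :=
    ae_all_iff.2 fun i => ae_all_iff.2 fun j => h1 i j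
  have h3 : ∀ᵐ p ∂(momMeasure d lam), ∀ i,
      (∑ j, A i a j • mulOp lam (m i) ⟨(ψ : HSpin d lam) j, ψ.2 i j⟩ : Hr d lam) p =
        ∑ j, (A i a j • mulOp lam (m i) ⟨(ψ : HSpin d lam) j, ψ.2 i j⟩ : Hr d lam) p :=
    ae_all_iff.2 fun i => coeFn_finset_sum _ _
  filter_upwards [h2, h3, coeFn_finset_sum Finset.univ fun i =>
    (∑ j, A i a j • mulOp lam (m i) ⟨(ψ : HSpin d lam) j, ψ.2 i j⟩ : Hr d lam)] with p h2 h3 h4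
  refine h4.trans (Finset.sum_congr rfl fun i _ => ?_)
  rw [h3]
  exact Finset.sum_congr rfl fun j _ => h2 i j

/-- The matrix `∑_μ D_μ(p) Γ^μ`. -/
def diracMat (lam : ℝ) (Γ : Fin (d + 1) → Matrix (Fin (spinDim d)) (Fin (spinDim d)) ℂ)
    (p : Pt d) : Matrix (Fin (spinDim d)) (Fin (spinDim d)) ℂ :=
  ∑ i, diracSymbol lam i p • Γ i

theorem dirac_ae_eq {Γ : Fin (d + 1) → Matrix (Fin (spinDim d)) (Fin (spinDim d)) ℂ}
    (ψ : (dirac lam Γ).domain) (a : Fin (spinDim d)) :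
    (dirac lam Γ ψ) a =ᵐ[momMeasure d lam]
      fun p => (diracMat lam Γ p).mulVec (fun j => (ψ : HSpin d lam) j p) a := by
  filter_upwards [matOp_ae_eq (lam := lam) (A := Γ) (m := diracSymbol lam) ψ a] with p hp
  refine hp.trans ?_
  simp only [diracMat, Matrix.mulVec, dotProduct, Matrix.sum_apply, Matrix.smul_apply,
    smul_eq_mul, Finset.sum_mul]
  rw [Finset.sum_comm]
  exact Finset.sum_congr rfl fun j _ => Finset.sum_congr rfl fun i _ => by ring

theorem sum_sq_diracSymbol (p : Pt d) :
    ∑ i, diracSymbol lam i p ^ 2 = ((dZero lam p.1 ^ 2 + ‖p.2‖ ^ 2 : ℝ) : ℂ) := by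
  rw [Fin.sum_univ_succ, EuclideanSpace.norm_sq_eq]
  simp [diracSymbol, dZero]

theorem diracMat_mul_self {Γ : Fin (d + 1) → Matrix (Fin (spinDim d)) (Fin (spinDim d)) ℂ}
    (hΓ : IsClifford Γ) (p : Pt d) :
    diracMat lam Γ p * diracMat lam Γ p =
      ((dZero lam p.1 ^ 2 + ‖p.2‖ ^ 2 : ℝ) : ℂ) • (1 : Matrix _ _ ℂ) := by
  have h1 : diracMat lam Γ p * diracMat lam Γ p =
      ∑ i, ∑ j, (diracSymbol lam i p * diracSymbol lam j p) • (Γ i * Γ j) := by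
    simp only [diracMat, Finset.sum_mul_sum, smul_mul_smul_comm]
  have h2 : diracMat lam Γ p * diracMat lam Γ p =
      ∑ i, ∑ j, (diracSymbol lam i p * diracSymbol lam j p) • (Γ j * Γ i) := by
    rw [h1, Finset.sum_comm]
    exact Finset.sum_congr rfl fun i _ => Finset.sum_congr rfl fun j _ => by
      rw [mul_comm (diracSymbol lam i p)]
  have h3 : (2 : ℂ) • (diracMat lam Γ p * diracMat lam Γ p) =
      (2 : ℂ) • (∑ i, diracSymbol lam i p ^ 2) • (1 : Matrix _ _ ℂ) := by
    rw [two_smul]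
    nth_rw 1 [h1]
    rw [h2]
    simp only [← Finset.sum_add_distrib, ← smul_add, hΓ.2]
    simp only [smul_ite, smul_zero, Finset.sum_ite_eq, Finset.mem_univ, if_true]
    rw [Finset.sum_smul, Finset.smul_sum]
    refine Finset.sum_congr rfl fun i _ => ?_
    rw [smul_comm, ← sq]
    congr 1
    rw [two_smul, one_add_one_eq_two]
  rw [← sum_sq_diracSymbol]
  exact smul_right_injective _ two_ne_zero h3

theorem measurable_diracSymbol (i : Fin (d + 1)) : Measurable (diracSymbol (d := d) lam i) := by
  refine Fin.cases ?_ (fun j => ?_) i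
  · simp only [diracSymbol, Fin.cons_zero]
    fun_prop
  · simp only [diracSymbol, Fin.cons_succ]
    fun_prop

theorem norm_diracSymbol_sq_le (mu : ℝ) (i : Fin (d + 1)) (p : Pt d) :
    ‖diracSymbol lam i p‖ ^ 2 ≤ symb lam mu p := by
  have hsum : ∑ i, ‖diracSymbol lam i p‖ ^ 2 = dZero lam p.1 ^ 2 + ‖p.2‖ ^ 2 := by
    rw [Fin.sum_univ_succ, EuclideanSpace.norm_sq_eq]
    simp only [diracSymbol, dZero, Fin.cons_zero, Fin.cons_succ, Complex.norm_real,
      Real.norm_eq_abs, sq_abs]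
  have h1 := Finset.single_le_sum (f := fun i => ‖diracSymbol lam i p‖ ^ 2)
    (fun _ _ => by positivity) (Finset.mem_univ i)
  simp only [hsum] at h1
  unfold symb
  nlinarith [sq_nonneg mu]

/-- The bounded continuous function `(D² + μ²)⁻¹` of the momentum. -/
def symbInv (d : ℕ) (lam : ℝ) {mu : ℝ} (hmu : mu ≠ 0) : Pt d →ᵇ ℂ :=
  BoundedContinuousFunction.ofNormedAddCommGroup (fun p => (((symb lam mu p)⁻¹ : ℝ) : ℂ))
    (by
      exact Complex.continuous_ofReal.comp
        ((continuous_symb (d := d) lam mu).inv₀ fun p => (symb_pos lam hmu p).ne')) (mu ^ 2)⁻¹ (fun p => by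
      rw [Complex.norm_real, Real.norm_of_nonneg (inv_nonneg.2 (symb_pos lam hmu p).le)]
      exact inv_anti₀ (by positivity) (sq_le_symb lam mu p))

theorem symbInv_apply (hmu : mu ≠ 0) (p : Pt d) :
    symbInv d lam hmu p = (((symb lam mu p)⁻¹ : ℝ) : ℂ) := rfl

/-- Multiplication by a bounded continuous function of the momentum, on spinors. -/
def spinRep (d : ℕ) (lam : ℝ) : (Pt d →ᵇ ℂ) →⋆ₐ[ℂ] (HSpin d lam →L[ℂ] HSpin d lam) :=
  (amplifyHom (Hr d lam) (Fin (spinDim d))).comp (mulRep (momMeasure d lam))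

theorem spinRep_ae_eq (g : Pt d →ᵇ ℂ) (ψ : HSpin d lam) (j : Fin (spinDim d)) :
    (spinRep d lam g ψ) j =ᵐ[momMeasure d lam] fun p => g p * ψ j p :=
  mulLp_ae_eq g (ψ j)

theorem norm_symbInv_mul_le (hmu : mu ≠ 0) (p : Pt d) {s t : ℂ} (hs : ‖s‖ ^ 2 ≤ symb lam mu p)
    (ht : ‖t‖ ^ 2 ≤ symb lam mu p) : ‖s * t * symbInv d lam hmu p‖ ≤ 1 := by
  have h0 := symb_pos lam hmu p
  rw [norm_mul, norm_mul, symbInv_apply, Complex.norm_real,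
    Real.norm_of_nonneg (inv_nonneg.2 h0.le), ← div_eq_mul_inv, div_le_one h0]
  nlinarith [sq_nonneg (‖s‖ - ‖t‖)]

theorem isSqAddInv_dirac {Γ : Fin (d + 1) → Matrix (Fin (spinDim d)) (Fin (spinDim d)) ℂ}
    (hΓ : IsClifford Γ) (hmu : mu ≠ 0) :
    IsSqAddInv (dirac lam Γ) mu (spinRep d lam (symbInv d lam hmu)) := by
  set R := spinRep d lam (symbInv d lam hmu) with hR
  have hsq : ∀ (p : Pt d) (v : Fin (spinDim d) → ℂ),
      (diracMat lam Γ p).mulVec ((diracMat lam Γ p).mulVec v) + ((mu ^ 2 : ℝ) : ℂ) • v =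
        ((symb lam mu p : ℝ) : ℂ) • v := by
    intro p v
    rw [Matrix.mulVec_mulVec, diracMat_mul_self hΓ, Matrix.smul_mulVec, Matrix.one_mulVec,
      ← add_smul, symb]
    push_cast
    rfl
  have hinv : ∀ p : Pt d, symbInv d lam hmu p * ((symb lam mu p : ℝ) : ℂ) = 1 := by
    intro p
    rw [symbInv_apply, ← Complex.ofReal_mul, inv_mul_cancel₀ (symb_pos lam hmu p).ne',
      Complex.ofReal_one]
  have hs1 : ∀ p : Pt d, ‖((|mu| : ℝ) : ℂ)‖ ^ 2 ≤ symb lam mu p := by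
    intro p
    simpa using sq_le_symb lam mu p
  constructor
  · intro ψ
    have hall : ∀ᵐ p ∂(momMeasure d lam), ∀ j, R ψ j p = symbInv d lam hmu p * ψ j p :=
      ae_all_iff.2 fun j => spinRep_ae_eq _ ψ j
    have h₁ : R ψ ∈ (dirac lam Γ).domain := by
      intro i j
      have hb := memLp_bdd_mul (g := fun p => diracSymbol lam i p * ((|mu| : ℝ) : ℂ) *
        symbInv d lam hmu p) (((measurable_diracSymbol i).mul_const _).mul
          (symbInv d lam hmu).continuous.measurable) (fun p =>
        norm_symbInv_mul_le hmu p (norm_diracSymbol_sq_le mu i p) (hs1 p)) (Lp.memLp (ψ j))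
      refine (memLp_congr_ae ?_).2 (hb.const_mul ((|mu| : ℝ) : ℂ)⁻¹)
      filter_upwards [hall] with p hp
      rw [hp]
      have : ((|mu| : ℝ) : ℂ) ≠ 0 := by exact_mod_cast abs_ne_zero.2 hmu
      field_simp
    have hD : ∀ᵐ p ∂(momMeasure d lam), ∀ a, dirac lam Γ ⟨R ψ, h₁⟩ a p =
        (diracMat lam Γ p).mulVec (fun j => R ψ j p) a :=
      ae_all_iff.2 fun a => dirac_ae_eq ⟨R ψ, h₁⟩ a
    have h₂ : dirac lam Γ ⟨R ψ, h₁⟩ ∈ (dirac lam Γ).domain := by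
      intro i a
      have hb : MemLp (fun p => ∑ l, ∑ j, Γ l a j * (diracSymbol lam i p * diracSymbol lam l p *
          symbInv d lam hmu p * ψ j p)) 2 (momMeasure d lam) := by
        refine memLp_finsetSum _ fun l _ => memLp_finsetSum _ fun j _ => MemLp.const_mul ?_ _
        exact memLp_bdd_mul (((measurable_diracSymbol i).mul (measurable_diracSymbol l)).mul
          (symbInv d lam hmu).continuous.measurable) (fun p =>
            norm_symbInv_mul_le hmu p (norm_diracSymbol_sq_le mu i p)
              (norm_diracSymbol_sq_le mu l p)) (Lp.memLp (ψ j))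
      refine (memLp_congr_ae ?_).2 hb
      filter_upwards [hall, hD] with p hp hDp
      rw [hDp]
      simp only [hp, diracMat, Matrix.mulVec, dotProduct, Matrix.sum_apply, Matrix.smul_apply,
        smul_eq_mul, Finset.sum_mul, Finset.mul_sum]
      rw [Finset.sum_comm]
      exact Finset.sum_congr rfl fun j _ => Finset.sum_congr rfl fun i _ => by ring
    refine ⟨h₁, h₂, ?_⟩
    ext1 a
    ext1
    have hsum := Lp.coeFn_add (dirac lam Γ ⟨dirac lam Γ ⟨R ψ, h₁⟩, h₂⟩ a)
      (((mu ^ 2 : ℝ) : ℂ) • R ψ a)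
    filter_upwards [hsum, Lp.coeFn_smul ((mu ^ 2 : ℝ) : ℂ) (R ψ a), hall, hD,
      dirac_ae_eq ⟨dirac lam Γ ⟨R ψ, h₁⟩, h₂⟩ a] with p e1 e2 e3 e4 e5
    refine e1.trans ?_
    rw [Pi.add_apply, e2, Pi.smul_apply, e5]
    have e6 : (fun j => dirac lam Γ ⟨R ψ, h₁⟩ j p) =
        (diracMat lam Γ p).mulVec (fun j => R ψ j p) := funext e4
    have e7 := congrFun (hsq p fun j => R ψ j p) a
    simp only [Pi.add_apply, Pi.smul_apply] at e7
    simp only [e6]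
    rw [e7, e3, smul_eq_mul, ← mul_assoc, mul_comm ((symb lam mu p : ℝ) : ℂ), hinv, one_mul]
  · intro φ h
    ext1 a
    ext1
    have hD : ∀ᵐ p ∂(momMeasure d lam), ∀ a, dirac lam Γ φ a p =
        (diracMat lam Γ p).mulVec (fun j => (φ : HSpin d lam) j p) a :=
      ae_all_iff.2 fun a => dirac_ae_eq φ a
    have hsum := Lp.coeFn_add (dirac lam Γ ⟨dirac lam Γ φ, h⟩ a)
      (((mu ^ 2 : ℝ) : ℂ) • (φ : HSpin d lam) a)
    filter_upwards [hsum, Lp.coeFn_smul ((mu ^ 2 : ℝ) : ℂ) ((φ : HSpin d lam) a), hD,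
      dirac_ae_eq ⟨dirac lam Γ φ, h⟩ a, spinRep_ae_eq (symbInv d lam hmu)
        (dirac lam Γ ⟨dirac lam Γ φ, h⟩ + ((mu ^ 2 : ℝ) : ℂ) • (φ : HSpin d lam)) a]
      with p e1 e2 e4 e5 e8
    refine e8.trans ?_
    have e1' : (dirac lam Γ ⟨dirac lam Γ φ, h⟩ + ((mu ^ 2 : ℝ) : ℂ) • (φ : HSpin d lam)) a p = _ :=
      e1
    rw [e1', Pi.add_apply, e2, Pi.smul_apply, e5]
    have e6 : (fun j => dirac lam Γ φ j p) =
        (diracMat lam Γ p).mulVec (fun j => (φ : HSpin d lam) j p) := funext e4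
    have e7 := congrFun (hsq p fun j => (φ : HSpin d lam) j p) a
    simp only [Pi.add_apply, Pi.smul_apply] at e7
    simp only [e6]
    rw [e7, smul_eq_mul, ← mul_assoc, hinv, one_mul]

theorem IsSqAddInv.unique {E : Type*} [NormedAddCommGroup E] [InnerProductSpace ℂ E]
    {D : E →ₗ.[ℂ] E} {mu : ℝ} {R S : E →L[ℂ] E} (hR : IsSqAddInv D mu R)
    (hS : IsSqAddInv D mu S) : R = S := by
  ext ψ
  obtain ⟨h₁, h₂, h⟩ := hS.1 ψ
  have := hR.2 ⟨S ψ, h₁⟩ h₂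
  rwa [h] at this

theorem sqAddInv_dirac {Γ : Fin (d + 1) → Matrix (Fin (spinDim d)) (Fin (spinDim d)) ℂ}
    (hΓ : IsClifford Γ) (hmu : mu ≠ 0) :
    sqAddInv (dirac lam Γ) mu = spinRep d lam (symbInv d lam hmu) := by
  have h : ∃ R, IsSqAddInv (dirac lam Γ) mu R := ⟨_, isSqAddInv_dirac hΓ hmu⟩
  rw [sqAddInv, dif_pos h]
  exact h.choose_spec.unique (isSqAddInv_dirac hΓ hmu)

theorem continuousOn_cpow_spectrum_symbInv (hmu : mu ≠ 0) {w : ℂ} (hw : 0 < w.re) :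
    ContinuousOn (fun x : ℂ => x ^ w) (spectrum ℂ (symbInv d lam hmu)) := by
  have hsub : spectrum ℂ (symbInv d lam hmu) ⊆ {x : ℂ | 0 ≤ x.re ∧ x.im = 0} := by
    intro x hx
    by_contra hx'
    have hcl : IsClosed {x : ℂ | 0 ≤ x.re ∧ x.im = 0} :=
      (isClosed_le continuous_const Complex.continuous_re).inter
        (isClosed_eq Complex.continuous_im continuous_const)
    obtain ⟨δ, hδ, hball⟩ := Metric.isOpen_iff.1 hcl.isOpen_compl x hx'
    have hdist : ∀ p : Pt d, δ ≤ ‖x - symbInv d lam hmu p‖ := by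
      intro p
      by_contra! h
      rw [← dist_eq_norm, dist_comm] at h
      refine hball h ⟨?_, ?_⟩
      · rw [symbInv_apply, Complex.ofReal_re]
        exact inv_nonneg.2 (symb_pos lam hmu p).le
      · rw [symbInv_apply, Complex.ofReal_im]
    have hne : ∀ p : Pt d, x - symbInv d lam hmu p ≠ 0 := fun p =>
      norm_pos_iff.1 (hδ.trans_le (hdist p))
    let b : Pt d →ᵇ ℂ := BoundedContinuousFunction.ofNormedAddCommGroup
      (fun p => (x - symbInv d lam hmu p)⁻¹)
      ((continuous_const.sub (symbInv d lam hmu).continuous).inv₀ hne) δ⁻¹ (fun p => by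
        rw [norm_inv]
        exact inv_anti₀ hδ (hdist p))
    refine hx (IsUnit.of_mul_eq_one b ?_)
    ext p
    change (algebraMap ℂ (Pt d →ᵇ ℂ) x p - symbInv d lam hmu p) * (x - symbInv d lam hmu p)⁻¹ = 1
    exact mul_inv_cancel₀ (hne p)
  intro x hx
  obtain ⟨h1, -⟩ := hsub hx
  exact (Complex.continuousAt_cpow_const_of_re_pos (Or.inl h1) hw).continuousWithinAt

theorem sqAddPow_dirac_ae_eq {Γ : Fin (d + 1) → Matrix (Fin (spinDim d)) (Fin (spinDim d)) ℂ}
    (hΓ : IsClifford Γ) (hmu : mu ≠ 0) {z : ℂ} (hz : 0 < z.re) (ψ : HSpin d lam)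
    (j : Fin (spinDim d)) :
    (sqAddPow (dirac lam Γ) mu z ψ) j =ᵐ[momMeasure d lam]
      fun p => ((symb lam mu p : ℝ) : ℂ) ^ (-(z / 2)) * ψ j p := by
  have hcont := continuousOn_cpow_spectrum_symbInv (d := d) (lam := lam) hmu (w := z / 2)
    (by simpa using hz)
  have hrep : Continuous (spinRep d lam) :=
    AddMonoidHomClass.continuous_of_bound _ 1 fun g => by
      rw [one_mul]
      exact NonUnitalStarAlgHom.norm_apply_le (spinRep d lam) g
  have h := StarAlgHom.map_cfc (spinRep d lam) (fun x : ℂ => x ^ (z / 2)) (symbInv d lam hmu)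
    hcont hrep (by cfc_tac) (by
      rw [isStarNormal_iff, ← map_star, Commute, SemiconjBy, ← map_mul, ← map_mul, mul_comm])
  rw [sqAddPow, sqAddInv_dirac hΓ hmu, ← h]
  filter_upwards [spinRep_ae_eq (lam := lam) (cfc (fun x : ℂ => x ^ (z / 2)) (symbInv d lam hmu)) ψ j]
    with p hp
  rw [hp, cfc_bcf_apply _ _ hcont, symbInv_apply, Complex.ofReal_inv,
    Complex.inv_cpow _ _ (by
      rw [Complex.arg_ofReal_of_nonneg (symb_pos lam hmu p).le]; exact Real.pi_pos.ne),
    Complex.cpow_neg]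

end Dirac

section LeftMul

variable {d : ℕ} {lam : ℝ}

/-- The group element `a b⁻¹`. -/
def quot (lam : ℝ) (a b : Pt d) : Pt d :=
  (a.1 - b.1, a.2 - Real.exp (-(lam * (a.1 - b.1))) • b.2)

@[fun_prop]
theorem measurable_quot {α : Type*} [MeasurableSpace α] {f g : α → Pt d} (hf : Measurable f)
    (hg : Measurable g) : Measurable fun x => quot lam (f x) (g x) := by
  unfold quot
  fun_prop

theorem quot_self (a : Pt d) : quot lam a a = 0 := by
  simp [quot]

theorem lintegral_comp_quot_left (b : Pt d) {F : Pt d → ℝ≥0∞} (hF : Measurable F) :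
    ∫⁻ a, F (quot lam a b) = ∫⁻ g, F g :=
  (measurePreserving_translate lam b).lintegral_comp hF

theorem map_quot_right (a : Pt d) :
    Measure.map (fun b => quot lam a b) volume =
      (volume : Measure (Pt d)).withDensity fun g => ENNReal.ofReal (Real.exp (lam * d * g.1)) := by
  have hm : Measurable fun b : Pt d => quot lam a b := by fun_prop
  refine Measure.ext_of_lintegral _ fun F hF => ?_
  rw [lintegral_map hF hm, lintegral_withDensity_eq_lintegral_mul _ (by fun_prop) hF]
  simp only [Pi.mul_apply]
  have h1 : ∀ t : ℝ, ∫⁻ y : EuclideanSpace ℝ (Fin d), F (t, a.2 - Real.exp (-(lam * t)) • y) =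
      ENNReal.ofReal (Real.exp (lam * d * t)) * ∫⁻ y, F (t, y) := by
    intro t
    have hmap := Measure.map_addHaar_smul (volume : Measure (EuclideanSpace ℝ (Fin d)))
      (Real.exp_pos (-(lam * t))).ne'
    have h2 := lintegral_map (μ := (volume : Measure (EuclideanSpace ℝ (Fin d))))
      (f := fun y => F (t, a.2 - y)) (by fun_prop)
      (measurable_const_smul (Real.exp (-(lam * t))))
    rw [hmap, lintegral_smul_measure, lintegral_sub_left_eq_self (fun y => F (t, y))] at h2
    rw [← h2, finrank_euclideanSpace_fin, abs_of_pos (inv_pos.2 (pow_pos (Real.exp_pos _) _)),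
      ← Real.exp_nat_mul, ← Real.exp_neg, smul_eq_mul]
    ring_nf
  calc ∫⁻ b, F (quot lam a b)
      = ∫⁻ t : ℝ, ∫⁻ y, F (quot lam a (t, y)) := lintegral_prod _ (hF.comp hm).aemeasurable
    _ = ∫⁻ t : ℝ, (fun s => ∫⁻ y : EuclideanSpace ℝ (Fin d),
          F (s, a.2 - Real.exp (-(lam * s)) • y)) (a.1 - t) := rfl
    _ = ∫⁻ t : ℝ, ∫⁻ y : EuclideanSpace ℝ (Fin d), F (t, a.2 - Real.exp (-(lam * t)) • y) :=
        lintegral_sub_left_eq_self (fun s => ∫⁻ y : EuclideanSpace ℝ (Fin d),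
          F (s, a.2 - Real.exp (-(lam * s)) • y)) a.1
    _ = ∫⁻ t : ℝ, ∫⁻ y, ENNReal.ofReal (Real.exp (lam * d * t)) * F (t, y) := by
        refine lintegral_congr fun t => ?_
        rw [h1, lintegral_const_mul _ (by fun_prop)]
    _ = _ := (lintegral_prod (fun g : Pt d => ENNReal.ofReal (Real.exp (lam * d * g.1)) * F g)
        (by fun_prop)).symm

theorem lintegral_comp_quot_right (a : Pt d) {F : Pt d → ℝ≥0∞} (hF : Measurable F) :
    ∫⁻ b, F (quot lam a b) = ∫⁻ g : Pt d, ENNReal.ofReal (Real.exp (lam * d * g.1)) * F g := by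
  have hm : Measurable fun b : Pt d => quot lam a b := by fun_prop
  rw [← lintegral_map hF hm, map_quot_right,
    lintegral_withDensity_eq_lintegral_mul _ (by fun_prop) hF]
  rfl

theorem integral_comp_quot_right (a : Pt d) {F : Pt d → ℂ} (hF : Continuous F) :
    ∫ b, F (quot lam a b) = ∫ g : Pt d, (Real.exp (lam * d * g.1) : ℂ) * F g := by
  have hm : Measurable fun b : Pt d => quot lam a b := by fun_prop
  rw [← integral_map hm.aemeasurable hF.aestronglyMeasurable, map_quot_right,
    integral_withDensity_eq_integral_toReal_smul (by fun_prop)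
    (.of_forall fun _ => ENNReal.ofReal_lt_top)]
  congr 1
  ext g
  rw [ENNReal.toReal_ofReal (Real.exp_pos _).le, Complex.real_smul]

theorem lintegral_momMeasure {F : Pt d → ℝ≥0∞} (hF : Measurable F) :
    ∫⁻ p, F p ∂(momMeasure d lam) =
      ∫⁻ p : Pt d, ENNReal.ofReal (twoPiInv d * Real.exp (-(lam * d * p.1))) * F p := by
  rw [momMeasure, lintegral_withDensity_eq_lintegral_mul _ (by fun_prop) hF]
  rfl

theorem integral_momMeasure (F : Pt d → ℂ) :
    ∫ p, F p ∂(momMeasure d lam) =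
      ∫ p : Pt d, ((twoPiInv d * Real.exp (-(lam * d * p.1)) : ℝ) : ℂ) * F p := by
  rw [momMeasure, integral_withDensity_eq_integral_toReal_smul (by fun_prop)
    (.of_forall fun _ => ENNReal.ofReal_lt_top)]
  congr 1
  ext p
  rw [ENNReal.toReal_ofReal (mul_nonneg (twoPiInv_pos d).le (Real.exp_pos _).le),
    Complex.real_smul]

instance instSFiniteMomMeasure : SFinite (momMeasure d lam) := by
  unfold momMeasure
  infer_instance

theorem conv_eq_integral_momMeasure (k ψ : Pt d → ℂ) (a : Pt d) :
    conv lam k ψ a =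
      ∫ b, (k (quot lam a b) * (Real.exp (lam * d * b.1) : ℂ)) * ψ b ∂(momMeasure d lam) := by
  rw [integral_momMeasure, conv, ← integral_const_mul]
  congr 1
  ext b
  have h : ((twoPiInv d * Real.exp (-(lam * d * b.1)) : ℝ) : ℂ) * (Real.exp (lam * d * b.1) : ℂ) =
      (twoPiInv d : ℂ) := by
    rw [← Complex.ofReal_mul, mul_assoc, ← Real.exp_add]
    simp
  calc _ = (((twoPiInv d * Real.exp (-(lam * d * b.1)) : ℝ) : ℂ) *
        (Real.exp (lam * d * b.1) : ℂ)) * (k (quot lam a b) * ψ b) := by rw [h]; rfl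
    _ = _ := by ring

theorem exists_isLeftMul (lam : ℝ) {f : 𝓢(Pt d, ℂ)} (hf : f ∈ algA d) :
    ∃ T, IsLeftMul lam f T := by
  set k := fourierS f with hk
  have hkSc : IsSc k := isSc_fourierS hf
  have hkm : Measurable k := k.continuous.measurable
  let K : Pt d × Pt d → ℂ := fun p => k (quot lam p.1 p.2) * (Real.exp (lam * d * p.2.1) : ℂ)
  have hK : Measurable K := by
    simp only [K]
    fun_prop
  have hc := twoPiInv_pos d
  have hn : ∀ (s : ℝ) (w : ℂ), ENNReal.ofReal (Real.exp s) * ‖w‖ₑ = ‖(Real.exp s : ℂ) * w‖ₑ := by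
    intro s w
    rw [enorm_mul, ← ofReal_norm (Real.exp s : ℂ), Complex.norm_real,
      Real.norm_of_nonneg (Real.exp_pos s).le]
  have h₁ : ∀ a, ∫⁻ b, ‖K (a, b)‖ₑ ∂(momMeasure d lam) ≤
      ENNReal.ofReal (twoPiInv d) * ∫⁻ g : Pt d, ‖(Real.exp (lam * d * g.1) : ℂ) * k g‖ₑ := by
    intro a
    rw [lintegral_momMeasure (by fun_prop)]
    simp only [← hn]
    rw [← lintegral_comp_quot_right (lam := lam) a hkm.enorm,
      ← lintegral_const_mul' _ _ ENNReal.ofReal_ne_top]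
    refine (lintegral_congr fun b => ?_).le
    simp only [K]
    rw [mul_comm (k _), ← hn, ← mul_assoc, ← ENNReal.ofReal_mul (by positivity), mul_assoc,
      ← Real.exp_add]
    simp
  have h₂ : ∀ b, ∫⁻ a, ‖K (a, b)‖ₑ ∂(momMeasure d lam) ≤
      ENNReal.ofReal (twoPiInv d) * ∫⁻ g : Pt d, ‖(Real.exp (-(lam * d) * g.1) : ℂ) * k g‖ₑ := by
    intro b
    rw [lintegral_momMeasure (by fun_prop)]
    simp only [← hn]
    rw [← lintegral_comp_quot_left (lam := lam) b (F := fun g : Pt d =>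
        ENNReal.ofReal (Real.exp (-(lam * d) * g.1)) * ‖k g‖ₑ) (by fun_prop),
      ← lintegral_const_mul' _ _ ENNReal.ofReal_ne_top]
    refine (lintegral_congr fun a => ?_).le
    simp only [K]
    rw [mul_comm (k _), ← hn, ← mul_assoc, ← mul_assoc, ← ENNReal.ofReal_mul (by positivity),
      ← ENNReal.ofReal_mul (by positivity), mul_assoc, ← Real.exp_add]
    congr 4
    simp only [quot]
    ring
  have hfin : ∀ c : ℝ, ENNReal.ofReal (twoPiInv d) *
      ∫⁻ g : Pt d, ‖(Real.exp (c * g.1) : ℂ) * k g‖ₑ ≠ ∞ := fun c =>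
    ENNReal.mul_ne_top ENNReal.ofReal_ne_top (integrable_weight c hkSc).2.ne
  obtain ⟨T, hT⟩ := exists_kernelOp (μ := momMeasure d lam) (ν := momMeasure d lam) hK
    (ENNReal.mul_ne_top (hfin (lam * d)) (hfin (-(lam * d)))) (schur_bound hK h₁ h₂)
  refine ⟨T, fun ψ => (hT ψ).trans (.of_forall fun a => ?_)⟩
  rw [conv_eq_integral_momMeasure, ← coe_fourierS]

theorem leftMul_ae_eq (lam : ℝ) {f : 𝓢(Pt d, ℂ)} (hf : f ∈ algA d) (ψ : Hr d lam) :
    leftMul lam f ψ =ᵐ[momMeasure d lam] conv lam (fourierS f) ψ := by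
  have h := exists_isLeftMul lam hf
  rw [leftMul, dif_pos h, coe_fourierS]
  exact h.choose_spec ψ

end LeftMul

section SchwartzTensor

variable {E F : Type*} [NormedAddCommGroup E] [NormedSpace ℝ E] [NormedAddCommGroup F]
  [NormedSpace ℝ F]

theorem norm_iteratedFDeriv_comp_fst_le (f : 𝓢(E, ℂ)) (n : ℕ) (p : E × F) :
    ‖iteratedFDeriv ℝ n (fun q : E × F => f q.1) p‖ ≤ ‖iteratedFDeriv ℝ n f p.1‖ := by
  have h := (ContinuousLinearMap.fst ℝ E F).iteratedFDeriv_comp_right (f.smooth ⊤) p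
    (i := n) (by exact_mod_cast le_top)
  change iteratedFDeriv ℝ n (fun q : E × F => f q.1) p = _ at h
  rw [h]
  refine (ContinuousMultilinearMap.norm_compContinuousLinearMap_le _ _).trans ?_
  refine mul_le_of_le_one_right (norm_nonneg _) ?_
  exact Finset.prod_le_one (fun _ _ => norm_nonneg _)
    fun _ _ => ContinuousLinearMap.norm_fst_le ℝ E F

theorem norm_iteratedFDeriv_comp_snd_le (g : 𝓢(F, ℂ)) (n : ℕ) (p : E × F) :
    ‖iteratedFDeriv ℝ n (fun q : E × F => g q.2) p‖ ≤ ‖iteratedFDeriv ℝ n g p.2‖ := by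
  have h := (ContinuousLinearMap.snd ℝ E F).iteratedFDeriv_comp_right (g.smooth ⊤) p
    (i := n) (by exact_mod_cast le_top)
  change iteratedFDeriv ℝ n (fun q : E × F => g q.2) p = _ at h
  rw [h]
  refine (ContinuousMultilinearMap.norm_compContinuousLinearMap_le _ _).trans ?_
  refine mul_le_of_le_one_right (norm_nonneg _) ?_
  exact Finset.prod_le_one (fun _ _ => norm_nonneg _)
    fun _ _ => ContinuousLinearMap.norm_snd_le ℝ E F

/-- The tensor product of two Schwartz functions. -/
theorem exists_schwartz_tensor (f : 𝓢(E, ℂ)) (g : 𝓢(F, ℂ)) :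
    ∃ h : 𝓢(E × F, ℂ), ∀ p, h p = f p.1 * g p.2 := by
  have hf : ContDiff ℝ (⊤ : ℕ∞) fun p : E × F => f p.1 := (f.smooth ⊤).comp contDiff_fst
  have hg : ContDiff ℝ (⊤ : ℕ∞) fun p : E × F => g p.2 := (g.smooth ⊤).comp contDiff_snd
  refine ⟨⟨fun p => f p.1 * g p.2, hf.mul hg, fun k n => ?_⟩, fun p => rfl⟩
  choose A hA0 hA using fun k i => f.decay k i
  choose B hB0 hB using fun k i => g.decay k i
  refine ⟨∑ i ∈ Finset.range (n + 1), (n.choose i : ℝ) *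
    (A k i * B 0 (n - i) + A 0 i * B k (n - i)), fun p => ?_⟩
  have h1 := norm_iteratedFDeriv_mul_le hf hg p (n := n) (by exact_mod_cast le_top)
  have h2 : ‖p‖ ^ k ≤ ‖p.1‖ ^ k + ‖p.2‖ ^ k := by
    rw [Prod.norm_def]
    rcases max_choice ‖p.1‖ ‖p.2‖ with h | h <;> rw [h]
    · exact le_add_of_nonneg_right (by positivity)
    · exact le_add_of_nonneg_left (by positivity)
  refine (mul_le_mul_of_nonneg_left h1 (by positivity)).trans ?_
  rw [Finset.mul_sum]
  refine Finset.sum_le_sum fun i _ => ?_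
  have hfi := norm_iteratedFDeriv_comp_fst_le (F := F) f i p
  have hgi := norm_iteratedFDeriv_comp_snd_le (E := E) g (n - i) p
  have a0 := hA 0 i p.1
  have ak := hA k i p.1
  have b0 := hB 0 (n - i) p.2
  have bk := hB k (n - i) p.2
  rw [pow_zero, one_mul] at a0 b0
  calc ‖p‖ ^ k * ((n.choose i : ℝ) * ‖iteratedFDeriv ℝ i (fun q : E × F => f q.1) p‖ *
        ‖iteratedFDeriv ℝ (n - i) (fun q : E × F => g q.2) p‖)
      ≤ (‖p.1‖ ^ k + ‖p.2‖ ^ k) * ((n.choose i : ℝ) * ‖iteratedFDeriv ℝ i f p.1‖ *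
        ‖iteratedFDeriv ℝ (n - i) g p.2‖) := by gcongr
    _ = (n.choose i : ℝ) * ((‖p.1‖ ^ k * ‖iteratedFDeriv ℝ i f p.1‖) *
          ‖iteratedFDeriv ℝ (n - i) g p.2‖ + ‖iteratedFDeriv ℝ i f p.1‖ *
          (‖p.2‖ ^ k * ‖iteratedFDeriv ℝ (n - i) g p.2‖)) := by ring
    _ ≤ _ := by
      have := (hA0 k i).le
      have := (hA0 0 i).le
      gcongr

end SchwartzTensor

section KernelExpansion

variable {d : ℕ}

theorem exists_cutoff_exp (lam R : ℝ) :
    ∃ e : ℝ → ℝ, e.HasTemperateGrowth ∧ (∃ C, ∀ t, |e t| ≤ C) ∧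
      ∀ t, |t| ≤ R → e t = Real.exp (-(lam * t)) := by
  let χ : ContDiffBump (0 : ℝ) := ⟨|R| + 1, |R| + 2, by positivity, by linarith⟩
  have hs : HasCompactSupport fun t => χ t * Real.exp (-(lam * t)) := χ.hasCompactSupport.mul_right
  have hc : ContDiff ℝ (⊤ : ℕ∞) fun t => χ t * Real.exp (-(lam * t)) := by
    have := χ.contDiff (n := ⊤)
    fun_prop
  refine ⟨_, hs.hasTemperateGrowth hc, ?_, fun t ht => ?_⟩
  · obtain ⟨C, hC⟩ := hc.continuous.bounded_above_of_compact_support hs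
    exact ⟨C, hC⟩
  · rw [χ.one_of_mem_closedBall, one_mul]
    simp only [Metric.mem_closedBall, dist_zero_right, Real.norm_eq_abs]
    change |t| ≤ |R| + 1
    linarith [le_abs_self R]

/-- The function `(1 + |a⃗|²)^M k(a b⁻¹) φ(b)` is a Schwartz function of `(a, b)`. -/
theorem exists_schwartz_kernel (lam : ℝ) (M : ℕ) {k : 𝓢(Pt d, ℂ)} (hk : IsSc k)
    (φ : 𝓢(Pt d, ℂ)) :
    ∃ S : 𝓢(Pt d × Pt d, ℂ), ∀ a b : Pt d,
      S (a, b) = (((1 + ‖a.2‖ ^ 2) ^ M : ℝ) : ℂ) * (k (quot lam a b) * φ b) := by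
  obtain ⟨K, hK, hk⟩ := hk
  obtain ⟨R, hR⟩ := hK.isBounded.exists_norm_le
  have hk0 : ∀ a : Pt d, R < |a.1| → k a = 0 := by
    intro a ha
    by_contra h
    exact absurd (hR _ (hk h).1) (not_le.2 ha)
  obtain ⟨e, he, ⟨C, hC⟩, heR⟩ := exists_cutoff_exp lam R
  obtain ⟨h, hh⟩ := exists_schwartz_tensor k φ
  let E := EuclideanSpace ℝ (Fin d)
  let Θ : Pt d × Pt d → Pt d × Pt d := fun p =>
    ((p.1.1 - p.2.1, p.1.2 - e (p.1.1 - p.2.1) • p.2.2), p.2)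
  let L11 : Pt d × Pt d →L[ℝ] ℝ := .fst ℝ ℝ E ∘L .fst ℝ (Pt d) (Pt d)
  let L12 : Pt d × Pt d →L[ℝ] E := .snd ℝ ℝ E ∘L .fst ℝ (Pt d) (Pt d)
  let L21 : Pt d × Pt d →L[ℝ] ℝ := .fst ℝ ℝ E ∘L .snd ℝ (Pt d) (Pt d)
  let L22 : Pt d × Pt d →L[ℝ] E := .snd ℝ ℝ E ∘L .snd ℝ (Pt d) (Pt d)
  let J : E →L[ℝ] Pt d × Pt d := .inl ℝ (Pt d) (Pt d) ∘L .inr ℝ ℝ E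
  let A : Pt d × Pt d →L[ℝ] Pt d × Pt d :=
    ((L11 - L21).prod L12).prod (.snd ℝ (Pt d) (Pt d))
  have hΘe : Θ = fun p => A p - J (e ((L11 - L21) p) • L22 p) := by
    refine funext fun p => Prod.ext (Prod.ext ?_ ?_) ?_ <;> simp [Θ, A, J, L11, L12, L21, L22]
  have hΘ : Θ.HasTemperateGrowth := by
    rw [hΘe]
    exact A.hasTemperateGrowth.sub (J.hasTemperateGrowth.comp
      ((he.comp (L11 - L21).hasTemperateGrowth).smul L22.hasTemperateGrowth))
  have hC0 : 0 ≤ C := (abs_nonneg _).trans (hC 0)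
  have hΘup : ∃ (m : ℕ) (C : ℝ), ∀ x, ‖x‖ ≤ C * (1 + ‖Θ x‖) ^ m := by
    refine ⟨1, 2 + C, fun p => ?_⟩
    have h0 := norm_nonneg (Θ p)
    have h1 : ‖p.2‖ ≤ ‖Θ p‖ := norm_snd_le (Θ p)
    have h3 : ‖p.1.1 - p.2.1‖ ≤ ‖Θ p‖ := (norm_fst_le (Θ p).1).trans (norm_fst_le (Θ p))
    have h4 : ‖p.1.2 - e (p.1.1 - p.2.1) • p.2.2‖ ≤ ‖Θ p‖ :=
      (norm_snd_le (Θ p).1).trans (norm_fst_le (Θ p))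
    have h5 : ‖p.1.1‖ ≤ ‖Θ p‖ + ‖Θ p‖ := by
      calc ‖p.1.1‖ = ‖(p.1.1 - p.2.1) + p.2.1‖ := by simp
        _ ≤ ‖p.1.1 - p.2.1‖ + ‖p.2.1‖ := norm_add_le _ _
        _ ≤ _ := add_le_add h3 ((norm_fst_le p.2).trans h1)
    have h6 : ‖p.1.2‖ ≤ ‖Θ p‖ + C * ‖Θ p‖ := by
      calc ‖p.1.2‖ = ‖(p.1.2 - e (p.1.1 - p.2.1) • p.2.2) + e (p.1.1 - p.2.1) • p.2.2‖ := by
            simp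
        _ ≤ ‖p.1.2 - e (p.1.1 - p.2.1) • p.2.2‖ + ‖e (p.1.1 - p.2.1) • p.2.2‖ := norm_add_le _ _
        _ ≤ _ := by
            refine add_le_add h4 ?_
            rw [norm_smul]
            exact mul_le_mul (hC _) ((norm_snd_le p.2).trans h1) (norm_nonneg _) hC0
    have h7 : 0 ≤ C * ‖Θ p‖ := by positivity
    rw [pow_one, Prod.norm_def, Prod.norm_def]
    refine max_le (max_le ?_ ?_) ?_ <;> nlinarith
  have hθ : Function.HasTemperateGrowth fun p : Pt d × Pt d => (1 + ‖p.1.2‖ ^ 2) ^ M := by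
    have h1 : Function.HasTemperateGrowth fun x : E => ‖x‖ ^ 2 :=
      Function.hasTemperateGrowth_norm_sq E
    exact ((Function.HasTemperateGrowth.const 1).add (h1.comp L12.hasTemperateGrowth)).pow M
  refine ⟨SchwartzMap.smulLeftCLM ℂ (fun p : Pt d × Pt d => (1 + ‖p.1.2‖ ^ 2) ^ M)
    (SchwartzMap.compCLM ℝ hΘ hΘup h), fun a b => ?_⟩
  rw [SchwartzMap.smulLeftCLM_apply_apply hθ, SchwartzMap.compCLM_apply, Complex.real_smul,
    Function.comp_apply, hh]
  congr 2
  by_cases hab : |a.1 - b.1| ≤ R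
  · simp only [Θ, heR _ hab, quot]
  · rw [hk0 _ (by simpa [Θ] using hab), hk0 _ (by simpa [quot] using hab)]

/-- Fourier inversion on a product: a Schwartz function of two variables is an integral of
products of unimodular functions. -/
theorem exists_schwartz_expansion {E F : Type*} [NormedAddCommGroup E] [NormedSpace ℝ E]
    [FiniteDimensional ℝ E] [NormedAddCommGroup F] [NormedSpace ℝ F] [FiniteDimensional ℝ F]
    (S : 𝓢(E × F, ℂ)) :
    ∃ (N : ℕ) (w : 𝓢(EuclideanSpace ℝ (Fin N), ℂ))
      (α : EuclideanSpace ℝ (Fin N) × E → ℂ) (β : EuclideanSpace ℝ (Fin N) × F → ℂ),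
      Continuous α ∧ Continuous β ∧ (∀ p, ‖α p‖ = 1) ∧ (∀ p, ‖β p‖ = 1) ∧
      ∀ a b, S (a, b) = ∫ y, w y * (α (y, a) * β (y, b)) := by
  let N := Module.finrank ℝ (E × F)
  let V := EuclideanSpace ℝ (Fin N)
  let e : (E × F) ≃L[ℝ] V := ContinuousLinearEquiv.ofFinrankEq (by simp [V, N])
  let S' : 𝓢(V, ℂ) := SchwartzMap.compCLMOfContinuousLinearEquiv ℂ e.symm S
  let ch : V × (E × F) → ℂ := fun p =>
    Complex.exp ((2 * Real.pi * inner ℝ p.1 (e p.2) : ℝ) * Complex.I)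
  have hch : Continuous ch := by
    have := e.continuous
    simp only [ch]
    fun_prop
  refine ⟨N, FourierTransform.fourier S', fun p => ch (p.1, (p.2, 0)), fun p => ch (p.1, (0, p.2)),
    by fun_prop, by fun_prop, fun p => Complex.norm_exp_ofReal_mul_I _,
    fun p => Complex.norm_exp_ofReal_mul_I _, fun a b => ?_⟩
  have h1 : S (a, b) = FourierTransformInv.fourierInv (FourierTransform.fourier S') (e (a, b)) := by
    rw [FourierTransform.fourierInv_fourier_eq]
    simp [S']
  rw [h1, SchwartzMap.fourierInv_coe, Real.fourierInv_eq']
  refine integral_congr_ae (.of_forall fun y => ?_)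
  simp only [smul_eq_mul, ch]
  rw [mul_comm, ← Complex.exp_add, ← add_mul, ← Complex.ofReal_add, ← mul_add, ← inner_add_right,
    ← map_add]
  simp

end KernelExpansion

section KernelFactors

variable {d : ℕ} {lam mu : ℝ}

theorem quot_quot_quot (a b γ : Pt d) :
    quot lam (quot lam a γ) (quot lam b γ) = quot lam a b := by
  refine Prod.ext ?_ ?_
  · simp [quot]
  · have h : Real.exp (-(lam * (a.1 - b.1))) * Real.exp (-(lam * (b.1 - γ.1))) =
        Real.exp (-(lam * (a.1 - γ.1))) := by
      rw [← Real.exp_add]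
      ring_nf
    simp only [quot, sub_sub_sub_cancel_right, smul_sub, smul_smul, h]

/-- A right translation by an element of a bounded set changes the symbol of `D² + μ²` by a
bounded factor. -/
theorem exists_symb_le (hlam : 0 < lam) (hmu : mu ≠ 0) (ρ : ℝ) :
    ∃ C, 0 < C ∧ ∀ b γ : Pt d, ‖quot lam b γ‖ ≤ ρ → symb lam mu γ ≤ C * symb lam mu b := by
  set e := Real.exp (lam * ρ) with he
  have he0 : 0 < e := Real.exp_pos _
  have hmu2 : 0 < mu ^ 2 := by positivity
  refine ⟨1 + 2 * e ^ 2 + (2 * (lam⁻¹ * (1 + e)) ^ 2 + 2 * e ^ 2 * ρ ^ 2) / mu ^ 2, by positivity,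
    fun b γ hq => ?_⟩
  obtain ⟨hq0, hq1⟩ := norm_prod_le_iff.1 hq
  set s := Real.exp (lam * (b.1 - γ.1)) with hs
  have hs0 : 0 < s := Real.exp_pos _
  have hse : s ≤ e := Real.exp_le_exp.2 (mul_le_mul_of_nonneg_left ((le_abs_self _).trans hq0)
    hlam.le)
  have h1 : dZero lam γ.1 = lam⁻¹ * (1 - s) + s * dZero lam b.1 := by
    have : Real.exp (-(lam * γ.1)) = s * Real.exp (-(lam * b.1)) := by
      rw [hs, ← Real.exp_add]
      ring_nf
    rw [dZero, dZero, this]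
    ring
  have h2 : γ.2 = s • (b.2 - (quot lam b γ).2) := by
    simp [quot, smul_smul, hs, ← Real.exp_add]
  have hA : (lam⁻¹ * (1 - s)) ^ 2 ≤ (lam⁻¹ * (1 + e)) ^ 2 := by
    refine sq_le_sq' ?_ ?_
    · rw [← mul_neg]
      exact mul_le_mul_of_nonneg_left (by linarith) (by positivity)
    · exact mul_le_mul_of_nonneg_left (by linarith) (by positivity)
  have hs2 : s ^ 2 ≤ e ^ 2 := pow_le_pow_left₀ hs0.le hse 2
  have h3 : dZero lam γ.1 ^ 2 ≤ 2 * (lam⁻¹ * (1 + e)) ^ 2 + 2 * e ^ 2 * dZero lam b.1 ^ 2 := by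
    have h4 : s ^ 2 * dZero lam b.1 ^ 2 ≤ e ^ 2 * dZero lam b.1 ^ 2 := by gcongr
    rw [h1]
    nlinarith [sq_nonneg (lam⁻¹ * (1 - s) - s * dZero lam b.1)]
  have h5 : ‖γ.2‖ ^ 2 ≤ 2 * e ^ 2 * ‖b.2‖ ^ 2 + 2 * e ^ 2 * ρ ^ 2 := by
    have hn : ‖b.2 - (quot lam b γ).2‖ ≤ ‖b.2‖ + ρ := (norm_sub_le _ _).trans (by gcongr)
    calc ‖γ.2‖ ^ 2 = s ^ 2 * ‖b.2 - (quot lam b γ).2‖ ^ 2 := by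
          conv_lhs => rw [h2, norm_smul, Real.norm_of_nonneg hs0.le, mul_pow]
      _ ≤ e ^ 2 * (‖b.2‖ + ρ) ^ 2 := by gcongr
      _ ≤ _ := by nlinarith [mul_nonneg (sq_nonneg e) (sq_nonneg (‖b.2‖ - ρ))]
  have hsb : dZero lam b.1 ^ 2 + ‖b.2‖ ^ 2 + mu ^ 2 = symb lam mu b := rfl
  have h6 : (2 * (lam⁻¹ * (1 + e)) ^ 2 + 2 * e ^ 2 * ρ ^ 2) ≤
      (2 * (lam⁻¹ * (1 + e)) ^ 2 + 2 * e ^ 2 * ρ ^ 2) / mu ^ 2 * symb lam mu b := by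
    calc _ = (2 * (lam⁻¹ * (1 + e)) ^ 2 + 2 * e ^ 2 * ρ ^ 2) / mu ^ 2 * mu ^ 2 := by field_simp
      _ ≤ _ := by
        gcongr
        exact sq_le_symb _ _ _
  have h7 : symb lam mu γ = dZero lam γ.1 ^ 2 + ‖γ.2‖ ^ 2 + mu ^ 2 := rfl
  rw [h7, add_mul, add_mul, one_mul]
  nlinarith [sq_nonneg (dZero lam b.1), sq_nonneg ‖b.2‖, mul_nonneg (sq_nonneg e) hmu2.le]

theorem measurable_symb : Measurable (symb lam mu : Pt d → ℝ) :=
  (continuous_symb lam mu).measurable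

theorem lintegral_exp_mul_symb_rpow_lt_top (hlam : 0 < lam) (hmu : mu ≠ 0) {s : ℝ}
    (hs : ((d + 1 : ℕ) : ℝ) < s) :
    ∫⁻ p : Pt d, ENNReal.ofReal (Real.exp (-(lam * p.1)) * symb lam mu p ^ (-(s / 2))) < ∞ := by
  have h := (integrable_exp_mul_symb_cpow (z := (s : ℂ)) (d := d) hlam hmu (by simpa using hs)).2
  refine lt_of_eq_of_lt (lintegral_congr fun p => ?_) h
  rw [← ofReal_norm, norm_mul, norm_ofReal_cpow_neg (symb_pos lam hmu p), Complex.norm_real,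
    Real.norm_of_nonneg (Real.exp_pos _).le]
  congr 3
  simp

/-- The weight `(1 + |g⃗|²)^{-M}`, cut off to the strip `|g₀| ≤ R`. -/
def stripWeight (R : ℝ) (M : ℕ) (g : Pt d) : ℝ :=
  if |g.1| ≤ R then ((1 + ‖g.2‖ ^ 2) ^ M)⁻¹ else 0

@[fun_prop]
theorem measurable_stripWeight (R : ℝ) (M : ℕ) : Measurable (stripWeight R M : Pt d → ℝ) := by
  exact Measurable.ite (measurableSet_le (by fun_prop) measurable_const) (by fun_prop)
    measurable_const

theorem lintegral_stripWeight_lt_top (c R : ℝ) {M : ℕ} (hM : d < M) :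
    ∫⁻ g : Pt d, ENNReal.ofReal (Real.exp (-(c * g.1)) * stripWeight R M g ^ 2) < ∞ := by
  have hI : Integrable (fun x : EuclideanSpace ℝ (Fin d) =>
      (1 + ‖x‖ ^ 2) ^ (-(4 * M : ℝ) / 2)) := by
    refine integrable_rpow_neg_one_add_norm_sq ?_
    rw [finrank_euclideanSpace_fin]
    have : (d : ℝ) < M := by exact_mod_cast hM
    linarith [(Nat.cast_nonneg M : (0 : ℝ) ≤ M)]
  have hJ : Integrable ((Set.Icc (-R) R).indicator fun _ : ℝ => Real.exp (|c| * R)) :=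
    (integrable_indicator_iff measurableSet_Icc).2 (integrableOn_const (by simp))
  have h := (hJ.mul_prod hI).2
  refine lt_of_le_of_lt (lintegral_mono fun g => ?_) h
  rw [← ofReal_norm]
  refine ENNReal.ofReal_le_ofReal ?_
  by_cases hg : |g.1| ≤ R
  · have h1 : stripWeight R M g = ((1 + ‖g.2‖ ^ 2) ^ M)⁻¹ := if_pos hg
    have hpos : 0 < 1 + ‖g.2‖ ^ 2 := by positivity
    have h2 : (1 + ‖g.2‖ ^ 2) ^ (-(4 * M : ℝ) / 2) = stripWeight R M g ^ 2 := by
      rw [h1, show (-(4 * M : ℝ) / 2) = -((M * 2 : ℕ) : ℝ) by push_cast; ring,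
        Real.rpow_neg hpos.le, Real.rpow_natCast, pow_mul, inv_pow]
    simp only
    rw [Set.indicator_of_mem (Set.mem_Icc.2 (abs_le.1 hg)), h2, norm_mul, Real.norm_of_nonneg (sq_nonneg _),
      Real.norm_of_nonneg (Real.exp_pos _).le]
    refine mul_le_mul_of_nonneg_right (Real.exp_le_exp.2 ?_) (sq_nonneg _)
    calc -(c * g.1) ≤ |c * g.1| := neg_le_abs _
      _ = |c| * |g.1| := abs_mul _ _
      _ ≤ _ := by gcongr
  · have h1 : stripWeight R M g = 0 := if_neg hg
    rw [h1]
    simp only [ne_eq, OfNat.ofNat_ne_zero, not_false_eq_true, zero_pow, mul_zero]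
    positivity

theorem memLp_two_of_weight {Y : Type*} [MeasureSpace Y] [SFinite (volume : Measure Y)]
    {U : Pt d × (Pt d × Y) → ℂ} (hU : Measurable U) {u : Pt d → Pt d → ℝ≥0∞} {w : Y → ℂ}
    (hw : Integrable w) (hle : ∀ a γ y, ‖U (a, (γ, y))‖ₑ ^ 2 ≤ u a γ * ‖w y‖ₑ)
    (hu : ∫⁻ a, ∫⁻ γ, u a γ ∂volume ∂(momMeasure d lam) ≠ ∞) :
    MemLp U 2 ((momMeasure d lam).prod volume) := by
  refine ⟨hU.aestronglyMeasurable, ?_⟩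
  have hfin : ∫⁻ p, ‖U p‖ₑ ^ 2 ∂((momMeasure d lam).prod volume) < ∞ := by
    rw [lintegral_prod _ (by fun_prop)]
    calc ∫⁻ a, ∫⁻ x, ‖U (a, x)‖ₑ ^ 2 ∂volume ∂(momMeasure d lam)
        ≤ ∫⁻ a, ∫⁻ γ, u a γ * ∫⁻ y, ‖w y‖ₑ ∂volume ∂volume ∂(momMeasure d lam) := by
          refine lintegral_mono fun a => ?_
          change ∫⁻ x, ‖U (a, x)‖ₑ ^ 2 ∂(volume.prod volume) ≤ _
          rw [lintegral_prod _ (by fun_prop)]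
          refine lintegral_mono fun γ => ?_
          rw [← lintegral_const_mul'' _ hw.1.enorm]
          exact lintegral_mono fun y => hle a γ y
      _ = (∫⁻ a, ∫⁻ γ, u a γ ∂volume ∂(momMeasure d lam)) * ∫⁻ y, ‖w y‖ₑ := by
          simp only [lintegral_mul_const' _ _ hw.2.ne]
      _ < ∞ := ENNReal.mul_lt_top hu.lt_top hw.2
  rw [← eLpNorm_two_sq] at hfin
  exact (ENNReal.pow_lt_top_iff.1 hfin).resolve_right two_ne_zero

/-- The weight `r(γ)` used to balance the two factors of the kernel. -/
def gauge (lam mu s : ℝ) (γ : Pt d) : ℝ :=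
  Real.exp (lam * (d + 1) * γ.1 / 2) * symb lam mu γ ^ (-(s / 4))

theorem gauge_pos (hmu : mu ≠ 0) (s : ℝ) (γ : Pt d) : 0 < gauge lam mu s γ :=
  mul_pos (Real.exp_pos _) (Real.rpow_pos_of_pos (symb_pos lam hmu γ) _)

@[fun_prop]
theorem measurable_gauge (s : ℝ) : Measurable (gauge lam mu s : Pt d → ℝ) := by
  have := measurable_symb (lam := lam) (mu := mu) (d := d)
  unfold gauge
  fun_prop

theorem gauge_sq (hmu : mu ≠ 0) (s : ℝ) (γ : Pt d) :
    gauge lam mu s γ ^ 2 = Real.exp (lam * (d + 1) * γ.1) * symb lam mu γ ^ (-(s / 2)) := by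
  rw [gauge, mul_pow, ← Real.exp_nat_mul, ← Real.rpow_mul_natCast (symb_pos lam hmu γ).le]
  congr 2 <;> push_cast <;> ring

theorem lintegral_left_factor_ne_top (hlam : 0 < lam) (hmu : mu ≠ 0) {s : ℝ}
    (hs : ((d + 1 : ℕ) : ℝ) < s) (R : ℝ) {M : ℕ} (hM : d < M) :
    ∫⁻ a : Pt d, ∫⁻ γ : Pt d, ENNReal.ofReal ((Real.exp (-(lam * a.1)) *
      stripWeight R M (quot lam a γ) * gauge lam mu s γ) ^ 2) ∂volume ∂(momMeasure d lam) ≠ ∞ := by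
  rw [lintegral_lintegral_swap (by unfold Function.uncurry; fun_prop)]
  set F : Pt d → ℝ≥0∞ := fun g =>
    ENNReal.ofReal (Real.exp (-((lam * (d + 2)) * g.1)) * stripWeight R M g ^ 2) with hFd
  have hF : Measurable F := by fun_prop
  have h1 : ∀ γ : Pt d, ∫⁻ a : Pt d, ENNReal.ofReal ((Real.exp (-(lam * a.1)) *
      stripWeight R M (quot lam a γ) * gauge lam mu s γ) ^ 2) ∂(momMeasure d lam) =
      ENNReal.ofReal (Real.exp (-(lam * γ.1)) * symb lam mu γ ^ (-(s / 2))) *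
        (ENNReal.ofReal (twoPiInv d) * ∫⁻ g, F g) := by
    intro γ
    have hc := twoPiInv_pos d
    have hsy := Real.rpow_pos_of_pos (symb_pos lam hmu γ) (-(s / 2))
    rw [lintegral_momMeasure (by fun_prop), ← lintegral_comp_quot_left (lam := lam) γ hF,
      ← lintegral_const_mul' _ _ ENNReal.ofReal_ne_top,
      ← lintegral_const_mul' _ _ ENNReal.ofReal_ne_top]
    refine lintegral_congr fun a => ?_
    simp only [hFd]
    rw [← ENNReal.ofReal_mul (by positivity), ← ENNReal.ofReal_mul (by positivity),
      ← ENNReal.ofReal_mul (by positivity), mul_pow, mul_pow, gauge_sq hmu, ← Real.exp_nat_mul]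
    have he : Real.exp (-(lam * d * a.1)) * Real.exp ((2 : ℕ) * -(lam * a.1)) *
        Real.exp (lam * (d + 1) * γ.1) = Real.exp (-(lam * γ.1)) *
          Real.exp (-((lam * (d + 2)) * (quot lam a γ).1)) := by
      simp only [← Real.exp_add, quot]
      congr 1
      push_cast
      ring
    congr 1
    linear_combination (twoPiInv d * stripWeight R M (quot lam a γ) ^ 2 *
      symb lam mu γ ^ (-(s / 2))) * he
  simp only [h1]
  have hfin : ENNReal.ofReal (twoPiInv d) * ∫⁻ g, F g ≠ ∞ :=
    ENNReal.mul_ne_top ENNReal.ofReal_ne_top (lintegral_stripWeight_lt_top _ _ hM).ne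
  rw [lintegral_mul_const' _ _ hfin]
  exact ENNReal.mul_ne_top (lintegral_exp_mul_symb_rpow_lt_top hlam hmu hs).ne hfin

theorem lintegral_right_factor_ne_top (hlam : 0 < lam) (hmu : mu ≠ 0) {s : ℝ}
    (hs : ((d + 1 : ℕ) : ℝ) < s) (ρ : ℝ) :
    ∫⁻ b : Pt d, ∫⁻ γ : Pt d, ENNReal.ofReal (((Metric.closedBall 0 ρ).indicator 1 (quot lam b γ) *
      symb lam mu b ^ (-(s / 2)) * Real.exp (lam * d * b.1) * (gauge lam mu s γ)⁻¹) ^ 2)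
      ∂volume ∂(momMeasure d lam) ≠ ∞ := by
  obtain ⟨C, hC0, hC⟩ := exists_symb_le (d := d) hlam hmu ρ
  have hs0 : 0 < s := lt_of_le_of_lt (Nat.cast_nonneg _) hs
  have hc := twoPiInv_pos d
  set F : Pt d → ℝ≥0∞ := fun g => (Metric.closedBall 0 ρ).indicator
    (fun q => ENNReal.ofReal (Real.exp (lam * (d + 1) * q.1))) g with hFd
  have hF : Measurable F := Measurable.indicator (by fun_prop) Metric.isClosed_closedBall.measurableSet
  have hFfin : ∫⁻ g : Pt d, ENNReal.ofReal (Real.exp (lam * d * g.1)) * F g ≠ ∞ := by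
    have hcont : IntegrableOn (fun g : Pt d => Real.exp (lam * d * g.1) *
        Real.exp (lam * (d + 1) * g.1)) (Metric.closedBall 0 ρ) :=
      ContinuousOn.integrableOn_compact (isCompact_closedBall _ _) (by fun_prop)
    have h := ((integrable_indicator_iff Metric.isClosed_closedBall.measurableSet).2 hcont).2
    refine (lt_of_le_of_lt (lintegral_mono fun g => ?_) h).ne
    by_cases hg : g ∈ Metric.closedBall (0 : Pt d) ρ
    · simp only [hFd, Set.indicator_of_mem hg]
      rw [← ENNReal.ofReal_mul (by positivity), ← ofReal_norm,
        Real.norm_of_nonneg (by positivity)]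
    · simp [hFd, Set.indicator_of_notMem hg]
  have hb : ∀ b γ : Pt d, ((Metric.closedBall 0 ρ).indicator 1 (quot lam b γ) *
      symb lam mu b ^ (-(s / 2)) * Real.exp (lam * d * b.1) * (gauge lam mu s γ)⁻¹) ^ 2 ≤
      (C ^ (s / 2) * symb lam mu b ^ (-(s / 2)) * Real.exp (lam * d * b.1) *
        Real.exp (-(lam * b.1))) * (Metric.closedBall 0 ρ).indicator
    (fun q => Real.exp (lam * (d + 1) * q.1)) (quot lam b γ) := by
    intro b γ
    have hsb := symb_pos lam hmu b
    have hsγ := symb_pos lam hmu γ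
    by_cases hg : quot lam b γ ∈ Metric.closedBall (0 : Pt d) ρ
    · rw [Set.indicator_of_mem hg, Set.indicator_of_mem hg, Pi.one_apply, one_mul, mul_pow, mul_pow,
        inv_pow, gauge_sq hmu, mul_inv, ← Real.rpow_neg hsγ.le, neg_neg]
      have h1 : symb lam mu γ ^ (s / 2) ≤ C ^ (s / 2) * symb lam mu b ^ (s / 2) := by
        rw [← Real.mul_rpow hC0.le hsb.le]
        exact Real.rpow_le_rpow hsγ.le (hC b γ (by simpa using hg)) (by positivity)
      have h2 : symb lam mu b ^ (-(s / 2)) * symb lam mu b ^ (s / 2) = 1 := by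
        rw [← Real.rpow_add hsb]
        simp
      have h3 : Real.exp (lam * d * b.1) * (Real.exp (lam * (d + 1) * γ.1))⁻¹ =
          Real.exp (-(lam * b.1)) * Real.exp (lam * (d + 1) * (quot lam b γ).1) := by
        simp only [← Real.exp_neg, ← Real.exp_add, quot]
        congr 1
        ring
      have hp := Real.rpow_pos_of_pos hsb (-(s / 2))
      calc _ ≤ (symb lam mu b ^ (-(s / 2))) ^ 2 * Real.exp (lam * d * b.1) ^ 2 *
            ((Real.exp (lam * (d + 1) * γ.1))⁻¹ * (C ^ (s / 2) * symb lam mu b ^ (s / 2))) := by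
            gcongr
        _ = C ^ (s / 2) * symb lam mu b ^ (-(s / 2)) * Real.exp (lam * d * b.1) *
            (symb lam mu b ^ (-(s / 2)) * symb lam mu b ^ (s / 2)) *
            (Real.exp (lam * d * b.1) * (Real.exp (lam * (d + 1) * γ.1))⁻¹) := by ring
        _ = _ := by rw [h2, h3]; ring
    · rw [Set.indicator_of_notMem hg, Set.indicator_of_notMem hg]
      simp
  have hm : Measurable fun b : Pt d => ENNReal.ofReal
      (C ^ (s / 2) * symb lam mu b ^ (-(s / 2)) * Real.exp (lam * d * b.1) *
        Real.exp (-(lam * b.1))) := by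
    have := measurable_symb (lam := lam) (mu := mu) (d := d)
    fun_prop
  refine ne_top_of_le_ne_top ?_ (lintegral_mono fun b => lintegral_mono fun γ =>
    ENNReal.ofReal_le_ofReal (hb b γ))
  have h1 : ∀ b : Pt d, ∫⁻ γ : Pt d, ENNReal.ofReal
      ((C ^ (s / 2) * symb lam mu b ^ (-(s / 2)) * Real.exp (lam * d * b.1) *
        Real.exp (-(lam * b.1))) * (Metric.closedBall 0 ρ).indicator
        (fun q => Real.exp (lam * (d + 1) * q.1)) (quot lam b γ)) =
      ENNReal.ofReal (C ^ (s / 2) * symb lam mu b ^ (-(s / 2)) * Real.exp (lam * d * b.1) *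
        Real.exp (-(lam * b.1))) * ∫⁻ g : Pt d, ENNReal.ofReal (Real.exp (lam * d * g.1)) * F g := by
    intro b
    have hp := Real.rpow_pos_of_pos (symb_pos lam hmu b) (-(s / 2))
    rw [← lintegral_comp_quot_right (lam := lam) b hF,
      ← lintegral_const_mul' _ _ ENNReal.ofReal_ne_top]
    refine lintegral_congr fun γ => ?_
    rw [ENNReal.ofReal_mul (by positivity)]
    congr 1
    by_cases hg : quot lam b γ ∈ Metric.closedBall (0 : Pt d) ρ
    · simp only [hFd, Set.indicator_of_mem hg]
    · simp [hFd, Set.indicator_of_notMem hg]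
  simp only [h1]
  rw [lintegral_mul_const' _ _ hFfin, lintegral_momMeasure hm]
  refine ENNReal.mul_ne_top ?_ hFfin
  have h2 := lintegral_exp_mul_symb_rpow_lt_top (d := d) hlam hmu hs
  refine ne_of_eq_of_ne (b := ENNReal.ofReal (twoPiInv d * C ^ (s / 2)) *
    ∫⁻ p : Pt d, ENNReal.ofReal (Real.exp (-(lam * p.1)) * symb lam mu p ^ (-(s / 2)))) ?_
    (ENNReal.mul_ne_top ENNReal.ofReal_ne_top h2.ne)
  rw [← lintegral_const_mul' _ _ ENNReal.ofReal_ne_top]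
  refine lintegral_congr fun b => ?_
  rw [← ENNReal.ofReal_mul (by positivity), ← ENNReal.ofReal_mul (by positivity)]
  congr 1
  have h3 : Real.exp (-(lam * d * b.1)) * Real.exp (lam * d * b.1) = 1 := by
    rw [← Real.exp_add]
    simp
  linear_combination (twoPiInv d * C ^ (s / 2) * symb lam mu b ^ (-(s / 2)) *
    Real.exp (-(lam * b.1))) * h3

/-- A smooth partition of unity, continuous in the parameter: a bump function `φ` with
`∫ φ(b γ⁻¹) dγ = 1` for all `b`. -/
theorem exists_bump (d : ℕ) (lam : ℝ) : ∃ (φ : 𝓢(Pt d, ℂ)) (ρ : ℝ),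
    (∀ q, ρ < ‖q‖ → φ q = 0) ∧ ∀ b : Pt d, ∫ γ, φ (quot lam b γ) = 1 := by
  let χ : ContDiffBump (0 : Pt d) := ⟨1, 2, one_pos, one_lt_two⟩
  have hχc : Continuous χ := χ.contDiff (n := 0) |>.continuous
  set c := ∫ g : Pt d, Real.exp (lam * d * g.1) * χ g with hcd
  have hc : 0 < c := by
    refine Continuous.integral_pos_of_hasCompactSupport_nonneg_nonzero (x := 0) (by fun_prop)
      χ.hasCompactSupport.mul_left (fun g => mul_nonneg (Real.exp_pos _).le χ.nonneg) ?_
    rw [χ.one_of_mem_closedBall (Metric.mem_closedBall_self χ.rIn_pos.le)]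
    simp
  have hs : HasCompactSupport fun g => ((c⁻¹ * χ g : ℝ) : ℂ) :=
    (HasCompactSupport.mul_left χ.hasCompactSupport).comp_left Complex.ofReal_zero
  have hd : ContDiff ℝ (⊤ : ℕ∞) fun g => ((c⁻¹ * χ g : ℝ) : ℂ) :=
    Complex.ofRealCLM.contDiff.comp (contDiff_const.mul χ.contDiff)
  refine ⟨hs.toSchwartzMap hd, 2, fun q hq => ?_, fun b => ?_⟩
  · change ((c⁻¹ * χ q : ℝ) : ℂ) = 0
    rw [χ.zero_of_le_dist (by simpa using hq.le)]
    simp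
  · rw [integral_comp_quot_right b (hs.toSchwartzMap hd).continuous]
    change ∫ g : Pt d, (Real.exp (lam * d * g.1) : ℂ) * ((c⁻¹ * χ g : ℝ) : ℂ) = 1
    simp only [← Complex.ofReal_mul, mul_left_comm _ c⁻¹]
    rw [integral_complex_ofReal, integral_const_mul, ← hcd, inv_mul_cancel₀ hc.ne']
    simp

end KernelFactors

section NuclearKernel

variable {d : ℕ} {lam mu : ℝ} {z : ℂ}

/-- The integral kernel of `Δ_Φ π(f) (D² + μ²)^{-z/2}`, with `k = 𝓕 f`, for the measure
`momMeasure`. -/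
def zetaKernel (lam mu : ℝ) (z : ℂ) (k : Pt d → ℂ) (a b : Pt d) : ℂ :=
  (Real.exp (-(lam * a.1)) : ℂ) * (k (quot lam a b) * (Real.exp (lam * d * b.1) : ℂ) *
    ((symb lam mu b : ℝ) : ℂ) ^ (-(z / 2)))

theorem integral_zetaKernel_diag (hlam : 0 < lam) (hmu : mu ≠ 0)
    (hz : ((d + 1 : ℕ) : ℝ) < z.re) (k : Pt d → ℂ) :
    ∫ a, zetaKernel lam mu z k a a ∂(momMeasure d lam) =
      (twoPiInv d : ℂ) * k 0 * Itot (d + 1) lam mu z := by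
  rw [integral_momMeasure, ← integral_exp_mul_symb_cpow hlam hmu hz, ← integral_const_mul]
  congr 1
  ext a
  have h : Real.exp (-(lam * d * a.1)) * Real.exp (lam * d * a.1) = 1 := by
    rw [← Real.exp_add]
    simp
  have h' : (Real.exp (-(lam * d * a.1)) : ℂ) * (Real.exp (lam * d * a.1) : ℂ) = 1 := by
    exact_mod_cast h
  rw [zetaKernel, quot_self, Complex.ofReal_mul]
  linear_combination ((twoPiInv d : ℂ) * (Real.exp (-(lam * a.1)) : ℂ) * k 0 *
    ((symb lam mu a : ℝ) : ℂ) ^ (-(z / 2))) * h'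

/-- The kernel of `Δ_Φ π(f) (D² + μ²)^{-z/2}` is the composition of two square integrable
kernels. -/
theorem exists_zetaKernel_factorization (hlam : 0 < lam) (hmu : mu ≠ 0)
    (hz : ((d + 1 : ℕ) : ℝ) < z.re) {k : 𝓢(Pt d, ℂ)} (hk : IsSc k) :
    ∃ (N : ℕ) (U V : Pt d × (Pt d × EuclideanSpace ℝ (Fin N)) → ℂ), Measurable U ∧ Measurable V ∧
      MemLp U 2 ((momMeasure d lam).prod volume) ∧ MemLp V 2 ((momMeasure d lam).prod volume) ∧
      ∀ a b, MemLp (fun x => U (a, x)) 2 volume → MemLp (fun x => V (b, x)) 2 volume →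
        ∫ x, U (a, x) * conj (V (b, x)) = zetaKernel lam mu z k a b := by
  obtain ⟨φ, ρ, hφ0, hφ1⟩ := exists_bump d lam
  obtain ⟨S, hS⟩ := exists_schwartz_kernel lam (d + 1) hk φ
  obtain ⟨N, w, α, β, hα, hβ, hα1, hβ1, hSw⟩ := exists_schwartz_expansion S
  obtain ⟨K, hK, hkK⟩ := hk
  obtain ⟨R, hR⟩ := hK.isBounded.exists_norm_le
  have hαm := hα.measurable
  have hβm := hβ.measurable
  have hwm : Measurable w := w.continuous.measurable
  have hcm : Measurable fun b : Pt d => ((symb lam mu b : ℝ) : ℂ) ^ (-(z / 2)) :=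
    (continuous_symb_cpow lam hmu _).measurable
  set θ : Pt d → ℝ := stripWeight (R + ρ) (d + 1) with hθ
  have hθm : Measurable θ := measurable_stripWeight _ _
  set Q : Pt d → ℝ := (Metric.closedBall (0 : Pt d) ρ).indicator 1 with hQ
  have hQm : Measurable Q :=
    Measurable.indicator measurable_one Metric.isClosed_closedBall.measurableSet
  set r : Pt d → ℝ := gauge lam mu z.re with hr
  have hrm : Measurable r := measurable_gauge _
  have hr0 : ∀ γ, 0 < r γ := gauge_pos hmu _
  let U : Pt d × (Pt d × EuclideanSpace ℝ (Fin N)) → ℂ := fun p =>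
    ((Real.exp (-(lam * p.1.1)) * θ (quot lam p.1 p.2.1) * r p.2.1 : ℝ) : ℂ) *
      ((√‖w p.2.2‖ : ℝ) * α (p.2.2, quot lam p.1 p.2.1))
  let W : Pt d × (Pt d × EuclideanSpace ℝ (Fin N)) → ℂ := fun p =>
    (Q (quot lam p.1 p.2.1) : ℂ) * ((symb lam mu p.1 : ℝ) : ℂ) ^ (-(z / 2)) *
      ((Real.exp (lam * d * p.1.1) * (r p.2.1)⁻¹ : ℝ) : ℂ) *
      ((w p.2.2 / (√‖w p.2.2‖ : ℝ)) * β (p.2.2, quot lam p.1 p.2.1))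
  have hUm : Measurable U := by
    simp only [U]
    fun_prop
  have hWm : Measurable W := by
    have : Measurable fun p : Pt d × (Pt d × EuclideanSpace ℝ (Fin N)) =>
        ((symb lam mu p.1 : ℝ) : ℂ) ^ (-(z / 2)) := hcm.comp measurable_fst
    simp only [W]
    fun_prop
  have hVm : Measurable fun p => conj (W p) := Complex.continuous_conj.measurable.comp hWm
  refine ⟨N, U, fun p => conj (W p), hUm, hVm, ?_, ?_, fun a b hUa hVb => ?_⟩
  · refine memLp_two_of_weight hUm w.integrable (fun a γ y => le_of_eq ?_)
      (lintegral_left_factor_ne_top hlam hmu hz (R + ρ) (Nat.lt_succ_self d))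
    rw [← ofReal_norm, ← ofReal_norm, ← ENNReal.ofReal_pow (norm_nonneg _),
      ← ENNReal.ofReal_mul (sq_nonneg _)]
    simp only [U, norm_mul, hα1, Complex.norm_real, mul_one, mul_pow, Real.norm_eq_abs, sq_abs,
      Real.sq_sqrt (norm_nonneg _)]
    rfl
  · refine memLp_two_of_weight hVm w.integrable (fun a γ y => le_of_eq ?_)
      (lintegral_right_factor_ne_top hlam hmu hz ρ)
    rw [← ofReal_norm, ← ofReal_norm, ← ENNReal.ofReal_pow (norm_nonneg _),
      ← ENNReal.ofReal_mul (sq_nonneg _)]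
    have h1 : (‖w y‖ / √‖w y‖) ^ 2 = ‖w y‖ := by
      rw [Real.div_sqrt, Real.sq_sqrt (norm_nonneg _)]
    have h2 : (z / 2).re = z.re / 2 := by simp
    simp only [RCLike.norm_conj, W, norm_mul, norm_div, hβ1, Complex.norm_real, mul_one, mul_pow,
      Real.norm_eq_abs, sq_abs, norm_ofReal_cpow_neg (symb_pos lam hmu a), h2,
      abs_of_nonneg (Real.sqrt_nonneg _), h1]
    congr 1
    ring
  · have hint : Integrable (fun x => U (a, x) * W (b, x)) (volume.prod volume) := by
      refine (hUa.integrable_mul hVb.star).congr (.of_forall fun x => ?_)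
      simp
    simp only [Complex.conj_conj]
    have hpt : ∀ γ y, U (a, (γ, y)) * W (b, (γ, y)) =
        ((Real.exp (-(lam * a.1)) : ℂ) * (Real.exp (lam * d * b.1) : ℂ) *
          ((symb lam mu b : ℝ) : ℂ) ^ (-(z / 2)) * (θ (quot lam a γ) * Q (quot lam b γ))) *
          (w y * (α (y, quot lam a γ) * β (y, quot lam b γ))) := by
      intro γ y
      have h1 : ((r γ : ℝ) : ℂ) * ((r γ : ℝ) : ℂ)⁻¹ = 1 :=
        mul_inv_cancel₀ (by exact_mod_cast (hr0 γ).ne')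
      have h2 : ((√‖w y‖ : ℝ) : ℂ) * (w y / (√‖w y‖ : ℝ)) = w y := by
        by_cases hw : w y = 0
        · simp [hw]
        · refine mul_div_cancel₀ _ ?_
          have : 0 < √‖w y‖ := Real.sqrt_pos.2 (norm_pos_iff.2 hw)
          exact_mod_cast this.ne'
      simp only [U, W]
      push_cast
      calc _ = ((Real.exp (-(lam * a.1)) : ℂ) * (Real.exp (lam * d * b.1) : ℂ) *
          ((symb lam mu b : ℝ) : ℂ) ^ (-(z / 2)) * (θ (quot lam a γ) * Q (quot lam b γ))) *
          ((((r γ : ℝ) : ℂ) * ((r γ : ℝ) : ℂ)⁻¹) *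
          (((√‖w y‖ : ℝ) : ℂ) * (w y / (√‖w y‖ : ℝ))) *
            (α (y, quot lam a γ) * β (y, quot lam b γ))) := by
            push_cast
            ring
        _ = _ := by
            rw [h1, h2]
            push_cast
            ring
    have hcut : ∀ γ, ((θ (quot lam a γ) : ℝ) : ℂ) * (Q (quot lam b γ) : ℝ) *
        S (quot lam a γ, quot lam b γ) = k (quot lam a b) * φ (quot lam b γ) := by
      intro γ
      rw [hS, quot_quot_quot]
      by_cases h0 : k (quot lam a b) * φ (quot lam b γ) = 0
      · rw [h0]
        simp
      · obtain ⟨hk0, hp0⟩ := mul_ne_zero_iff.1 h0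
        have hq : ‖quot lam b γ‖ ≤ ρ := not_lt.1 fun h => hp0 (hφ0 _ h)
        have hQ1 : Q (quot lam b γ) = 1 := by
          rw [hQ, Set.indicator_of_mem (by simpa using hq), Pi.one_apply]
        have hstrip : |(quot lam a γ).1| ≤ R + ρ := by
          have h1 : |a.1 - b.1| ≤ R := hR _ (hkK hk0).1
          have h2 : |b.1 - γ.1| ≤ ρ := (norm_fst_le (quot lam b γ)).trans hq
          calc |a.1 - γ.1| = |(a.1 - b.1) + (b.1 - γ.1)| := by ring_nf
            _ ≤ _ := (abs_add_le _ _).trans (add_le_add h1 h2)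
        have hθ1 : θ (quot lam a γ) = ((1 + ‖(quot lam a γ).2‖ ^ 2) ^ (d + 1))⁻¹ := if_pos hstrip
        have hpos : ((1 + ‖(quot lam a γ).2‖ ^ 2) ^ (d + 1) : ℝ) ≠ 0 := by positivity
        rw [hQ1, hθ1, Complex.ofReal_one, mul_one, ← mul_assoc, ← Complex.ofReal_mul,
          inv_mul_cancel₀ hpos, Complex.ofReal_one, one_mul]
    change ∫ x, U (a, x) * W (b, x) ∂(volume.prod volume) = _
    rw [integral_prod _ hint]
    have hy : ∀ γ, ∫ y, U (a, (γ, y)) * W (b, (γ, y)) =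
        ((Real.exp (-(lam * a.1)) : ℂ) * (Real.exp (lam * d * b.1) : ℂ) *
          ((symb lam mu b : ℝ) : ℂ) ^ (-(z / 2)) * k (quot lam a b)) * φ (quot lam b γ) := by
      intro γ
      simp only [hpt, integral_const_mul]
      rw [← hSw, mul_assoc, hcut]
      ring
    simp only [hy]
    rw [integral_const_mul, hφ1, zetaKernel]
    ring

theorem exists_nuclear_zetaKernel (hlam : 0 < lam) (hmu : mu ≠ 0)
    (hz : ((d + 1 : ℕ) : ℝ) < z.re) {k : 𝓢(Pt d, ℂ)} (hk : IsSc k) :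
    ∃ (T : Hr d lam →L[ℂ] Hr d lam) (κ : Type) (x y : κ → Hr d lam),
      (∀ ψ, T ψ =ᵐ[momMeasure d lam] fun a =>
        ∫ b, zetaKernel lam mu z k a b * ψ b ∂(momMeasure d lam)) ∧
      Countable κ ∧ IsNuclearSum T x y ∧
      HasSum (fun i => inner ℂ (x i) (y i)) ((twoPiInv d : ℂ) * k 0 * Itot (d + 1) lam mu z) := by
  obtain ⟨N, U, V, hU, hV, hU2, hV2, hUV⟩ := exists_zetaKernel_factorization hlam hmu hz hk
  have : Fact ((2 : ℝ≥0∞) ≠ ∞) := ⟨ENNReal.ofNat_ne_top⟩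
  have : MeasurableSpace.CountablyGenerated (Pt d × EuclideanSpace ℝ (Fin N)) := inferInstance
  have : SFinite (volume : Measure (Pt d × EuclideanSpace ℝ (Fin N))) := inferInstance
  have : SecondCountableTopology
      (Lp ℂ 2 (volume : Measure (Pt d × EuclideanSpace ℝ (Fin N)))) := inferInstance
  obtain ⟨T, κ, x, y, hT, hκ, hnuc, hsum⟩ := exists_nuclear_of_factorization hU hU2 hV hV2
  have hUs := ae_memLp_section hU hU2
  have hVs := ae_memLp_section hV hV2
  refine ⟨T, κ, x, y, fun ψ => (hT ψ).trans ?_, hκ, hnuc, ?_⟩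
  · filter_upwards [hUs] with a ha
    refine integral_congr_ae ?_
    filter_upwards [hVs] with b hb
    rw [hUV a b ha hb]
  · rw [← integral_zetaKernel_diag hlam hmu hz]
    convert hsum using 1
    refine integral_congr_ae ?_
    filter_upwards [hUs, hVs] with a ha hb
    rw [hUV a a ha hb]

end NuclearKernel

section Zeta

variable {d : ℕ} {lam mu : ℝ} {z : ℂ}

theorem exp_mul_leftMulSpin_sqAddPow_ae_eq
    {Γ : Fin (d + 1) → Matrix (Fin (spinDim d)) (Fin (spinDim d)) ℂ} (hΓ : IsClifford Γ)
    (hmu : mu ≠ 0) (hz : 0 < z.re) {f : 𝓢(Pt d, ℂ)} (hf : f ∈ algA d) (ψ : HSpin d lam)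
    (j : Fin (spinDim d)) :
    (fun a : Pt d => ((Real.exp (-(lam * a.1)) : ℝ) : ℂ) *
        (leftMulSpin lam f ∘L sqAddPow (dirac lam Γ) mu z) ψ j a) =ᵐ[momMeasure d lam]
      fun a => ∫ b, zetaKernel lam mu z (fourierS f) a b * ψ j b ∂(momMeasure d lam) := by
  have h1 := leftMul_ae_eq lam hf (sqAddPow (dirac lam Γ) mu z ψ j)
  have h2 := sqAddPow_dirac_ae_eq hΓ hmu hz ψ j
  filter_upwards [h1] with a ha
  have hA : (leftMulSpin lam f ∘L sqAddPow (dirac lam Γ) mu z) ψ j a =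
      leftMul lam f (sqAddPow (dirac lam Γ) mu z ψ j) a := rfl
  rw [hA, ha, conv_eq_integral_momMeasure, ← integral_const_mul]
  refine integral_congr_ae ?_
  filter_upwards [h2] with b hb
  rw [hb, zetaKernel]
  ring

theorem modularOp_apply_ae_eq (ψ : (modularOp d lam).domain) (j : Fin (spinDim d)) :
    modularOp d lam ψ j =ᵐ[momMeasure d lam]
      fun p => ((Real.exp (-(lam * p.1)) : ℝ) : ℂ) * (ψ : HSpin d lam) j p := by
  filter_upwards [matOp_ae_eq ψ j] with p hp
  refine hp.trans ?_
  simp [Matrix.one_apply]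

theorem fourierS_zero (f : 𝓢(Pt d, ℂ)) : fourierS f 0 = ∫ x, f x := by
  simp [coe_fourierS, fourier, dot]

theorem hasZeta_of_mem_algA (hlam : 0 < lam) (hmu : mu ≠ 0)
    {Γ : Fin (d + 1) → Matrix (Fin (spinDim d)) (Fin (spinDim d)) ℂ} (hΓ : IsClifford Γ)
    (hz : ((d + 1 : ℕ) : ℝ) < z.re) {f : 𝓢(Pt d, ℂ)} (hf : f ∈ algA d) :
    HasZeta lam mu Γ f z
      ((2 : ℂ) ^ ((d + 1) / 2) / (2 * (Real.pi : ℂ)) ^ (d + 1) * Itot (d + 1) lam mu z *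
        ∫ x : Pt d, f x) := by
  have hz0 : 0 < z.re := lt_of_le_of_lt (Nat.cast_nonneg _) hz
  obtain ⟨T, κ, x, y, hT, hκ, hnuc, hsum⟩ :=
    exists_nuclear_zetaKernel hlam hmu hz (isSc_fourierS hf)
  have hae := fun ψ j => (exp_mul_leftMulSpin_sqAddPow_ae_eq (lam := lam) hΓ hmu hz0 hf ψ j).trans
    (hT (ψ j)).symm
  refine ⟨amplify (Fin (spinDim d)) T, fun ψ => ⟨fun _ j => ?_, ?_⟩, ?_⟩
  · exact (memLp_congr_ae (hae ψ j)).2 (Lp.memLp _)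
  · ext1 j
    rw [amplify_apply]
    exact Lp.ext ((modularOp_apply_ae_eq _ j).trans (hae ψ j))
  · convert (hnuc.amplify (S := amplify (Fin (spinDim d)) T) fun _ _ => rfl).hasTrace
      (hasSum_inner_amplify hnuc.1 hsum) using 1
    rw [fourierS_zero, Fintype.card_fin, twoPiInv]
    push_cast
    ring

end Zeta

end KMinkowski

end

open KMinkowski in
theorem mainTheorem4 (d : ℕ)
    (Γ : Fin (d + 1) → Matrix (Fin (spinDim d)) (Fin (spinDim d)) ℂ) (hΓ : IsClifford Γ)
    (mu : ℝ) (hmu : mu ≠ 0) (z : ℂ) (hz : ((d + 1 : ℕ) : ℝ) < z.re) :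
    Ic (d + 1) mu z =
        (Real.pi : ℂ) ^ (((d + 1 : ℕ) : ℂ) / 2) * ((|mu| : ℝ) : ℂ) ^ (((d + 1 : ℕ) : ℂ) - z) *
          (Complex.Gamma ((z - ((d + 1 : ℕ) : ℂ)) / 2) / Complex.Gamma (z / 2)) ∧
      (∀ lam : ℝ, 0 < lam → ∀ f ∈ algA d,
        HasZeta lam mu Γ f z
          ((2 : ℂ) ^ ((d + 1) / 2) / (2 * (Real.pi : ℂ)) ^ (d + 1) * Itot (d + 1) lam mu z *
            ∫ x : Pt d, f x)) ∧
      Tendsto (fun lam : ℝ => Itot (d + 1) lam mu z) (𝓝[>] 0) (𝓝 (Ic (d + 1) mu z)) := by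
  exact ⟨Ic_eq _ hmu hz, fun lam hlam f hf => hasZeta_of_mem_algA hlam hmu hΓ hz hf,
    tendsto_Itot hmu hz⟩
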